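/- Let $\Sigma$ be a compact metric space with Borel $\sigma$-field, $K$ a Markov kernel on $\Sigma$ and $\mu$ a $K$-stationary probability measure. Write $\|f\|_\infty=\sup|f|$. Assume $(K,\mu)$ is strongly mixing: there are $c>0$, $0<\rho<1$ with $$\Big|\int f\,dK^n(x,\cdot)-\int f\,d\mu\Big|\le c\,\rho^n\|f\|_\infty$$ for all bounded measurable $f:\Sigma\to\mathbb C$, $x\in\Sigma$, $n\in\mathbb N$. Let $\mathbb P_\mu$ be the law of the Markov chain $(x_n)_{n\ge0}$ with initial law $\mu$ and kernel $K$. Let $m\ge2$, and let $\mathcal B^\infty_m$ be the set of functions $A:\Sigma\times\Sigma\to \mathrm{GL}(m,\mathbb R)$ such that $A$ and $A^{-1}$ are measurable and uniformly bounded, with metric $d_\infty(A,B)=\sup_{x,y}\|A(x,y)-B(x,y)\|$ (operator norm). Put $A^{(n)}=A(x_{n-1},x_n)\cdots A(x_0,x_1)$. Let $\Lambda_j(A)$ be the $\mathbb P_\mu$-almost sure value of $\lim_n\frac1n\log\|\wedge_jA^{(n)}\|$ and $L_j(A)=\Lambda_j(A)-\Lambda_{j-1}(A)$. Call $A$ irreducible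 if there is no measurable family of subspaces $V(x)\subset\mathbb R^m$ ($x\in\Sigma$), of $\mu$-a.e. constant dimension strictly between $0$ and $m$, such that $\mathbb P_\mu$-almost surely $A(x_n,x_{n+1})V(x_n)=V(x_{n+1})$ for all $n$. For $B\in\mathcal B^\infty_m$, define on $\Sigma\times\Sigma\times\mathbb P(\mathbb R^m)$ the Markov kernel $K_B(x,y,p)=\int_\Sigma\delta_{(y,z,B(y,z)p)}\,K(y,dz)$ and the Markov operator $(Q_Bf)(x,y,p)=\int_\Sigma f(y,z,B(y,z)p)\,K(y,dz)$. Let $\delta(p,q)=\|v\wedge w\|/(\|v\|\|w\|)$ for lines $p=\mathbb Rv$, $q=\mathbb Rw$. For $0<\alpha\le1$ put $$v_\alpha(f)=\sup_{x,y,\;p\ne q}\frac{|f(x,y,p)-f(x,y,q)|}{\delta(p,q)^\alpha},\qquad \|f\|_\alpha=v_\alpha(f)+\|f\|_\infty,$$ and let $\mathscr H_\alpha(\Sigma\times\mathbb P(\mathbb R^m))$ be the space of bounded measurable complex functions $f(x,y,p)$ that do not depend on $x$ and satisfy $v_\alpha(f)<\infty$. **Proposition.** Let $A\in\mathcal B^\infty_m$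 be irreducible with $L_1(A)>L_2(A)$. Then there are a neighborhood $\mathscr V$ of $A$ in $\mathcal B^\infty_m$, exponents $0<\alpha_1<\frac{\alpha_0}2<\alpha_0\le1$, and constants $C>0$, $0<\sigma<1$, such that for every $B\in\mathscr V$ the kernel $K_B$ has a unique stationary probability measure $\mu_B$, and for all $\alpha\in[\alpha_1,\alpha_0]$, $f\in\mathscr H_\alpha(\Sigma\times\mathbb P(\mathbb R^m))$ and $n\in\mathbb N$ one has $Q_B^nf\in\mathscr H_\alpha(\Sigma\times\mathbb P(\mathbb R^m))$ and $$\|Q_B^nf-\langle f,\mu_B\rangle\mathbf 1\|_\alpha\le C\,\sigma^n\,\|f\|_\alpha ,\qquad \langle f,\mu_B\rangle=\int f\,d\mu_B .$$ -/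

import Mathlib

open MeasureTheory ProbabilityTheory Filter Topology

noncomputable section

namespace MarkovCocycle

/-! ### Euclidean space, exterior powers, projective space -/

/-- The Euclidean space `ℝᵐ`. -/
abbrev Euc (m : ℕ) : Type := EuclideanSpace ℝ (Fin m)

/-- Coordinates of the exterior power `⋀ᵏ ℝᵐ` in the basis `e_{i₁} ∧ ⋯ ∧ e_{iₖ}`, `i₁ < ⋯ < iₖ`,
which is orthonormal for the Euclidean structure of `⋀ᵏ ℝᵐ`. -/
def extCoord (m k : ℕ) :
    (⋀[ℝ]^k (Euc m)) ≃ₗ[ℝ] EuclideanSpace ℝ (Set.powersetCard (Fin m) k) :=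
  ((EuclideanSpace.basisFun (Fin m) ℝ).toBasis.exteriorPower k).equivFun ≪≫ₗ
    (WithLp.linearEquiv 2 ℝ (Set.powersetCard (Fin m) k → ℝ)).symm

/-- The Euclidean norm of a `k`-vector. -/
def extNorm {m k : ℕ} (ω : ⋀[ℝ]^k (Euc m)) : ℝ := ‖extCoord m k ω‖

/-- The operator norm of `∧ₖ T : ⋀ᵏ ℝᵐ → ⋀ᵏ ℝᵐ`. -/
def wedgeNorm {m : ℕ} (k : ℕ) (T : Euc m →L[ℝ] Euc m) : ℝ :=
  ‖LinearMap.toContinuousLinearMap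
    ((extCoord m k).toLinearMap ∘ₗ exteriorPower.map k T.toLinearMap ∘ₗ
      (extCoord m k).symm.toLinearMap)‖

/-- The projective space of `ℝᵐ`. -/
abbrev Proj (m : ℕ) : Type := Projectivization ℝ (Euc m)

/-- The quotient topology on projective space. -/
instance instTopologicalSpaceProj (m : ℕ) : TopologicalSpace (Proj m) :=
  inferInstanceAs (TopologicalSpace (Quotient (projectivizationSetoid ℝ (Euc m))))

/-- The Borel `σ`-field of projective space. -/
instance instMeasurableSpaceProj (m : ℕ) : MeasurableSpace (Proj m) := borel _

instance instBorelSpaceProj (m : ℕ) : BorelSpace (Proj m) := ⟨rfl⟩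

/-- The projective distance `δ(p, q) = ‖p ∧ q‖ / (‖p‖ ‖q‖)`. -/
def projDist {m : ℕ} (p q : Proj m) : ℝ :=
  extNorm (exteriorPower.ιMulti ℝ 2 ![p.rep, q.rep]) / (‖p.rep‖ * ‖q.rep‖)

/-- The action of an invertible linear map on projective space. -/
def projAct {m : ℕ} (g : Euc m ≃L[ℝ] Euc m) (p : Proj m) : Proj m :=
  p.map g.toLinearEquiv.toLinearMap g.injective

theorem isOpenQuotientMap_mk (m : ℕ) :
    IsOpenQuotientMap (Projectivization.mk' ℝ : {v : Euc m // v ≠ 0} → Proj m) := by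
  refine ⟨Quotient.mk''_surjective, continuous_quotient_mk', ?_⟩
  intro U hU
  have key : (Projectivization.mk' ℝ : {v : Euc m // v ≠ 0} → Proj m) ⁻¹'
      ((Projectivization.mk' ℝ : {v : Euc m // v ≠ 0} → Proj m) '' U) =
      ⋃ a : ℝˣ, (fun v : {v : Euc m // v ≠ 0} =>
        (⟨a • v.1, (smul_ne_zero_iff_ne a).mpr v.2⟩ : {v : Euc m // v ≠ 0})) ⁻¹' U := by
    ext v
    simp only [Set.mem_preimage, Set.mem_image, Set.mem_iUnion]
    constructor
    · rintro ⟨w, hw, h⟩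
      obtain ⟨a, ha⟩ := (Projectivization.mk_eq_mk_iff ℝ w.1 v.1 w.2 v.2).1 h
      refine ⟨a, ?_⟩
      convert hw
    · rintro ⟨a, ha⟩
      exact ⟨_, ha, (Projectivization.mk_eq_mk_iff ℝ _ v.1 _ v.2).2 ⟨a, rfl⟩⟩
  have : IsOpen ((Projectivization.mk' ℝ : {v : Euc m // v ≠ 0} → Proj m) ⁻¹'
      ((Projectivization.mk' ℝ : {v : Euc m // v ≠ 0} → Proj m) '' U)) := by
    rw [key]
    refine isOpen_iUnion fun a => hU.preimage ?_
    exact (continuous_subtype_val.const_smul a).subtype_mk _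
  exact this

instance instSecondCountableProj (m : ℕ) : SecondCountableTopology (Proj m) :=
  (isOpenQuotientMap_mk m).isQuotientMap.secondCountableTopology (isOpenQuotientMap_mk m).isOpenMap

theorem continuous_injAct (m : ℕ) :
    Continuous fun z : {T : Euc m →L[ℝ] Euc m // Function.Injective T.toLinearMap} × Proj m =>
      z.2.map z.1.1.toLinearMap z.1.2 := by
  have hq := (IsOpenQuotientMap.id
    (X := {T : Euc m →L[ℝ] Euc m // Function.Injective T.toLinearMap})).prodMap
      (isOpenQuotientMap_mk m)
  rw [hq.isQuotientMap.continuous_iff]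
  have h : Continuous fun z : {T : Euc m →L[ℝ] Euc m // Function.Injective T.toLinearMap} ×
      {v : Euc m // v ≠ 0} =>
      (⟨z.1.1 z.2.1, fun h0 => z.2.2 (z.1.2 (by simpa using h0))⟩ : {v : Euc m // v ≠ 0}) := by
    refine Continuous.subtype_mk ?_ _
    exact (continuous_subtype_val.comp continuous_fst).clm_apply
      (continuous_subtype_val.comp continuous_snd)
  exact (isOpenQuotientMap_mk m).continuous.comp h

/-! ### Markov systems -/

section Markov

variable {S : Type*} [MeasurableSpace S]

/-- Sup norm of a function (meant for bounded functions). -/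
def supNorm {Y : Type*} (f : Y → ℂ) : ℝ := ⨆ y, ‖f y‖

/-- `(K, μ)` is strongly mixing: `|∫ f dKⁿ(x, ·) - ∫ f dμ| ≤ C ρⁿ ‖f‖_∞` uniformly in `x`. -/
def IsStronglyMixing (K : Kernel S S) (μ : Measure S) : Prop :=
  ∃ C ρ : ℝ, 0 < C ∧ 0 < ρ ∧ ρ < 1 ∧
    ∀ f : S → ℂ, Measurable f → BddAbove (Set.range fun x => ‖f x‖) →
      ∀ (x : S) (n : ℕ), ‖∫ y, f y ∂((K ^ n) x) - ∫ y, f y ∂μ‖ ≤ C * ρ ^ n * supNorm f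

/-- The law on `S^ℕ` of the Markov chain with initial distribution `μ` and kernel `K`. -/
def markovMeasure (K : Kernel S S) [IsMarkovKernel K] (μ : Measure S) [IsProbabilityMeasure μ] :
    Measure (ℕ → S) :=
  Kernel.trajMeasure (X := fun _ => S) μ
    (fun n => K.comap (fun h : (i : Finset.Iic n) → S => h ⟨n, Finset.mem_Iic.2 le_rfl⟩)
      (measurable_pi_apply _))

end Markov

/-! ### Random cocycles -/

/-- Functions `A : S × S → GL(m, ℝ)` with `A` and `A⁻¹` measurable and uniformly bounded. -/
structure RandCocycle (S : Type*) [MeasurableSpace S] (m : ℕ) where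
  toFun : S → S → (Euc m ≃L[ℝ] Euc m)
  measurable_coe : Measurable fun z : S × S => (toFun z.1 z.2 : Euc m →L[ℝ] Euc m)
  measurable_symm : Measurable fun z : S × S => ((toFun z.1 z.2).symm : Euc m →L[ℝ] Euc m)
  bounded_coe : ∃ c : ℝ, ∀ x y, ‖(toFun x y : Euc m →L[ℝ] Euc m)‖ ≤ c
  bounded_symm : ∃ c : ℝ, ∀ x y, ‖((toFun x y).symm : Euc m →L[ℝ] Euc m)‖ ≤ c

namespace RandCocycle

variable {S : Type*} [MeasurableSpace S] {m : ℕ}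

/-- The value `A(x, y)` as a bounded operator. -/
def op (A : RandCocycle S m) (z : S × S) : Euc m →L[ℝ] Euc m := A.toFun z.1 z.2

theorem bddAbove_op_sub (A B : RandCocycle S m) :
    BddAbove (Set.range fun z : S × S => ‖A.op z - B.op z‖) := by
  obtain ⟨a, ha⟩ := A.bounded_coe
  obtain ⟨b, hb⟩ := B.bounded_coe
  refine ⟨a + b, ?_⟩
  rintro _ ⟨z, rfl⟩
  exact (norm_sub_le _ _).trans (add_le_add (ha _ _) (hb _ _))

/-- The metric `d_∞(A, B) = sup ‖A(x, y) - B(x, y)‖`. -/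
instance instMetricSpace : MetricSpace (RandCocycle S m) where
  dist A B := ⨆ z : S × S, ‖A.op z - B.op z‖
  dist_self A := by simp
  dist_comm A B := by simp only [norm_sub_rev]
  dist_triangle A B D := by
    refine Real.iSup_le (fun z => ?_) (add_nonneg (Real.iSup_nonneg fun _ => norm_nonneg _)
      (Real.iSup_nonneg fun _ => norm_nonneg _))
    calc ‖A.op z - D.op z‖ ≤ ‖A.op z - B.op z‖ + ‖B.op z - D.op z‖ :=
          norm_sub_le_norm_sub_add_norm_sub _ _ _
      _ ≤ _ := add_le_add (le_ciSup (bddAbove_op_sub A B) z) (le_ciSup (bddAbove_op_sub B D) z)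
  eq_of_dist_eq_zero := by
    intro A B h
    have hz : ∀ z, A.op z = B.op z := fun z => by
      have h1 := (le_ciSup (bddAbove_op_sub A B) z).trans h.le
      exact sub_eq_zero.1 (norm_le_zero_iff.1 h1)
    have hf : A.toFun = B.toFun := by
      funext x y
      exact ContinuousLinearEquiv.coe_injective (hz (x, y))
    cases A
    cases B
    cases hf
    rfl

/-- The iterates `A⁽ⁿ⁾(ω) = A(ω_{n-1}, ω_n) ⋯ A(ω₁, ω₂) A(ω₀, ω₁)`. -/
def iter (A : RandCocycle S m) (ω : ℕ → S) : ℕ → (Euc m →L[ℝ] Euc m)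
  | 0 => ContinuousLinearMap.id ℝ (Euc m)
  | n + 1 => (A.op (ω n, ω (n + 1))).comp (iter A ω n)

/-- `A` is irreducible: there is no measurable proper `A`-invariant section of the Grassmannian.
The Grassmannian is embedded in the space of operators by `W ↦` (orthogonal projection onto `W`);
measurability of the section refers to this embedding. -/
def IsIrreducible (A : RandCocycle S m) (K : Kernel S S) [IsMarkovKernel K]
    (μ : Measure S) [IsProbabilityMeasure μ] : Prop :=
  ¬ ∃ V : S → Submodule ℝ (Euc m),
    Measurable (fun x => (V x).starProjection) ∧
    (∃ d : ℕ, 0 < d ∧ d < m ∧ ∀ᵐ x ∂μ, Module.finrank ℝ (V x) = d) ∧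
    ∀ᵐ ω ∂(markovMeasure K μ), ∀ n : ℕ,
      (V (ω n)).map (A.op (ω n, ω (n + 1))).toLinearMap = V (ω (n + 1))

/-- `Λ_j(A)`, the almost sure value of `lim (1/n) log ‖∧_j A⁽ⁿ⁾‖`. For a strongly mixing system the
limit exists and is constant almost surely, so it is the mean of the (always defined) upper
limit. -/
def lyapSum (A : RandCocycle S m) (K : Kernel S S) [IsMarkovKernel K]
    (μ : Measure S) [IsProbabilityMeasure μ] (j : ℕ) : ℝ :=
  ∫ ω, limsup (fun n : ℕ => (1 / (n : ℝ)) * Real.log (wedgeNorm j (A.iter ω n))) atTop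
    ∂(markovMeasure K μ)

/-- The Lyapunov exponent `L_j(A) = Λ_j(A) - Λ_{j-1}(A)`, for `j ≥ 1`. -/
def lyapExp (A : RandCocycle S m) (K : Kernel S S) [IsMarkovKernel K]
    (μ : Measure S) [IsProbabilityMeasure μ] (j : ℕ) : ℝ :=
  A.lyapSum K μ j - A.lyapSum K μ (j - 1)

/-- One step of the fibre dynamics: `((x, y, p), z) ↦ (y, z, A(y, z) p)`. -/
def step (A : RandCocycle S m) (w : (S × S × Proj m) × S) : S × S × Proj m :=
  (w.1.2.1, w.2, projAct (A.toFun w.1.2.1 w.2) w.1.2.2)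

theorem measurable_step (A : RandCocycle S m) : Measurable A.step := by
  have h1 : Measurable fun w : (S × S × Proj m) × S => w.1.2.1 := by fun_prop
  have h2 : Measurable fun w : (S × S × Proj m) × S =>
      ((⟨A.op (w.1.2.1, w.2), (A.toFun w.1.2.1 w.2).injective⟩, w.1.2.2) :
        {T : Euc m →L[ℝ] Euc m // Function.Injective T.toLinearMap} × Proj m) :=
    ((A.measurable_coe.comp (h1.prodMk measurable_snd)).subtype_mk).prodMk (by fun_prop)
  exact h1.prodMk (measurable_snd.prodMk ((continuous_injAct m).measurable.comp h2))

/-- The Markov kernel `K_A(x, y, p) = ∫ δ_{(y, z, A(y, z) p)} K(y, dz)`. -/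
def kernel (A : RandCocycle S m) (K : Kernel S S) : Kernel (S × S × Proj m) (S × S × Proj m) :=
  (Kernel.id ×ₖ K.comap (fun w : S × S × Proj m => w.2.1) (by fun_prop)).map A.step

/-- The Markov operator `(Q_A f)(x, y, p) = ∫ f(y, z, A(y, z) p) K(y, dz)`. -/
def markovOp (A : RandCocycle S m) (K : Kernel S S) (f : S × S × Proj m → ℂ) :
    S × S × Proj m → ℂ :=
  fun w => ∫ z, f (w.2.1, z, projAct (A.toFun w.2.1 z) w.2.2) ∂(K w.2.1)

theorem kernel_apply (A : RandCocycle S m) (K : Kernel S S) [IsMarkovKernel K]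
    (w : S × S × Proj m) :
    A.kernel K w =
      (K w.2.1).map fun z => (w.2.1, z, projAct (A.toFun w.2.1 z) w.2.2) := by
  rw [kernel, Kernel.map_apply _ A.measurable_step, Kernel.prod_apply, Kernel.id_apply,
    Kernel.comap_apply, Measure.dirac_prod, Measure.map_map A.measurable_step (by fun_prop)]
  rfl

end RandCocycle

/-! ### Hölder functions on `S × S × P(ℝᵐ)` -/

section Holder

variable {S : Type*} [MeasurableSpace S] {m : ℕ}

/-- The quotients `|f(x, y, p) - f(x, y, q)| / δ(p, q)^α`, `p ≠ q`. -/
def holderQuotients (α : ℝ) (f : S × S × Proj m → ℂ) : Set ℝ :=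
  {r | ∃ (x y : S) (p q : Proj m), p ≠ q ∧ r = ‖f (x, y, p) - f (x, y, q)‖ / projDist p q ^ α}

/-- The seminorm `v_α`. -/
def holderSeminorm (α : ℝ) (f : S × S × Proj m → ℂ) : ℝ := sSup (holderQuotients α f)

/-- The norm `‖f‖_α = v_α(f) + ‖f‖_∞`. -/
def holderNorm (α : ℝ) (f : S × S × Proj m → ℂ) : ℝ := holderSeminorm α f + supNorm f

/-- The space `H_α(S × P(ℝᵐ))`: bounded measurable functions `f(x, y, p)` with `v_α(f) < ∞`
that do not depend on `x`. -/
def MemHolder (α : ℝ) (f : S × S × Proj m → ℂ) : Prop :=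
  Measurable f ∧ BddAbove (Set.range fun w => ‖f w‖) ∧ BddAbove (holderQuotients α f) ∧
    ∀ x x' y p, f (x, y, p) = f (x', y, p)

end Holder

end MarkovCocycle

end

/-!
The chain is studied through the kernels `prodLaw` (`law` for a given cocycle), the joint law of
`x_n` and of the product `A⁽ⁿ⁾` for the chain started from a point. Exponential convergence of
`Q_Bⁿ` on Hölder functions follows from two contractions: the projective action contracts angles in
the mean, which flattens functions along the fibre, and the base chain mixes. All of the work lies
in showing that the first contraction is uniform in the starting point and stable under
perturbation.

*Uniform growth.* For every `β < Λ₁` there is a time `n` at which every direction `v`, above every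
point `x`, satisfies `E_x log (‖A⁽ⁿ⁾ v‖ / ‖v‖) ≥ n β` (`HasBound.exists_le_meanGrowth`). Suppose
that the best uniform rate `β₀` is less than `Λ₁`, and fix `β` strictly between them. A small
negative exponential moment shows that a vector whose mean rate is close to `β₀` grows slower than
`exp (n β)` with large probability (`HasBound.exists_truncGrowth_le`). Since `β₀` is optimal there
are vectors with mean rate arbitrarily close to `β₀`; averaging along their orbits, and using that
the base mixes, gives above almost every point a direction which is slow at all times of some
sequence (`HasBound.ae_exists_tsum_lt_top`). The slow directions above `x` form a subspace
`slowSpace`, which depends measurably on `x`, is invariant, and has constant dimension because the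
dimension can only increase along the chain (`exists_ae_finrank_eq`). It is not zero; it is not
proper, by irreducibility (`IsIrreducible.finrank_eq`); and it is not everything, since otherwise
the norm of the product would grow at most at rate `β < Λ₁`
(`HasBound.lyapSum_one_le_of_slowSpace_eq_top`).

*Contraction of angles.* The action of `M` expands the angle of `v` and `w` at most by the factor
`‖∧₂ M‖ (‖M v‖ / ‖v‖)⁻¹ (‖M w‖ / ‖w‖)⁻¹`. The stationary mean of `log ‖∧₂ A⁽ⁿ⁾‖` grows at rate at
most `Λ₂`, and mixing makes this uniform in the starting point; as `Λ₂ - 2 Λ₁ = L₂ - L₁ < 0`,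
uniform growth makes the mean logarithm of this factor at most `-1` at some time
(`HasBound.exists_integral_projRate_le`). Along one trajectory the products of two nearby cocycles
are close, so that the bound persists in a neighbourhood of `A`, and a second order expansion of
the exponential turns it into a contraction of the moments of order `α` of the angle, for all small
`α` (`exists_nhds_lintegral_exp_projRate_le`). Iteration gives `exists_angleMoment_le`, and
together with mixing in the base the convergence of `Q_Bⁿ f` to a constant
(`exists_markovOp_contraction`).

*Stationary measure.* Functions which are Lipschitz in the fibre determine measures and become
Hölder after one application of `Q_B`, so that the stationary measure is unique
(`HasBound.invariant_unique`). Cocycles are merely measurable, hence `Q_B` does not preserve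
continuity; but if the base point is initially distributed according to `μ`, then the laws of the
chain at all times have the same marginal `μ` in the base, and under this constraint weak
convergence already gives the convergence of integrals of Hölder functions
(`IsHolder.tendsto_integral`). This is enough to construct a stationary measure as a weak limit
(`HasBound.exists_invariant`). The constant approached by `Q_Bⁿ f` is then within the same error of
the mean of `f`.
-/

noncomputable section

namespace MarkovCocycle

set_option linter.unusedSectionVars false

/-! ### Products of a random cocycle as a Markov chain -/

section Chain

variable {S : Type*} [MeasurableSpace S] {G : Type*} [Monoid G] [MeasurableSpace G]
  [MeasurableMul₂ G]

/-- The kernel `(x, M) ↦ (y, c(x, y) M)`, `y` distributed according to `K(x, ·)`, which records the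
Markov chain together with the running product of a cocycle `c` with values in a monoid. -/
def stepKernel (K : Kernel S S) (c : S × S → G) : Kernel (S × G) (S × G) :=
  (Kernel.id ×ₖ K.comap (fun w : S × G => w.1) measurable_fst).map
    fun w => (w.2, c (w.1.1, w.2) * w.1.2)

/-- The joint law, given `x₀ = x`, of `x_n` and of the product
`c(x_{n-1}, x_n) ⋯ c(x₀, x₁)`. -/
def prodLaw (K : Kernel S S) (c : S × S → G) (n : ℕ) : Kernel S (S × G) :=
  (stepKernel K c ^ n).comap (fun x => (x, 1)) (by fun_prop)

variable {K : Kernel S S} [IsMarkovKernel K] {c : S × S → G}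

theorem measurable_stepFun (hc : Measurable c) :
    Measurable fun w : (S × G) × S => (w.2, c (w.1.1, w.2) * w.1.2) := by fun_prop

theorem stepKernel_apply (hc : Measurable c) (w : S × G) :
    stepKernel K c w = (K w.1).map fun y => (y, c (w.1, y) * w.2) := by
  rw [stepKernel, Kernel.map_apply _ (measurable_stepFun hc), Kernel.prod_apply, Kernel.id_apply,
    Kernel.comap_apply, Measure.dirac_prod, Measure.map_map (measurable_stepFun hc) (by fun_prop)]
  rfl

theorem isMarkovKernel_stepKernel (hc : Measurable c) : IsMarkovKernel (stepKernel K c) :=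
  Kernel.IsMarkovKernel.map _ (measurable_stepFun hc)

theorem isMarkovKernel_pow {X : Type*} [MeasurableSpace X] (κ : Kernel X X) [IsMarkovKernel κ]
    (n : ℕ) : IsMarkovKernel (κ ^ n) := by
  induction n with
  | zero => rw [pow_zero]; exact inferInstanceAs (IsMarkovKernel Kernel.id)
  | succ n ih =>
    rw [pow_succ]
    exact inferInstanceAs (IsMarkovKernel ((κ ^ n) ∘ₖ κ))

theorem isMarkovKernel_prodLaw (hc : Measurable c) (n : ℕ) : IsMarkovKernel (prodLaw K c n) := by
  have := isMarkovKernel_stepKernel (K := K) hc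
  have := isMarkovKernel_pow (stepKernel K c) n
  rw [prodLaw]; infer_instance

theorem isProbabilityMeasure_prodLaw (hc : Measurable c) (n : ℕ) (x : S) :
    IsProbabilityMeasure (prodLaw K c n x) :=
  (isMarkovKernel_prodLaw hc n).isProbabilityMeasure x

theorem prodLaw_zero (x : S) : prodLaw K c 0 x = Measure.dirac (x, 1) := by
  rw [prodLaw, pow_zero, Kernel.comap_apply]
  exact Kernel.id_apply _

theorem lintegral_stepKernel (hc : Measurable c) (w : S × G) {g : S × G → ENNReal}
    (hg : Measurable g) :
    ∫⁻ p, g p ∂(stepKernel K c w) = ∫⁻ y, g (y, c (w.1, y) * w.2) ∂(K w.1) := by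
  rw [stepKernel_apply hc, lintegral_map hg (by fun_prop)]

theorem lintegral_prodLaw_succ (hc : Measurable c) (n : ℕ) (x : S) {g : S × G → ENNReal}
    (hg : Measurable g) :
    ∫⁻ p, g p ∂(prodLaw K c (n + 1) x) =
      ∫⁻ p, ∫⁻ y, g (y, c (p.1, y) * p.2) ∂(K p.1) ∂(prodLaw K c n x) := by
  rw [prodLaw, Kernel.comap_apply, pow_succ']
  change ∫⁻ p, g p ∂((stepKernel K c ∘ₖ (stepKernel K c ^ n)) (x, 1)) = _
  rw [Kernel.lintegral_comp _ _ _ hg]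
  simp_rw [lintegral_stepKernel hc _ hg]
  rfl

/-- The cocycle acts by left multiplication, so that starting from `(x, M)` instead of `(x, 1)`
just multiplies the product by `M` on the right. -/
theorem stepKernel_pow_apply (hc : Measurable c) (n : ℕ) (x : S) (M : G) :
    (stepKernel K c ^ n) (x, M) = (prodLaw K c n x).map fun p => (p.1, p.2 * M) := by
  have hm : Measurable fun p : S × G => (p.1, p.2 * M) := by fun_prop
  have := isMarkovKernel_stepKernel (K := K) hc
  induction n with
  | zero =>
    rw [prodLaw_zero, Measure.map_dirac' hm, one_mul, pow_zero]
    exact Kernel.id_apply _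
  | succ n ih =>
    refine Measure.ext_of_lintegral _ fun g hg => ?_
    rw [lintegral_map hg hm, lintegral_prodLaw_succ hc n x
      (g := fun p => g (p.1, p.2 * M)) (hg.comp hm), pow_succ']
    change ∫⁻ p, g p ∂((stepKernel K c ∘ₖ (stepKernel K c ^ n)) (x, M)) = _
    rw [Kernel.lintegral_comp _ _ _ hg, ih, lintegral_map (hg.lintegral_kernel) hm]
    simp_rw [lintegral_stepKernel hc _ hg, mul_assoc]

/-- Chapman–Kolmogorov for the chain together with its product. -/
theorem prodLaw_add (hc : Measurable c) (n k : ℕ) (x : S) :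
    prodLaw K c (n + k) x =
      (prodLaw K c n x).bind fun p => (prodLaw K c k p.1).map fun q => (q.1, q.2 * p.2) := by
  rw [prodLaw, Kernel.comap_apply, add_comm, pow_add]
  change ((stepKernel K c ^ k) ∘ₖ (stepKernel K c ^ n)) (x, 1) = _
  rw [Kernel.comp_apply]
  congr 1
  funext p
  exact stepKernel_pow_apply hc k p.1 p.2

theorem measurable_translate_prodLaw (hc : Measurable c) (k : ℕ) :
    Measurable fun p : S × G => (prodLaw K c k p.1).map fun q => (q.1, q.2 * p.2) := by
  have : (fun p : S × G => (prodLaw K c k p.1).map fun q => (q.1, q.2 * p.2)) =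
      ⇑(stepKernel K c ^ k) := by
    funext p
    exact (stepKernel_pow_apply hc k p.1 p.2).symm
  rw [this]
  exact (stepKernel K c ^ k).measurable

theorem lintegral_prodLaw_add (hc : Measurable c) (n k : ℕ) (x : S) {g : S × G → ENNReal}
    (hg : Measurable g) :
    ∫⁻ p, g p ∂(prodLaw K c (n + k) x) =
      ∫⁻ p, ∫⁻ q, g (q.1, q.2 * p.2) ∂(prodLaw K c k p.1) ∂(prodLaw K c n x) := by
  rw [prodLaw_add hc, Measure.lintegral_bind (measurable_translate_prodLaw hc k).aemeasurable
    hg.aemeasurable]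
  refine lintegral_congr fun p => ?_
  rw [lintegral_map hg (by fun_prop)]

theorem integral_prodLaw_add {E : Type*} [NormedAddCommGroup E] [NormedSpace ℝ E]
    (hc : Measurable c) (n k : ℕ) (x : S) {g : S × G → E} (hg : StronglyMeasurable g)
    (hi : Integrable g (prodLaw K c (n + k) x)) :
    ∫ p, g p ∂(prodLaw K c (n + k) x) =
      ∫ p, ∫ q, g (q.1, q.2 * p.2) ∂(prodLaw K c k p.1) ∂(prodLaw K c n x) := by
  have e : prodLaw K c (n + k) x = ((stepKernel K c ^ k) ∘ₖ (stepKernel K c ^ n)) (x, 1) := by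
    rw [prodLaw, Kernel.comap_apply, add_comm, pow_add]; rfl
  rw [e] at hi ⊢
  rw [Kernel.integral_comp hi]
  change ∫ p, _ ∂(prodLaw K c n x) = _
  congr 1
  funext p
  rw [show p = (p.1, p.2) from rfl, stepKernel_pow_apply hc k,
    integral_map (by fun_prop) hg.aestronglyMeasurable]

theorem prodLaw_one (hc : Measurable c) (x : S) :
    prodLaw K c 1 x = (K x).map fun y => (y, c (x, y)) := by
  rw [prodLaw, Kernel.comap_apply, pow_one, stepKernel_apply hc]
  simp

/-- Decomposition of a trajectory at its first step, rather than at its last one as in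
`lintegral_prodLaw_succ`. -/
theorem lintegral_prodLaw_succ' (hc : Measurable c) (k : ℕ) (x : S) {g : S × G → ENNReal}
    (hg : Measurable g) :
    ∫⁻ p, g p ∂(prodLaw K c (k + 1) x) =
      ∫⁻ y, ∫⁻ q, g (q.1, q.2 * c (x, y)) ∂(prodLaw K c k y) ∂(K x) := by
  have h := lintegral_prodLaw_add (K := K) hc 1 k x hg
  rw [add_comm] at h
  rw [h, prodLaw_one hc, lintegral_map _ (by fun_prop)]
  have : (fun p : S × G => ∫⁻ q, g (q.1, q.2 * p.2) ∂(prodLaw K c k p.1)) =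
      fun p => ∫⁻ q, g q ∂((stepKernel K c ^ k) p) := by
    funext p
    rw [show p = (p.1, p.2) from rfl, stepKernel_pow_apply hc k, lintegral_map hg (by fun_prop)]
  rw [this]
  exact hg.lintegral_kernel

theorem map_fst_prodLaw (hc : Measurable c) (n : ℕ) (x : S) :
    (prodLaw K c n x).map Prod.fst = (K ^ n) x := by
  induction n with
  | zero =>
    rw [prodLaw_zero, Measure.map_dirac' measurable_fst, pow_zero]
    exact (Kernel.id_apply _).symm
  | succ n ih =>
    refine Measure.ext_of_lintegral _ fun g hg => ?_
    rw [lintegral_map hg measurable_fst, lintegral_prodLaw_succ hc n x (g := fun p => g p.1)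
      (hg.comp measurable_fst), pow_succ']
    change _ = ∫⁻ p, g p ∂((K ∘ₖ (K ^ n)) x)
    rw [Kernel.lintegral_comp _ _ _ hg, ← ih, lintegral_map (hg.lintegral_kernel) measurable_fst]

theorem integral_fst_prodLaw {E : Type*} [NormedAddCommGroup E] [NormedSpace ℝ E]
    (hc : Measurable c) (n : ℕ) (x : S) {g : S → E} (hg : StronglyMeasurable g) :
    ∫ p, g p.1 ∂(prodLaw K c n x) = ∫ y, g y ∂((K ^ n) x) := by
  rw [← map_fst_prodLaw (c := c) hc, integral_map measurable_fst.aemeasurable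
    hg.aestronglyMeasurable]

/-- Applied to the two projections of a product of monoids, this makes the product law of a pair of
cocycles a coupling of the product laws of the two components. -/
theorem map_prodLaw_hom {H : Type*} [Monoid H] [MeasurableSpace H] [MeasurableMul₂ H]
    (φ : G →* H) (hφ : Measurable φ) (hc : Measurable c) (n : ℕ) (x : S) :
    (prodLaw K c n x).map (fun p => (p.1, φ p.2)) = prodLaw K (fun z => φ (c z)) n x := by
  have hm : Measurable fun p : S × G => (p.1, φ p.2) := by fun_prop
  induction n with
  | zero => rw [prodLaw_zero, Measure.map_dirac' hm, prodLaw_zero, map_one]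
  | succ n ih =>
    have hc' : Measurable fun z => φ (c z) := hφ.comp hc
    refine Measure.ext_of_lintegral _ fun g hg => ?_
    rw [lintegral_map hg hm, lintegral_prodLaw_succ hc n x
      (g := fun p => g (p.1, φ p.2)) (hg.comp hm),
      lintegral_prodLaw_succ hc' n x hg, ← ih, lintegral_map _ hm]
    · simp_rw [map_mul]
    · exact Measurable.lintegral_kernel_prod_right (κ := K.comap Prod.fst measurable_fst)
        (f := fun (p : S × H) y => g (y, φ (c (p.1, y)) * p.2))
        (hg.comp (by fun_prop))

/-- A sequence of sets which the cocycle maps into each other carries the laws of the products. -/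
theorem ae_prodLaw_mem (hc : Measurable c) {D : ℕ → Set G} (hD : ∀ n, MeasurableSet (D n))
    (h0 : (1 : G) ∈ D 0) (hs : ∀ n z, ∀ M ∈ D n, c z * M ∈ D (n + 1)) (n : ℕ) (x : S) :
    ∀ᵐ p ∂(prodLaw K c n x), p.2 ∈ D n := by
  induction n with
  | zero =>
    rw [prodLaw_zero]
    exact (ae_dirac_iff (measurable_snd (hD 0))).2 h0
  | succ n ih =>
    have hm : MeasurableSet {p : S × G | p.2 ∉ D (n + 1)} := (measurable_snd (hD (n + 1))).compl
    have key : ∫⁻ p, Set.indicator {p : S × G | p.2 ∉ D (n + 1)} 1 p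
        ∂(prodLaw K c (n + 1) x) = 0 := by
      rw [lintegral_prodLaw_succ hc n x (measurable_one.indicator hm),
        lintegral_congr_ae (g := fun _ => 0), lintegral_zero]
      filter_upwards [ih] with p hp
      rw [lintegral_congr (g := fun _ => 0), lintegral_zero]
      intro y
      exact Set.indicator_of_notMem (fun h => (Set.mem_ofPred.1 h) (hs n (p.1, y) p.2 hp)) _
    rw [lintegral_indicator_one hm] at key
    exact key

end Chain

/-! ### Exterior powers of linear maps -/

section Wedge

variable {m : ℕ}

/-- The exterior power `∧ₖ T` as an operator on the coordinate space of `⋀ᵏ ℝᵐ`. -/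
def wedgeMap (k : ℕ) (T : Euc m →L[ℝ] Euc m) :
    EuclideanSpace ℝ (Set.powersetCard (Fin m) k) →L[ℝ]
      EuclideanSpace ℝ (Set.powersetCard (Fin m) k) :=
  LinearMap.toContinuousLinearMap
    ((extCoord m k).toLinearMap ∘ₗ exteriorPower.map k T.toLinearMap ∘ₗ
      (extCoord m k).symm.toLinearMap)

theorem wedgeMap_apply (k : ℕ) (T : Euc m →L[ℝ] Euc m)
    (y : EuclideanSpace ℝ (Set.powersetCard (Fin m) k)) :
    wedgeMap k T y = extCoord m k (exteriorPower.map k T.toLinearMap ((extCoord m k).symm y)) :=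
  rfl

theorem wedgeNorm_eq (k : ℕ) (T : Euc m →L[ℝ] Euc m) : wedgeNorm k T = ‖wedgeMap k T‖ := rfl

theorem wedgeNorm_nonneg (k : ℕ) (T : Euc m →L[ℝ] Euc m) : 0 ≤ wedgeNorm k T := norm_nonneg _

theorem extNorm_map_le (k : ℕ) (T : Euc m →L[ℝ] Euc m) (ω : ⋀[ℝ]^k (Euc m)) :
    extNorm (exteriorPower.map k T.toLinearMap ω) ≤ wedgeNorm k T * extNorm ω := by
  have h := (wedgeMap k T).le_opNorm (extCoord m k ω)
  rwa [wedgeMap_apply, LinearEquiv.symm_apply_apply] at h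

theorem wedgeMap_comp (k : ℕ) (T U : Euc m →L[ℝ] Euc m) :
    wedgeMap k (T * U) = wedgeMap k T * wedgeMap k U := by
  ext1 y
  have : (T * U).toLinearMap = T.toLinearMap ∘ₗ U.toLinearMap := rfl
  rw [wedgeMap_apply, this, exteriorPower.map_comp]
  change _ = wedgeMap k T (wedgeMap k U y)
  rw [wedgeMap_apply, wedgeMap_apply, LinearEquiv.symm_apply_apply]
  rfl

theorem wedgeNorm_mul_le (k : ℕ) (T U : Euc m →L[ℝ] Euc m) :
    wedgeNorm k (T * U) ≤ wedgeNorm k T * wedgeNorm k U := by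
  rw [wedgeNorm_eq, wedgeMap_comp]
  exact norm_mul_le _ _

theorem wedgeMap_one (k : ℕ) : wedgeMap k (1 : Euc m →L[ℝ] Euc m) = 1 := by
  ext1 y
  have : (1 : Euc m →L[ℝ] Euc m).toLinearMap = LinearMap.id := rfl
  rw [wedgeMap_apply, this, exteriorPower.map_id]
  simp

theorem wedgeNorm_one {k : ℕ} (hk : k ≤ m) : wedgeNorm k (1 : Euc m →L[ℝ] Euc m) = 1 := by
  have : Nonempty (Set.powersetCard (Fin m) k) := by
    obtain ⟨s, hs⟩ := Finset.exists_subset_card_eq (s := (Finset.univ : Finset (Fin m)))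
      (by simpa using hk)
    exact ⟨⟨s, hs.2⟩⟩
  rw [wedgeNorm_eq, wedgeMap_one]
  exact norm_one

theorem wedgeMap_smul (k : ℕ) (t : ℝ) (T : Euc m →L[ℝ] Euc m) :
    wedgeMap k (t • T) = t ^ k • wedgeMap k T := by
  have h : exteriorPower.map k (t • T).toLinearMap = t ^ k • exteriorPower.map k T.toLinearMap := by
    refine exteriorPower.linearMap_ext ?_
    ext1 v
    simp only [LinearMap.compAlternatingMap_apply, exteriorPower.map_apply_ιMulti,
      LinearMap.smul_apply]
    have : (⇑(t • T).toLinearMap ∘ v) = fun i => t • (T.toLinearMap ∘ v) i := rfl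
    rw [this]
    have := (exteriorPower.ιMulti ℝ k (M := Euc m)).map_smul_univ (fun _ => t) (T.toLinearMap ∘ v)
    simpa using this
  ext1 y
  rw [wedgeMap_apply, h]
  simp [wedgeMap_apply]

theorem extCoord_ιMulti (k : ℕ) (v : Fin k → Euc m) (s : Set.powersetCard (Fin m) k) :
    extCoord m k (exteriorPower.ιMulti ℝ k v) s =
      (Matrix.of fun i j => v i (Set.powersetCard.ofFinEmbEquiv.symm s j)).det := by
  change (((EuclideanSpace.basisFun (Fin m) ℝ).toBasis.exteriorPower k).repr _) s = _
  rw [exteriorPower.basis_repr_apply, exteriorPower.ιMultiDual_apply_ιMulti]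
  simp

theorem extCoord_symm_eq_sum (k : ℕ) (y : EuclideanSpace ℝ (Set.powersetCard (Fin m) k)) :
    (extCoord m k).symm y = ∑ s, y s • exteriorPower.ιMulti ℝ k
      (fun i => EuclideanSpace.basisFun (Fin m) ℝ (Set.powersetCard.ofFinEmbEquiv.symm s i)) := by
  change ((EuclideanSpace.basisFun (Fin m) ℝ).toBasis.exteriorPower k).equivFun.symm _ = _
  rw [Module.Basis.equivFun_symm_apply]
  refine Finset.sum_congr rfl fun s _ => ?_
  rw [exteriorPower.basis_apply]
  rfl

theorem continuous_wedgeMap (k : ℕ) :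
    Continuous (wedgeMap k : (Euc m →L[ℝ] Euc m) → _) := by
  rw [continuous_clm_apply]
  intro y
  have : (fun T : Euc m →L[ℝ] Euc m => wedgeMap k T y) = fun T => ∑ s, y s • extCoord m k
      (exteriorPower.ιMulti ℝ k (fun i => T (EuclideanSpace.basisFun (Fin m) ℝ
        (Set.powersetCard.ofFinEmbEquiv.symm s i)))) := by
    funext T
    rw [wedgeMap_apply, extCoord_symm_eq_sum, map_sum, map_sum]
    refine Finset.sum_congr rfl fun s _ => ?_
    rw [map_smul, map_smul, exteriorPower.map_apply_ιMulti]
    rfl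
  rw [this]
  refine continuous_finsetSum _ fun s _ => ?_
  refine Continuous.fun_const_smul ?_ (y s)
  have h : (fun T : Euc m →L[ℝ] Euc m => extCoord m k
      (exteriorPower.ιMulti ℝ k (fun i => T (EuclideanSpace.basisFun (Fin m) ℝ
        (Set.powersetCard.ofFinEmbEquiv.symm s i))))) = fun T => WithLp.toLp 2 fun r =>
      (Matrix.of fun i j => T (EuclideanSpace.basisFun (Fin m) ℝ
        (Set.powersetCard.ofFinEmbEquiv.symm s i))
          (Set.powersetCard.ofFinEmbEquiv.symm r j)).det := by
    funext T
    ext r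
    exact extCoord_ιMulti k _ r
  rw [h]
  refine (PiLp.continuous_toLp 2 _).comp (continuous_pi fun r => ?_)
  refine Continuous.matrix_det (continuous_pi fun i => continuous_pi fun j => ?_)
  exact (EuclideanSpace.proj (𝕜 := ℝ) (Set.powersetCard.ofFinEmbEquiv.symm r j :
    Fin m)).continuous.comp
    (ContinuousLinearMap.apply ℝ _ _).continuous

theorem continuous_wedgeNorm (k : ℕ) :
    Continuous (wedgeNorm k : (Euc m →L[ℝ] Euc m) → ℝ) :=
  (continuous_wedgeMap k).norm

theorem exists_wedgeNorm_le (k : ℕ) :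
    ∃ C : ℝ, 1 ≤ C ∧ ∀ T : Euc m →L[ℝ] Euc m, wedgeNorm k T ≤ C * ‖T‖ ^ k := by
  obtain ⟨C, hC⟩ := (isCompact_closedBall (0 : Euc m →L[ℝ] Euc m) 1).exists_bound_of_continuousOn
    (continuous_wedgeNorm k).continuousOn
  refine ⟨max C 1, le_max_right _ _, fun T => ?_⟩
  have hb : ∀ U : Euc m →L[ℝ] Euc m, ‖U‖ ≤ 1 → wedgeNorm k U ≤ max C 1 := fun U hU =>
    (le_abs_self _).trans ((hC U (by simpa using hU)).trans (le_max_left _ _))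
  have hs : wedgeNorm k T = ‖T‖ ^ k * wedgeNorm k (‖T‖⁻¹ • T) ∨ T = 0 := by
    by_cases h : T = 0
    · exact Or.inr h
    · left
      have : T = ‖T‖ • (‖T‖⁻¹ • T) := by
        rw [smul_smul, mul_inv_cancel₀ (norm_ne_zero_iff.2 h), one_smul]
      conv_lhs => rw [this, wedgeNorm_eq, wedgeMap_smul, norm_smul, norm_pow, norm_norm]
      rfl
  rcases hs with hs | rfl
  · rw [hs, mul_comm]
    refine mul_le_mul_of_nonneg_right (hb _ ?_) (by positivity)
    rw [norm_smul, norm_inv, norm_norm]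
    exact inv_mul_le_one
  · rcases Nat.eq_zero_or_pos k with rfl | hk
    · simpa using hb 0 (by simp)
    · have : wedgeNorm k (0 : Euc m →L[ℝ] Euc m) = 0 := by
        have h := wedgeMap_smul k 0 (0 : Euc m →L[ℝ] Euc m)
        have e : (0 : ℝ) • (0 : Euc m →L[ℝ] Euc m) = 0 := zero_smul ℝ (0 : Euc m →L[ℝ] Euc m)
        have e' : (0 : ℝ) ^ k • wedgeMap k (0 : Euc m →L[ℝ] Euc m) = 0 := by
          rw [zero_pow hk.ne']; exact zero_smul ℝ (wedgeMap k (0 : Euc m →L[ℝ] Euc m))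
        rw [e, e'] at h
        rw [wedgeNorm_eq, h, norm_zero]
      simp [this, hk.ne']

theorem wedgeNorm_zero (T : Euc m →L[ℝ] Euc m) : wedgeNorm 0 T = 1 := by
  have : wedgeMap 0 T = wedgeMap 0 1 := by
    have h (U : Euc m →L[ℝ] Euc m) : wedgeMap 0 U = wedgeMap 0 0 := by
      have e : (0 : ℝ) • U = 0 := zero_smul ℝ U
      rw [← e, wedgeMap_smul, pow_zero]
      exact (one_smul ℝ _).symm
    rw [h, h 1]
  rw [wedgeNorm_eq, this]
  exact wedgeNorm_one (Nat.zero_le m)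

theorem extNorm_eq_norm {k : ℕ} (ω : ⋀[ℝ]^k (Euc m)) : extNorm ω = ‖ω‖ := by
  have h := (((EuclideanSpace.basisFun (Fin m) ℝ).exteriorPower k).repr).norm_map ω
  rw [← h, extNorm]
  congr 1

/-- Lagrange's identity. -/
theorem extNorm_wedge_sq (v w : Euc m) :
    extNorm (exteriorPower.ιMulti ℝ 2 ![v, w]) ^ 2 = ‖v‖ ^ 2 * ‖w‖ ^ 2 - inner ℝ v w ^ 2 := by
  rw [extNorm_eq_norm, ← real_inner_self_eq_norm_sq, exteriorPower.inner_ιMulti_self,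
    Matrix.det_fin_two]
  simp only [Matrix.gram_apply, Matrix.cons_val_zero, Matrix.cons_val_one,
    real_inner_self_eq_norm_sq, real_inner_comm v w]
  ring

end Wedge

/-! ### The projective distance -/

section Projective

variable {m : ℕ}

/-- The sine `‖v ∧ w‖ / (‖v‖ ‖w‖)` of the angle between two vectors. -/
def sinAngle (v w : Euc m) : ℝ := extNorm (exteriorPower.ιMulti ℝ 2 ![v, w]) / (‖v‖ * ‖w‖)

theorem extNorm_wedge (v w : Euc m) :
    extNorm (exteriorPower.ιMulti ℝ 2 ![v, w]) = √(‖v‖ ^ 2 * ‖w‖ ^ 2 - inner ℝ v w ^ 2) := by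
  rw [← extNorm_wedge_sq, Real.sqrt_sq (show (0 : ℝ) ≤ extNorm _ from norm_nonneg _)]

theorem continuous_extNorm_wedge :
    Continuous fun z : Euc m × Euc m => extNorm (exteriorPower.ιMulti ℝ 2 ![z.1, z.2]) := by
  simp_rw [extNorm_wedge]
  fun_prop

theorem measurable_sinAngle : Measurable fun z : Euc m × Euc m => sinAngle z.1 z.2 :=
  continuous_extNorm_wedge.measurable.div (by fun_prop)

theorem sinAngle_nonneg (v w : Euc m) : 0 ≤ sinAngle v w :=
  div_nonneg (norm_nonneg _) (by positivity)

theorem sinAngle_sq {v w : Euc m} (hv : v ≠ 0) (hw : w ≠ 0) :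
    sinAngle v w ^ 2 = 1 - (inner ℝ v w / (‖v‖ * ‖w‖)) ^ 2 := by
  have h1 := norm_ne_zero_iff.2 hv
  have h2 := norm_ne_zero_iff.2 hw
  rw [sinAngle, div_pow, extNorm_wedge_sq]
  field_simp

theorem sinAngle_le_one (v w : Euc m) : sinAngle v w ≤ 1 := by
  by_cases hv : v = 0
  · simp [sinAngle, hv]
  by_cases hw : w = 0
  · simp [sinAngle, hw]
  refine (sq_le_one_iff₀ (sinAngle_nonneg v w)).1 ?_
  rw [sinAngle_sq hv hw]
  nlinarith [sq_nonneg (inner ℝ v w / (‖v‖ * ‖w‖))]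

theorem sinAngle_smul_smul {a b : ℝ} (ha : a ≠ 0) (hb : b ≠ 0) (v w : Euc m) :
    sinAngle (a • v) (b • w) = sinAngle v w := by
  by_cases hv : v = 0
  · simp [sinAngle, hv]
  by_cases hw : w = 0
  · simp [sinAngle, hw]
  have h1 := norm_ne_zero_iff.2 hv
  have h2 := norm_ne_zero_iff.2 hw
  have ha' := abs_ne_zero.2 ha
  have hb' := abs_ne_zero.2 hb
  refine (pow_left_inj₀ (sinAngle_nonneg _ _) (sinAngle_nonneg _ _) two_ne_zero).1 ?_
  rw [sinAngle_sq hv hw, sinAngle_sq (smul_ne_zero ha hv) (smul_ne_zero hb hw),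
    real_inner_smul_left, real_inner_smul_right, norm_smul, norm_smul, Real.norm_eq_abs,
    Real.norm_eq_abs]
  congr 1
  rw [← sq_abs, ← sq_abs (inner ℝ v w / _)]
  simp only [abs_div, abs_mul, abs_abs, abs_norm]
  field_simp

theorem projDist_mk {v w : Euc m} (hv : v ≠ 0) (hw : w ≠ 0) :
    projDist (Projectivization.mk ℝ v hv) (Projectivization.mk ℝ w hw) = sinAngle v w := by
  obtain ⟨a, ha⟩ := Projectivization.exists_smul_eq_mk_rep ℝ v hv
  obtain ⟨b, hb⟩ := Projectivization.exists_smul_eq_mk_rep ℝ w hw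
  rw [← sinAngle_smul_smul a.ne_zero b.ne_zero v w]
  change sinAngle _ _ = _
  rw [← ha, ← hb]
  rfl

theorem projDist_nonneg (p q : Proj m) : 0 ≤ projDist p q := sinAngle_nonneg _ _

theorem projDist_le_one (p q : Proj m) : projDist p q ≤ 1 := sinAngle_le_one _ _

/-- Distortion of angles under a linear map. -/
theorem sinAngle_map_le (M : Euc m →L[ℝ] Euc m) {v w : Euc m} (hv : v ≠ 0) (hw : w ≠ 0) :
    sinAngle (M v) (M w) ≤
      wedgeNorm 2 M * (‖M v‖ / ‖v‖)⁻¹ * (‖M w‖ / ‖w‖)⁻¹ * sinAngle v w := by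
  have h1 := norm_ne_zero_iff.2 hv
  have h2 := norm_ne_zero_iff.2 hw
  have h := extNorm_map_le 2 M (exteriorPower.ιMulti ℝ 2 ![v, w])
  rw [exteriorPower.map_apply_ιMulti] at h
  have e : (⇑M.toLinearMap ∘ ![v, w]) = ![M v, M w] := by
    funext i; fin_cases i <;> rfl
  rw [e] at h
  rw [sinAngle, sinAngle]
  calc _ ≤ (wedgeNorm 2 M * extNorm (exteriorPower.ιMulti ℝ 2 ![v, w])) / (‖M v‖ * ‖M w‖) := by
        gcongr
    _ = _ := by
        by_cases h3 : ‖M v‖ = 0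
        · simp [h3]
        by_cases h4 : ‖M w‖ = 0
        · simp [h4]
        field_simp

/-- The rank one projection onto a line, `p = ℝ v ↦ v ⊗ v / ‖v‖²`, as a vector of coordinates. -/
def lineProj (p : Proj m) : EuclideanSpace ℝ (Fin m × Fin m) :=
  WithLp.toLp 2 fun z => (p.rep z.1 * p.rep z.2) / ‖p.rep‖ ^ 2

theorem lineProj_mk {v : Euc m} (hv : v ≠ 0) :
    lineProj (Projectivization.mk ℝ v hv) =
      WithLp.toLp 2 fun z => (v z.1 * v z.2) / ‖v‖ ^ 2 := by
  obtain ⟨a, ha⟩ := Projectivization.exists_smul_eq_mk_rep ℝ v hv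
  have h1 := norm_ne_zero_iff.2 hv
  have h2 : (a : ℝ) ≠ 0 := a.ne_zero
  rw [lineProj, ← ha]
  congr 1
  funext z
  change ((a : ℝ) * v z.1) * ((a : ℝ) * v z.2) / ‖(a : ℝ) • v‖ ^ 2 = _
  rw [norm_smul, mul_pow, Real.norm_eq_abs, sq_abs]
  field_simp

/-- The Hilbert–Schmidt inner product of two rank one projections is `cos²` of the angle, which is
what makes `lineProj` an isometric embedding of projective space, up to the factor `√2`. -/
theorem inner_lineProj {v w : Euc m} (hv : v ≠ 0) (hw : w ≠ 0) :
    inner ℝ (lineProj (Projectivization.mk ℝ v hv)) (lineProj (Projectivization.mk ℝ w hw)) =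
      (inner ℝ v w / (‖v‖ * ‖w‖)) ^ 2 := by
  have h1 := norm_ne_zero_iff.2 hv
  have h2 := norm_ne_zero_iff.2 hw
  rw [lineProj_mk, lineProj_mk, PiLp.inner_apply, Fintype.sum_prod_type, div_pow, mul_pow,
    PiLp.inner_apply, sq (∑ i, _), Finset.sum_mul_sum, Finset.sum_div]
  refine Finset.sum_congr rfl fun i _ => ?_
  rw [Finset.sum_div]
  refine Finset.sum_congr rfl fun j _ => ?_
  simp only [RCLike.inner_apply, conj_trivial]
  field_simp

theorem dist_lineProj_sq (p q : Proj m) :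
    dist (lineProj p) (lineProj q) ^ 2 = 2 * projDist p q ^ 2 := by
  induction p using Projectivization.ind with | h v hv
  induction q using Projectivization.ind with | h w hw
  have h1 := norm_ne_zero_iff.2 hv
  have h2 := norm_ne_zero_iff.2 hw
  rw [projDist_mk, sinAngle_sq hv hw, dist_eq_norm, norm_sub_sq_real, ← real_inner_self_eq_norm_sq,
    ← real_inner_self_eq_norm_sq, inner_lineProj, inner_lineProj, inner_lineProj,
    real_inner_self_eq_norm_sq, real_inner_self_eq_norm_sq]
  field_simp
  ring

theorem dist_lineProj (p q : Proj m) :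
    dist (lineProj p) (lineProj q) = √2 * projDist p q := by
  refine (pow_left_inj₀ dist_nonneg (by have := projDist_nonneg p q; positivity) two_ne_zero).1 ?_
  rw [dist_lineProj_sq, mul_pow, Real.sq_sqrt (by norm_num)]

theorem projDist_pos {p q : Proj m} (h : p ≠ q) : 0 < projDist p q := by
  refine lt_of_le_of_ne (projDist_nonneg p q) fun h0 => h ?_
  induction p using Projectivization.ind with | h v hv
  induction q using Projectivization.ind with | h w hw
  rw [projDist_mk] at h0
  have h1 := sinAngle_sq hv hw
  rw [← h0] at h1
  have h2 : |inner ℝ v w / (‖v‖ * ‖w‖)| = 1 := by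
    have : (inner ℝ v w / (‖v‖ * ‖w‖)) ^ 2 = 1 := by linarith
    exact (sq_eq_sq₀ (abs_nonneg _) zero_le_one).1 (by rw [sq_abs, this, one_pow])
  obtain ⟨-, r, hr, e⟩ := (abs_real_inner_div_norm_mul_norm_eq_one_iff v w).1 h2
  refine ((Projectivization.mk_eq_mk_iff' ℝ _ _ hw hv).2 ⟨r, e.symm⟩).symm

theorem lineProj_injective : Function.Injective (lineProj (m := m)) := by
  intro p q h
  by_contra hne
  have h1 := dist_lineProj p q
  rw [h, dist_self] at h1
  have := projDist_pos hne
  have h3 : 0 < √2 * projDist p q := by positivity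
  linarith

theorem continuous_lineProj : Continuous (lineProj (m := m)) := by
  rw [(isOpenQuotientMap_mk m).isQuotientMap.continuous_iff]
  have : (lineProj (m := m)) ∘ (Projectivization.mk' ℝ : {v : Euc m // v ≠ 0} → Proj m) =
      fun v => WithLp.toLp 2 fun z => (v.1 z.1 * v.1 z.2) / ‖v.1‖ ^ 2 := by
    funext v
    exact lineProj_mk v.2
  rw [this]
  refine (PiLp.continuous_toLp 2 _).comp (continuous_pi fun z => ?_)
  refine Continuous.div ?_ ?_ fun v => pow_ne_zero 2 (norm_ne_zero_iff.2 v.2)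
  · exact ((EuclideanSpace.proj (𝕜 := ℝ) z.1).continuous.comp continuous_subtype_val).mul
      ((EuclideanSpace.proj (𝕜 := ℝ) z.2).continuous.comp continuous_subtype_val)
  · exact (continuous_subtype_val.norm).pow 2

instance instCompactSpaceProj : CompactSpace (Proj m) := by
  have hs : IsCompact (Metric.sphere (0 : Euc m) 1) := isCompact_sphere _ _
  have hne : ∀ v : Metric.sphere (0 : Euc m) 1, v.1 ≠ 0 := fun v => ne_zero_of_mem_unit_sphere v
  have hc : Continuous fun v : Metric.sphere (0 : Euc m) 1 =>
      (Projectivization.mk' ℝ ⟨v.1, hne v⟩ : Proj m) :=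
    (isOpenQuotientMap_mk m).continuous.comp (continuous_subtype_val.subtype_mk _)
  have : CompactSpace (Metric.sphere (0 : Euc m) 1) := isCompact_iff_compactSpace.1 hs
  refine ⟨?_⟩
  have hr := isCompact_range hc
  convert hr
  symm
  rw [Set.eq_univ_iff_forall]
  intro p
  induction p using Projectivization.ind with | h v hv
  have h1 := norm_ne_zero_iff.2 hv
  refine ⟨⟨‖v‖⁻¹ • v, by simp [norm_smul, h1]⟩, ?_⟩
  exact (Projectivization.mk_eq_mk_iff' ℝ _ _ _ hv).2 ⟨‖v‖⁻¹, rfl⟩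

theorem isClosedEmbedding_lineProj : IsClosedEmbedding (lineProj (m := m)) :=
  continuous_lineProj.isClosedEmbedding lineProj_injective

instance instT2SpaceProj : T2Space (Proj m) :=
  T2Space.of_injective_continuous lineProj_injective continuous_lineProj

theorem continuous_projDist : Continuous fun z : Proj m × Proj m => projDist z.1 z.2 := by
  have : (fun z : Proj m × Proj m => projDist z.1 z.2) =
      fun z => dist (lineProj z.1) (lineProj z.2) / √2 := by
    funext z
    rw [dist_lineProj]
    field_simp
  rw [this]
  have := continuous_lineProj (m := m)
  fun_prop

end Projective

/-! ### Bounds for products of the cocycle -/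

section Bounds

variable {m : ℕ}

instance : SecondCountableTopology (Euc m →L[ℝ] Euc m) :=
  have : ProperSpace (Euc m →L[ℝ] Euc m) := FiniteDimensional.proper ℝ _
  inferInstance

/-- `M` distorts lengths at most by the factor `C`, in both directions. -/
def HasDistortion (C : ℝ) (M : Euc m →L[ℝ] Euc m) : Prop :=
  ∀ v, ‖M v‖ ≤ C * ‖v‖ ∧ ‖v‖ ≤ C * ‖M v‖

theorem isClosed_hasDistortion (C : ℝ) : IsClosed {M : Euc m →L[ℝ] Euc m | HasDistortion C M} := by
  have : {M : Euc m →L[ℝ] Euc m | HasDistortion C M} =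
      ⋂ v, {M | ‖M v‖ ≤ C * ‖v‖} ∩ {M | ‖v‖ ≤ C * ‖M v‖} := by
    ext M; simp [HasDistortion]
  rw [this]
  refine isClosed_iInter fun v => ?_
  have h : Continuous fun M : Euc m →L[ℝ] Euc m => M v :=
    (ContinuousLinearMap.apply ℝ _ v).continuous
  exact (isClosed_le h.norm continuous_const).inter
    (isClosed_le continuous_const (h.norm.const_mul C))

theorem HasDistortion.mul {C D : ℝ} {M N : Euc m →L[ℝ] Euc m} (hN : HasDistortion D N)
    (hM : HasDistortion C M) (hC : 0 ≤ C) (hD : 0 ≤ D) : HasDistortion (D * C) (N * M) := by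
  intro v
  change ‖N (M v)‖ ≤ _ ∧ _ ≤ _ * ‖N (M v)‖
  constructor
  · calc _ ≤ D * ‖M v‖ := (hN _).1
      _ ≤ D * (C * ‖v‖) := by gcongr; exact (hM v).1
      _ = _ := by ring
  · calc _ ≤ C * ‖M v‖ := (hM _).2
      _ ≤ C * (D * ‖N (M v)‖) := by gcongr; exact (hN _).2
      _ = _ := by ring

theorem hasDistortion_one : HasDistortion 1 (1 : Euc m →L[ℝ] Euc m) := fun v => by simp

theorem HasDistortion.mono {C D : ℝ} {M : Euc m →L[ℝ] Euc m} (h : HasDistortion C M)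
    (hCD : C ≤ D) : HasDistortion D M := fun v =>
  ⟨(h v).1.trans (by gcongr), (h v).2.trans (by gcongr)⟩

theorem HasDistortion.map_ne_zero {C : ℝ} {M : Euc m →L[ℝ] Euc m} (h : HasDistortion C M)
    {v : Euc m} (hv : v ≠ 0) : M v ≠ 0 := by
  intro h0
  have := (h v).2
  rw [h0, norm_zero, mul_zero] at this
  exact hv (norm_le_zero_iff.1 this)

theorem HasDistortion.norm_le {C : ℝ} {M : Euc m →L[ℝ] Euc m} (h : HasDistortion C M)
    (hC : 0 ≤ C) : ‖M‖ ≤ C := M.opNorm_le_bound hC fun v => (h v).1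

theorem HasDistortion.inv_le {C : ℝ} {M : Euc m →L[ℝ] Euc m} (h : HasDistortion C M)
    (hC : 0 < C) {v : Euc m} (hv : v ≠ 0) : C⁻¹ ≤ ‖M v‖ / ‖v‖ := by
  have := norm_pos_iff.2 hv
  rw [le_div_iff₀ this, inv_mul_le_iff₀ hC]
  exact (h v).2

theorem HasDistortion.le {C : ℝ} {M : Euc m →L[ℝ] Euc m} (h : HasDistortion C M)
    {v : Euc m} (hv : v ≠ 0) : ‖M v‖ / ‖v‖ ≤ C := by
  have := norm_pos_iff.2 hv
  rw [div_le_iff₀ this]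
  exact (h v).1

theorem HasDistortion.abs_log_le {C : ℝ} {M : Euc m →L[ℝ] Euc m} (h : HasDistortion C M)
    (hC : 0 < C) {v : Euc m} (hv : v ≠ 0) : |Real.log (‖M v‖ / ‖v‖)| ≤ Real.log C := by
  have h1 := h.inv_le hC hv
  have h2 := h.le hv
  rw [abs_le, ← Real.log_inv]
  exact ⟨Real.log_le_log (by positivity) h1,
    Real.log_le_log (lt_of_lt_of_le (by positivity) h1) h2⟩

theorem HasDistortion.exists_leftInverse {C : ℝ} {M : Euc m →L[ℝ] Euc m} (h : HasDistortion C M)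
    (hC : 0 ≤ C) : ∃ N : Euc m →L[ℝ] Euc m, N * M = 1 ∧ ‖N‖ ≤ C := by
  have hinj : Function.Injective M.toLinearMap := by
    rw [← LinearMap.ker_eq_bot, LinearMap.ker_eq_bot']
    intro v hv
    by_contra h0
    exact h.map_ne_zero h0 hv
  let e := LinearEquiv.ofInjectiveEndo M.toLinearMap hinj
  refine ⟨LinearMap.toContinuousLinearMap e.symm.toLinearMap, ?_, ?_⟩
  · ext1 v
    exact e.symm_apply_apply v
  · refine ContinuousLinearMap.opNorm_le_bound _ hC fun w => ?_
    have := (h (e.symm w)).2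
    rwa [show M (e.symm w) = w from e.apply_symm_apply w] at this

theorem HasDistortion.norm_pos {C : ℝ} {M : Euc m →L[ℝ] Euc m} (h : HasDistortion C M)
    (hC : 0 < C) (hm : 1 ≤ m) : C⁻¹ ≤ ‖M‖ := by
  let v : Euc m := EuclideanSpace.single ⟨0, hm⟩ 1
  have hv : ‖v‖ = 1 := by simp [v]
  have h1 := (h v).2
  have h2 := M.le_opNorm v
  rw [hv] at h1 h2
  rw [inv_le_iff_one_le_mul₀ hC]
  nlinarith

/-- The norm of an exterior power is comparable to `1` on maps of bounded distortion. -/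
theorem exists_wedgeNorm_bounds {k : ℕ} (hk : k ≤ m) :
    ∃ R : ℝ, 1 ≤ R ∧ ∀ C : ℝ, 0 < C → ∀ M : Euc m →L[ℝ] Euc m, HasDistortion C M →
      0 < wedgeNorm k M ∧ |Real.log (wedgeNorm k M)| ≤ Real.log R + k * Real.log C := by
  obtain ⟨R, hR, hb⟩ := exists_wedgeNorm_le (m := m) k
  refine ⟨R, hR, fun C hC M hM => ?_⟩
  obtain ⟨N, hNM, hN⟩ := hM.exists_leftInverse hC.le
  have h1 : wedgeNorm k M ≤ R * C ^ k := (hb M).trans (by gcongr; exact hM.norm_le hC.le)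
  have h2 : wedgeNorm k N ≤ R * C ^ k := (hb N).trans (by gcongr)
  have h3 : 1 ≤ wedgeNorm k N * wedgeNorm k M := by
    rw [← wedgeNorm_one hk, ← hNM]
    exact wedgeNorm_mul_le k N M
  have hRC : 0 < R * C ^ k := by positivity
  have h4 : 1 ≤ R * C ^ k * wedgeNorm k M :=
    h3.trans (mul_le_mul_of_nonneg_right h2 (wedgeNorm_nonneg k M))
  have h5 : 0 < wedgeNorm k M := by
    by_contra h0
    have := mul_nonpos_of_nonneg_of_nonpos hRC.le (not_lt.1 h0)
    linarith
  refine ⟨h5, ?_⟩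
  have h6 : Real.log (R * C ^ k) = Real.log R + k * Real.log C := by
    rw [Real.log_mul (by positivity) (by positivity), Real.log_pow]
  rw [← h6, abs_le]
  refine ⟨?_, Real.log_le_log h5 h1⟩
  rw [← Real.log_inv]
  exact Real.log_le_log (by positivity) ((inv_le_iff_one_le_mul₀ hRC).2 (by linarith))

end Bounds

namespace RandCocycle

variable {S : Type*} [MeasurableSpace S] {m : ℕ}

theorem measurable_op (A : RandCocycle S m) : Measurable A.op := A.measurable_coe

/-- All values of the cocycle have distortion at most `c`. -/
def HasBound (A : RandCocycle S m) (c : ℝ) : Prop := 1 ≤ c ∧ ∀ z, HasDistortion c (A.op z)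

theorem exists_hasBound (A : RandCocycle S m) : ∃ c, A.HasBound c := by
  obtain ⟨a, ha⟩ := A.bounded_coe
  obtain ⟨b, hb⟩ := A.bounded_symm
  refine ⟨max 1 (max a b), le_max_left _ _, fun z v => ⟨?_, ?_⟩⟩
  · refine ((A.op z).le_opNorm v).trans ?_
    gcongr
    exact (ha z.1 z.2).trans ((le_max_left _ _).trans (le_max_right _ _))
  · have h := ((A.toFun z.1 z.2).symm : Euc m →L[ℝ] Euc m).le_opNorm (A.op z v)
    have e : ((A.toFun z.1 z.2).symm : Euc m →L[ℝ] Euc m) (A.op z v) = v :=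
      (A.toFun z.1 z.2).symm_apply_apply v
    rw [e] at h
    refine h.trans ?_
    gcongr
    exact (hb z.1 z.2).trans ((le_max_right _ _).trans (le_max_right _ _))

variable {A : RandCocycle S m} {c : ℝ} {K : Kernel S S} [IsMarkovKernel K]

/-- The joint law, given `x₀ = x`, of `x_n` and `A⁽ⁿ⁾`. -/
abbrev law (A : RandCocycle S m) (K : Kernel S S) (n : ℕ) : Kernel S (S × (Euc m →L[ℝ] Euc m)) :=
  prodLaw K A.op n

instance (n : ℕ) : IsMarkovKernel (A.law K n) := isMarkovKernel_prodLaw A.measurable_op n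

theorem HasBound.pos (hA : A.HasBound c) : 0 < c := zero_lt_one.trans_le hA.1

theorem HasBound.log_nonneg (hA : A.HasBound c) : 0 ≤ Real.log c := Real.log_nonneg hA.1

theorem HasBound.ae_law (hA : A.HasBound c) (n : ℕ) (x : S) :
    ∀ᵐ p ∂(A.law K n x), HasDistortion (c ^ n) p.2 := by
  refine ae_prodLaw_mem A.measurable_op (D := fun n => {M | HasDistortion (c ^ n) M})
    (fun n => (isClosed_hasDistortion _).measurableSet) ?_ ?_ n x
  · simpa using hasDistortion_one
  · intro n z M hM
    have := (hA.2 z).mul hM (pow_nonneg hA.pos.le n) hA.pos.le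
    rwa [← pow_succ'] at this

theorem HasBound.integrable_law (hA : A.HasBound c) (n : ℕ) (x : S)
    {g : S × (Euc m →L[ℝ] Euc m) → ℝ} (hg : Measurable g) (R : ℝ)
    (hb : ∀ p, HasDistortion (c ^ n) p.2 → |g p| ≤ R) : Integrable g (A.law K n x) :=
  Integrable.of_bound hg.aestronglyMeasurable R
    ((hA.ae_law n x).mono fun p hp => hb p hp)

theorem HasBound.abs_integral_law_le (hA : A.HasBound c) (n : ℕ) (x : S)
    {g : S × (Euc m →L[ℝ] Euc m) → ℝ} (R : ℝ)
    (hb : ∀ p, HasDistortion (c ^ n) p.2 → |g p| ≤ R) : |∫ p, g p ∂(A.law K n x)| ≤ R := by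
  have := norm_integral_le_of_norm_le_const (μ := A.law K n x) (f := g) (C := R)
    ((hA.ae_law n x).mono fun p hp => hb p hp)
  simpa using this

/-- Chapman–Kolmogorov for quantities controlled by the distortion. -/
theorem HasBound.integral_law_add (hA : A.HasBound c) (n k : ℕ) (x : S)
    {g : S × (Euc m →L[ℝ] Euc m) → ℝ} (hg : Measurable g) (R : ℝ)
    (hb : ∀ p, HasDistortion (c ^ (n + k)) p.2 → |g p| ≤ R) :
    ∫ p, g p ∂(A.law K (n + k) x) =
      ∫ p, ∫ q, g (q.1, q.2 * p.2) ∂(A.law K k p.1) ∂(A.law K n x) :=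
  integral_prodLaw_add A.measurable_op n k x hg.stronglyMeasurable
    (hA.integrable_law (n + k) x hg R hb)

theorem HasBound.mul_pow (hA : A.HasBound c) {n k : ℕ} {M N : Euc m →L[ℝ] Euc m}
    (hM : HasDistortion (c ^ n) M) (hN : HasDistortion (c ^ k) N) :
    HasDistortion (c ^ (n + k)) (N * M) := by
  have := hN.mul hM (pow_nonneg hA.pos.le n) (pow_nonneg hA.pos.le k)
  rwa [← pow_add, add_comm] at this

/-! ### The products along a trajectory -/

theorem iter_congr (A : RandCocycle S m) {ω ω' : ℕ → S} {n : ℕ} (h : ∀ i ≤ n, ω i = ω' i) :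
    A.iter ω n = A.iter ω' n := by
  induction n with
  | zero => rfl
  | succ n ih =>
    rw [iter, iter, ih fun i hi => h i (by omega), h n (by omega), h (n + 1) le_rfl]

theorem iter_succ (A : RandCocycle S m) (ω : ℕ → S) (n : ℕ) :
    A.iter ω (n + 1) = A.op (ω n, ω (n + 1)) * A.iter ω n := rfl

theorem measurable_iter (A : RandCocycle S m) (n : ℕ) : Measurable fun ω => A.iter ω n := by
  induction n with
  | zero => exact measurable_const
  | succ n ih =>
    simp_rw [iter_succ]
    have := A.measurable_op
    exact Measurable.mul (this.comp (by fun_prop)) ih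

theorem HasBound.iter (hA : A.HasBound c) (ω : ℕ → S) (n : ℕ) :
    HasDistortion (c ^ n) (A.iter ω n) := by
  induction n with
  | zero => rw [pow_zero]; exact hasDistortion_one
  | succ n ih =>
    have := (hA.2 (ω n, ω (n + 1))).mul ih (pow_nonneg hA.pos.le n) hA.pos.le
    rw [← pow_succ'] at this
    exact this

end RandCocycle

section Path

variable {S : Type*} [MeasurableSpace S] {m : ℕ} {K : Kernel S S} [IsMarkovKernel K]
  {μ : Measure S} [IsProbabilityMeasure μ]

instance : IsProbabilityMeasure (markovMeasure K μ) := by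
  rw [markovMeasure]; infer_instance

theorem map_zero_markovMeasure : (markovMeasure K μ).map (fun ω => ω 0) = μ := by
  have h0 : (fun ω : ℕ → S => ω 0) = (MeasurableEquiv.piUnique fun _ : Finset.Iic 0 => S) ∘
      Preorder.frestrictLe (π := fun _ => S) 0 := rfl
  rw [h0, ← Measure.map_map (by fun_prop) (by fun_prop), markovMeasure, Kernel.trajMeasure,
    Measure.map_comp _ _ (by fun_prop), Kernel.traj_map_frestrictLe, Kernel.partialTraj_self,
    Measure.id_comp, Measure.map_map (by fun_prop) (by fun_prop)]
  convert Measure.map_id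
  funext x
  exact (MeasurableEquiv.piUnique fun _ : Finset.Iic 0 => S).apply_symm_apply x

/-- The Markov property. -/
theorem lintegral_markovMeasure_succ (n : ℕ)
    {F : (Finset.Iic n → S) × S → ENNReal} (hF : Measurable F) :
    ∫⁻ ω, F (Preorder.frestrictLe (π := fun _ => S) n ω, ω (n + 1)) ∂(markovMeasure K μ) =
      ∫⁻ ω, ∫⁻ y, F (Preorder.frestrictLe (π := fun _ => S) n ω, y) ∂(K (ω n))
        ∂(markovMeasure K μ) := by
  have h := Kernel.map_frestrictLe_trajMeasure_compProd_eq_map_trajMeasure (X := fun _ => S)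
    (μ₀ := μ) (κ := fun n => K.comap
      (fun h : (i : Finset.Iic n) → S => h ⟨n, Finset.mem_Iic.2 le_rfl⟩) (measurable_pi_apply _))
      (a := n)
  have h1 := congrArg (fun ν => ∫⁻ z, F z ∂ν) h
  rw [Measure.lintegral_compProd hF, lintegral_map hF (by fun_prop),
    lintegral_map (by exact hF.lintegral_kernel_prod_right') (by fun_prop)] at h1
  exact h1.symm

/-- The kernels `law` describe the products along a random trajectory. -/
theorem map_iter_markovMeasure (A : RandCocycle S m) (n : ℕ) :
    (markovMeasure K μ).map (fun ω => (ω n, A.iter ω n)) = μ.bind (A.law K n) := by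
  have hm : ∀ n, Measurable fun ω : ℕ → S => (ω n, A.iter ω n) := fun n =>
    (measurable_pi_apply n).prodMk (A.measurable_iter n)
  induction n with
  | zero =>
    have : (A.law K 0 : S → Measure (S × (Euc m →L[ℝ] Euc m))) = fun x => Measure.dirac (x, 1) := by
      funext x; exact prodLaw_zero x
    rw [this, Measure.bind_dirac_eq_map _ (by fun_prop)]
    conv_rhs => rw [← map_zero_markovMeasure (K := K) (μ := μ)]
    rw [Measure.map_map (by fun_prop) (by fun_prop)]
    rfl
  | succ n ih =>
    refine Measure.ext_of_lintegral _ fun g hg => ?_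
    rw [lintegral_map hg (hm _), Measure.lintegral_bind (Kernel.aemeasurable _) hg.aemeasurable]
    simp_rw [lintegral_prodLaw_succ A.measurable_op n _ hg]
    have hG : Measurable fun p : S × (Euc m →L[ℝ] Euc m) =>
        ∫⁻ y, g (y, A.op (p.1, y) * p.2) ∂(K p.1) := by
      have := A.measurable_op
      exact Measurable.lintegral_kernel_prod_right (κ := K.comap Prod.fst measurable_fst)
        (f := fun (p : S × (Euc m →L[ℝ] Euc m)) y => g (y, A.op (p.1, y) * p.2))
        (hg.comp (by fun_prop))
    rw [← Measure.lintegral_bind (Kernel.aemeasurable _) hG.aemeasurable, ← ih,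
      lintegral_map hG (hm n)]
    -- the product up to time `n` is a function of the trajectory up to time `n`
    let r : (Finset.Iic n → S) → ℕ → S := fun h i => h ⟨min i n, by simp⟩
    have hr : Measurable r := by fun_prop
    have hri : ∀ ω : ℕ → S, A.iter (r (Preorder.frestrictLe (π := fun _ => S) n ω)) n =
        A.iter ω n := fun ω => A.iter_congr fun i hi => by
      simp [r, Preorder.frestrictLe, min_eq_left hi]
    have hF : Measurable fun z : (Finset.Iic n → S) × S =>
        g (z.2, A.op (r z.1 n, z.2) * A.iter (r z.1) n) := by
      refine hg.comp (measurable_snd.prodMk (Measurable.mul (A.measurable_op.comp ?_) ?_))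
      · exact ((measurable_pi_apply n).comp (hr.comp measurable_fst)).prodMk measurable_snd
      · exact (A.measurable_iter n).comp (hr.comp measurable_fst)
    have hrn : ∀ ω : ℕ → S, r (Preorder.frestrictLe (π := fun _ => S) n ω) n = ω n := fun ω => by
      simp [r, Preorder.frestrictLe]
    have h := lintegral_markovMeasure_succ (K := K) (μ := μ) n hF
    simp only [hri, hrn] at h
    exact h

theorem integral_iter_markovMeasure (A : RandCocycle S m) (n : ℕ)
    {g : S × (Euc m →L[ℝ] Euc m) → ℝ} (hg : Measurable g)
    (hi : Integrable g (μ.bind (A.law K n))) :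
    ∫ ω, g (ω n, A.iter ω n) ∂(markovMeasure K μ) = ∫ x, ∫ p, g p ∂(A.law K n x) ∂μ := by
  rw [← integral_map (φ := fun ω : ℕ → S => (ω n, A.iter ω n)) _ hg.aestronglyMeasurable,
    map_iter_markovMeasure]
  · have e : μ.bind (A.law K n) = (A.law K n ∘ₖ Kernel.const Unit μ) () := by
      rw [Kernel.comp_apply, Kernel.const_apply]
    rw [e] at hi ⊢
    rw [Kernel.integral_comp hi, Kernel.const_apply]
  · exact ((measurable_pi_apply n).prodMk (A.measurable_iter n)).aemeasurable

theorem map_coord_markovMeasure (hμ : Kernel.Invariant K μ) (n : ℕ) :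
    (markovMeasure K μ).map (fun ω => ω n) = μ := by
  induction n with
  | zero => exact map_zero_markovMeasure
  | succ n ih =>
    refine Measure.ext_of_lintegral _ fun g hg => ?_
    have h := lintegral_markovMeasure_succ (K := K) (μ := μ) n (F := fun z => g z.2)
      (hg.comp measurable_snd)
    rw [lintegral_map hg (by fun_prop), h, ← lintegral_map (g := fun ω : ℕ → S => ω n)
      (f := fun x => ∫⁻ y, g y ∂(K x)) hg.lintegral_kernel (by fun_prop), ih,
      ← Measure.lintegral_bind (Kernel.aemeasurable _) hg.aemeasurable, hμ.def]

theorem map_pair_markovMeasure (hμ : Kernel.Invariant K μ) (n : ℕ) :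
    (markovMeasure K μ).map (fun ω => (ω n, ω (n + 1))) = μ ⊗ₘ K := by
  refine Measure.ext_of_lintegral _ fun g hg => ?_
  have h := lintegral_markovMeasure_succ (K := K) (μ := μ) n
    (F := fun z => g (z.1 ⟨n, Finset.mem_Iic.2 le_rfl⟩, z.2)) (hg.comp (by fun_prop))
  rw [lintegral_map hg (by fun_prop), Measure.lintegral_compProd hg]
  conv_rhs => rw [← map_coord_markovMeasure (K := K) (μ := μ) hμ n]
  rw [lintegral_map hg.lintegral_kernel_prod_right' (by fun_prop)]
  exact h

end Path

/-! ### Mixing and mean growth -/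

section Mixing

variable {S : Type*} [MeasurableSpace S] {K : Kernel S S} [IsMarkovKernel K]
  {μ : Measure S} [IsProbabilityMeasure μ]

theorem IsStronglyMixing.exists_real (h : IsStronglyMixing K μ) :
    ∃ C ρ : ℝ, 0 < C ∧ 0 < ρ ∧ ρ < 1 ∧ ∀ f : S → ℝ, Measurable f → ∀ R : ℝ, (∀ x, |f x| ≤ R) →
      ∀ (x : S) (n : ℕ), |∫ y, f y ∂((K ^ n) x) - ∫ y, f y ∂μ| ≤ C * ρ ^ n * R := by
  obtain ⟨C, ρ, hC, h0, h1, H⟩ := h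
  refine ⟨C, ρ, hC, h0, h1, fun f hf R hR x n => ?_⟩
  have hb : ∀ x, ‖(f x : ℂ)‖ ≤ R := fun x => by simpa using hR x
  have h2 := H (fun x => (f x : ℂ)) (by fun_prop) ⟨R, by rintro _ ⟨x, rfl⟩; exact hb x⟩ x n
  rw [integral_complex_ofReal, integral_complex_ofReal, ← Complex.ofReal_sub,
    Complex.norm_real] at h2
  refine h2.trans ?_
  have : Nonempty S := ⟨x⟩
  gcongr
  exact ciSup_le hb

end Mixing

/-- Second order expansion of a small exponential moment. -/
theorem integral_exp_le {X : Type*} [MeasurableSpace X] {P : Measure X} [IsProbabilityMeasure P]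
    {f : X → ℝ} (hf : Measurable f) {R b α : ℝ} (hR : ∀ᵐ x ∂P, |f x| ≤ R) (hb : ∫ x, f x ∂P ≤ b)
    (hα : 0 ≤ α) (hαR : α * R ≤ 1) :
    ∫ x, Real.exp (α * f x) ∂P ≤ 1 + α * b + α ^ 2 * R ^ 2 := by
  have hi : Integrable f P := Integrable.of_bound hf.aestronglyMeasurable R hR
  have hR0 : 0 ≤ R := by
    obtain ⟨x, hx⟩ := hR.exists
    exact (abs_nonneg _).trans hx
  calc ∫ x, Real.exp (α * f x) ∂P ≤ ∫ x, (1 + α * f x + α ^ 2 * R ^ 2) ∂P := by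
        refine integral_mono_ae ?_ (by fun_prop) ?_
        · refine Integrable.of_bound (by fun_prop) (Real.exp 1) (hR.mono fun x hx => ?_)
          rw [Real.norm_eq_abs, Real.abs_exp]
          refine Real.exp_le_exp.2 (le_trans ?_ hαR)
          exact mul_le_mul_of_nonneg_left ((le_abs_self _).trans hx) hα
        · filter_upwards [hR] with x hx
          have h1 : |α * f x| ≤ α * R := by
            rw [abs_mul, abs_of_nonneg hα]; gcongr
          have h2 := (abs_le.1 (Real.abs_exp_sub_one_sub_id_le (h1.trans hαR))).2
          have h3 : (α * f x) ^ 2 ≤ (α * R) ^ 2 := sq_le_sq' (abs_le.1 h1).1 (abs_le.1 h1).2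
          nlinarith
    _ = 1 + α * ∫ x, f x ∂P + α ^ 2 * R ^ 2 := by
        rw [integral_add (by fun_prop) (by fun_prop), integral_add (by fun_prop) (by fun_prop),
          integral_const_mul]
        simp
    _ ≤ _ := by gcongr

namespace RandCocycle

variable {S : Type*} [MeasurableSpace S] {m : ℕ} {A : RandCocycle S m} {c : ℝ} {K : Kernel S S}
  [IsMarkovKernel K] {μ : Measure S} [IsProbabilityMeasure μ]

theorem measurable_integral_law {T : Type*} [MeasurableSpace T] (k : ℕ)
    {g : (S × T) × (S × (Euc m →L[ℝ] Euc m)) → ℝ} (hg : Measurable g) :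
    Measurable fun z : S × T => ∫ p, g (z, p) ∂(A.law K k z.1) :=
  (StronglyMeasurable.integral_kernel_prod_right' (κ := (A.law K k).comap Prod.fst measurable_fst)
    hg.stronglyMeasurable).measurable

theorem measurable_integral_law' (k : ℕ) {g : S × (Euc m →L[ℝ] Euc m) → ℝ} (hg : Measurable g) :
    Measurable fun x => ∫ p, g p ∂(A.law K k x) :=
  (hg.stronglyMeasurable.integral_kernel).measurable

/-- A quantity of linear growth which is subadditive under products of cocycle values. -/
structure IsSubadditive (c : ℝ) (φ : (Euc m →L[ℝ] Euc m) → ℝ) (R ℓ : ℝ) : Prop where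
  measurable : Measurable φ
  bound : ∀ (n : ℕ) M, HasDistortion (c ^ n) M → |φ M| ≤ R + n * ℓ
  subadd : ∀ (n : ℕ) M, HasDistortion (c ^ n) M → ∀ (k : ℕ) N, HasDistortion (c ^ k) N →
    φ (N * M) ≤ φ N + φ M

variable {φ : (Euc m →L[ℝ] Euc m) → ℝ} {R ℓ : ℝ}

theorem IsSubadditive.integral_law_add_le (hφ : IsSubadditive c φ R ℓ) (hA : A.HasBound c)
    (n k : ℕ) (x : S) :
    ∫ p, φ p.2 ∂(A.law K (n + k) x) ≤
      ∫ p, ∫ q, φ q.2 ∂(A.law K k p.1) ∂(A.law K n x) + ∫ p, φ p.2 ∂(A.law K n x) := by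
  have hm := hφ.measurable
  rw [hA.integral_law_add n k x (g := fun p => φ p.2) (by fun_prop) (R + (n + k : ℕ) * ℓ)
    fun p hp => hφ.bound _ _ hp]
  have h1 : Integrable (fun p : S × (Euc m →L[ℝ] Euc m) => ∫ q, φ q.2 ∂(A.law K k p.1))
      (A.law K n x) :=
    hA.integrable_law n x ((measurable_integral_law' k (g := fun q => φ q.2) (by fun_prop)).comp
      measurable_fst) (R + k * ℓ)
      fun p _ => hA.abs_integral_law_le k p.1 _ fun q hq => hφ.bound _ _ hq
  have h2 : Integrable (fun p : S × (Euc m →L[ℝ] Euc m) => φ p.2) (A.law K n x) :=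
    hA.integrable_law n x (by fun_prop) (R + n * ℓ) fun p hp => hφ.bound _ _ hp
  rw [← integral_add h1 h2]
  refine integral_mono_ae ?_ (h1.add h2) ?_
  · refine hA.integrable_law n x (measurable_integral_law k
      (g := fun z => φ (z.2.2 * z.1.2)) (by fun_prop)) (R + (n + k : ℕ) * ℓ) fun p hp => ?_
    exact hA.abs_integral_law_le k p.1 _ fun q hq => hφ.bound _ _ (hA.mul_pow hp hq)
  · filter_upwards [hA.ae_law n x] with p hp
    have h3 : Integrable (fun q : S × (Euc m →L[ℝ] Euc m) => φ q.2) (A.law K k p.1) :=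
      hA.integrable_law k p.1 (by fun_prop) (R + k * ℓ) fun q hq => hφ.bound _ _ hq
    calc _ ≤ ∫ q, (φ q.2 + φ p.2) ∂(A.law K k p.1) := by
          refine integral_mono_ae ?_ (h3.add (integrable_const _)) ?_
          · exact hA.integrable_law k p.1 (g := fun q => φ (q.2 * p.2)) (by fun_prop)
              (R + (n + k : ℕ) * ℓ) fun q hq => hφ.bound _ _ (hA.mul_pow hp hq)
          · filter_upwards [hA.ae_law k p.1] with q hq using hφ.subadd n _ hp k _ hq
      _ = _ := by
          rw [integral_add h3 (integrable_const _)]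
          simp

theorem IsSubadditive.integral_law_mul_le (hφ : IsSubadditive c φ R ℓ) (hA : A.HasBound c)
    {N : ℕ} {a : ℝ} (ha : ∀ x, ∫ p, φ p.2 ∂(A.law K N x) ≤ a) (q : ℕ) (x : S) :
    ∫ p, φ p.2 ∂(A.law K (N * (q + 1)) x) ≤ (q + 1) * a := by
  induction q with
  | zero => simpa using ha x
  | succ q ih =>
    have hm := hφ.measurable
    have h := hφ.integral_law_add_le (K := K) hA (N * (q + 1)) N x
    have h1 : ∫ p, ∫ q, φ q.2 ∂(A.law K N p.1) ∂(A.law K (N * (q + 1)) x) ≤ a := by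
      calc _ ≤ ∫ p, a ∂(A.law K (N * (q + 1)) x) := by
            refine integral_mono ?_ (integrable_const _) fun p => ha p.1
            exact hA.integrable_law _ x ((measurable_integral_law' N (g := fun q => φ q.2)
              (by fun_prop)).comp measurable_fst) (R + N * ℓ)
              fun p _ => hA.abs_integral_law_le N p.1 _ fun q hq => hφ.bound _ _ hq
        _ = a := by simp
    rw [show N * (q + 1 + 1) = N * (q + 1) + N by ring]
    push_cast
    linarith

/-- Under strong mixing, an upper bound for the stationary mean growth at arbitrarily large times
gives an upper bound which is uniform in the initial point. -/
theorem IsSubadditive.exists_uniform (hφ : IsSubadditive c φ R ℓ) (hA : A.HasBound c)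
    (hR : 0 ≤ R) (hK : IsStronglyMixing K μ) {b ε : ℝ} (hε : 0 < ε)
    (hb : ∃ᶠ n : ℕ in atTop, ∫ x, ∫ p, φ p.2 ∂(A.law K n x) ∂μ ≤ n * b) :
    ∃ N : ℕ, 1 ≤ N ∧ ∀ x, ∫ p, φ p.2 ∂(A.law K N x) ≤ N * (b + ε) := by
  obtain ⟨C, ρ, hC, h0, h1, H⟩ := hK.exists_real
  obtain ⟨j, hj⟩ : ∃ j : ℕ, C * ρ ^ j * ℓ ≤ ε / 2 := by
    have : Tendsto (fun j : ℕ => C * ρ ^ j * ℓ) atTop (𝓝 (C * 0 * ℓ)) :=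
      ((tendsto_pow_atTop_nhds_zero_of_lt_one h0.le h1).const_mul C).mul_const ℓ
    exact (this.eventually_le_const (by simpa using half_pos hε)).exists
  obtain ⟨n0, hn0⟩ := exists_nat_ge ((R + j * ℓ + C * R + j * |b|) / (ε / 2))
  obtain ⟨n, hn, hnb⟩ := Filter.frequently_atTop.1 hb (n0 + 1)
  have hm := hφ.measurable
  refine ⟨j + n, by omega, fun x => ?_⟩
  have h2 := hφ.integral_law_add_le (K := K) hA j n x
  have h3 : ∫ p, φ p.2 ∂(A.law K j x) ≤ R + j * ℓ :=
    (le_abs_self _).trans (hA.abs_integral_law_le j x _ fun p hp => hφ.bound _ _ hp)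
  have hψm : Measurable fun y => ∫ q, φ q.2 ∂(A.law K n y) :=
    measurable_integral_law' n (g := fun q => φ q.2) (by fun_prop)
  have h4 := H (fun y => ∫ q, φ q.2 ∂(A.law K n y)) hψm (R + n * ℓ)
    (fun y => hA.abs_integral_law_le n y _ fun p hp => hφ.bound _ _ hp) x j
  rw [← integral_fst_prodLaw (c := A.op) A.measurable_op j x hψm.stronglyMeasurable] at h4
  have h5 := (abs_le.1 h4).2
  have h6 : C * ρ ^ j * (R + n * ℓ) ≤ C * R + n * (ε / 2) := by
    have : ρ ^ j ≤ 1 := pow_le_one₀ h0.le h1.le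
    have h7 : C * ρ ^ j * R ≤ C * R := by
      calc C * ρ ^ j * R ≤ C * 1 * R := by gcongr
        _ = _ := by ring
    have h8 : n * (C * ρ ^ j * ℓ) ≤ n * (ε / 2) := by gcongr
    nlinarith
  have h7 : R + j * ℓ + C * R + j * |b| ≤ n * (ε / 2) := by
    rw [div_le_iff₀ (by positivity)] at hn0
    refine hn0.trans ?_
    gcongr
    omega
  have h8 : -(j * |b|) ≤ j * b := by
    have := neg_abs_le b
    nlinarith [(Nat.cast_nonneg j : (0 : ℝ) ≤ j)]
  have h9 : 0 ≤ (j : ℝ) * ε := by positivity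
  push_cast
  nlinarith

/-! ### Growth of individual directions -/

/-- The mean logarithmic growth in `n` steps of the vector `v`, for the chain started at `x`. -/
def meanGrowth (A : RandCocycle S m) (K : Kernel S S) (n : ℕ) (x : S) (v : Euc m) : ℝ :=
  ∫ p, Real.log (‖p.2 v‖ / ‖v‖) ∂(A.law K n x)

theorem measurable_apply_op {T : Type*} [MeasurableSpace T] {f : T → (Euc m →L[ℝ] Euc m)}
    {g : T → Euc m} (hf : Measurable f) (hg : Measurable g) : Measurable fun t => f t (g t) :=
  (Continuous.measurable (f := fun z : (Euc m →L[ℝ] Euc m) × Euc m => z.1 z.2)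
    (continuous_fst.clm_apply continuous_snd)).comp (hf.prodMk hg)

theorem measurable_log_growth : Measurable fun z : (Euc m →L[ℝ] Euc m) × Euc m =>
    Real.log (‖z.1 z.2‖ / ‖z.2‖) := by
  have := measurable_apply_op (f := fun z : (Euc m →L[ℝ] Euc m) × Euc m => z.1)
    (g := fun z => z.2) measurable_fst measurable_snd
  fun_prop

theorem measurable_meanGrowth (n : ℕ) :
    Measurable fun z : S × Euc m => A.meanGrowth K n z.1 z.2 :=
  measurable_integral_law n (g := fun z => Real.log (‖z.2.2 z.1.2‖ / ‖z.1.2‖))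
    (measurable_log_growth.comp (f := fun z : (S × Euc m) × (S × (Euc m →L[ℝ] Euc m)) =>
      (z.2.2, z.1.2)) (by fun_prop))

theorem HasBound.abs_log_growth_le (hA : A.HasBound c) {n : ℕ} {M : Euc m →L[ℝ] Euc m}
    (hM : HasDistortion (c ^ n) M) {v : Euc m} (hv : v ≠ 0) :
    |Real.log (‖M v‖ / ‖v‖)| ≤ n * Real.log c := by
  rw [← Real.log_pow]
  exact hM.abs_log_le (pow_pos hA.pos n) hv

theorem HasBound.abs_meanGrowth_le (hA : A.HasBound c) (n : ℕ) (x : S) {v : Euc m} (hv : v ≠ 0) :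
    |A.meanGrowth K n x v| ≤ n * Real.log c :=
  hA.abs_integral_law_le n x _ fun _ hp => hA.abs_log_growth_le hp hv

theorem HasBound.integrable_log_growth (hA : A.HasBound c) (n : ℕ) (x : S) {v : Euc m}
    (hv : v ≠ 0) :
    Integrable (fun p : S × (Euc m →L[ℝ] Euc m) => Real.log (‖p.2 v‖ / ‖v‖)) (A.law K n x) :=
  hA.integrable_law n x (measurable_log_growth.comp (f := fun p : S × (Euc m →L[ℝ] Euc m) =>
    (p.2, v)) (by fun_prop)) _ fun _ hp => hA.abs_log_growth_le hp hv

theorem HasBound.integrable_meanGrowth (hA : A.HasBound c) (n k : ℕ) (x : S) {v : Euc m}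
    (hv : v ≠ 0) :
    Integrable (fun p : S × (Euc m →L[ℝ] Euc m) => A.meanGrowth K k p.1 (p.2 v)) (A.law K n x) :=
  hA.integrable_law n x ((measurable_meanGrowth k).comp (measurable_fst.prodMk
    (measurable_apply_op measurable_snd measurable_const))) _
    fun p hp => hA.abs_meanGrowth_le k p.1 (hp.map_ne_zero hv)

theorem HasBound.meanGrowth_add (hA : A.HasBound c) (n k : ℕ) (x : S) {v : Euc m} (hv : v ≠ 0) :
    A.meanGrowth K (n + k) x v =
      A.meanGrowth K n x v + ∫ p, A.meanGrowth K k p.1 (p.2 v) ∂(A.law K n x) := by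
  rw [meanGrowth, hA.integral_law_add n k x (g := fun p => Real.log (‖p.2 v‖ / ‖v‖))
    (measurable_log_growth.comp (f := fun p : S × (Euc m →L[ℝ] Euc m) => (p.2, v)) (by fun_prop)) _
    fun p hp => hA.abs_log_growth_le hp hv, meanGrowth,
    ← integral_add (hA.integrable_log_growth n x hv) (hA.integrable_meanGrowth n k x hv)]
  refine integral_congr_ae ?_
  filter_upwards [hA.ae_law n x] with p hp
  have hpv := hp.map_ne_zero hv
  have e : Real.log (‖p.2 v‖ / ‖v‖) = ∫ q, Real.log (‖p.2 v‖ / ‖v‖) ∂(A.law K k p.1) := by simp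
  rw [meanGrowth, add_comm, e, ← integral_add (hA.integrable_log_growth k p.1 hpv)
    (integrable_const _)]
  refine integral_congr_ae ?_
  filter_upwards [hA.ae_law k p.1] with q hq
  have h1 := norm_ne_zero_iff.2 hv
  have h2 := norm_ne_zero_iff.2 hpv
  have h3 := norm_ne_zero_iff.2 (hq.map_ne_zero hpv)
  change Real.log (‖q.2 (p.2 v)‖ / ‖v‖) = _
  rw [← Real.log_mul (by positivity) (by positivity)]
  congr 1
  field_simp

theorem HasBound.mul_le_meanGrowth (hA : A.HasBound c) {N : ℕ} {a : ℝ}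
    (ha : ∀ x (v : Euc m), v ≠ 0 → a ≤ A.meanGrowth K N x v) (q : ℕ) (x : S) {v : Euc m}
    (hv : v ≠ 0) : q * a ≤ A.meanGrowth K (N * q) x v := by
  induction q with
  | zero =>
    have := hA.abs_meanGrowth_le (K := K) 0 x hv
    simp only [Nat.cast_zero, zero_mul, abs_nonpos_iff] at this
    simp [this]
  | succ q ih =>
    rw [show N * (q + 1) = N * q + N by ring, hA.meanGrowth_add _ _ _ hv]
    have h1 : a ≤ ∫ p, A.meanGrowth K N p.1 (p.2 v) ∂(A.law K (N * q) x) := by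
      calc a = ∫ p, a ∂(A.law K (N * q) x) := by simp
        _ ≤ _ := integral_mono_ae (integrable_const _) (hA.integrable_meanGrowth _ N x hv)
            ((hA.ae_law _ x).mono fun p hp => ha p.1 _ (hp.map_ne_zero hv))
    push_cast
    linarith

end RandCocycle

namespace RandCocycle

variable {S : Type*} [MeasurableSpace S] {m : ℕ} {A : RandCocycle S m} {c : ℝ} {K : Kernel S S}
  [IsMarkovKernel K] {μ : Measure S} [IsProbabilityMeasure μ]

/-! ### The sums of Lyapunov exponents -/

theorem lyapSum_zero (A : RandCocycle S m) : A.lyapSum K μ 0 = 0 := by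
  simp [lyapSum, wedgeNorm_zero]

theorem isSubadditive_log_wedgeNorm (hc : 1 ≤ c) {k : ℕ} (hk : k ≤ m) :
    ∃ R : ℝ, 0 ≤ R ∧
      IsSubadditive (m := m) c (fun M => Real.log (wedgeNorm k M)) R (k * Real.log c) := by
  obtain ⟨R, hR, H⟩ := exists_wedgeNorm_bounds hk
  have hc0 : 0 < c := zero_lt_one.trans_le hc
  refine ⟨Real.log R, Real.log_nonneg hR,
    (continuous_wedgeNorm k).measurable.log, fun n M hM => ?_, fun n M hM l N hN => ?_⟩
  · have := (H (c ^ n) (pow_pos hc0 n) M hM).2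
    rw [Real.log_pow] at this
    linarith
  · have h1 := (H _ (pow_pos hc0 n) M hM).1
    have h2 := (H _ (pow_pos hc0 l) N hN).1
    rw [← Real.log_mul h2.ne' h1.ne']
    have h3 := hN.mul hM (pow_nonneg hc0.le n) (pow_nonneg hc0.le l)
    exact Real.log_le_log (H _ (by positivity) _ h3).1 (wedgeNorm_mul_le k N M)

theorem isSubadditive_log_norm (hc : 1 ≤ c) (hm : 1 ≤ m) :
    IsSubadditive (m := m) c (fun M => Real.log ‖M‖) 0 (Real.log c) := by
  have hc0 : 0 < c := zero_lt_one.trans_le hc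
  refine ⟨by fun_prop, fun n M hM => ?_, fun n M hM l N hN => ?_⟩
  · rw [zero_add, ← Real.log_pow, abs_le, ← Real.log_inv]
    have h1 := hM.norm_pos (pow_pos hc0 n) hm
    have h2 : 0 < (c ^ n)⁻¹ := by positivity
    exact ⟨Real.log_le_log h2 h1,
      Real.log_le_log (h2.trans_le h1) (hM.norm_le (by positivity))⟩
  · have h1 := hM.norm_pos (pow_pos hc0 n) hm
    have h2 := hN.norm_pos (pow_pos hc0 l) hm
    have h3 := (hN.mul hM (pow_nonneg hc0.le n) (pow_nonneg hc0.le l)).norm_pos (by positivity) hm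
    have h1' : 0 < ‖M‖ := lt_of_lt_of_le (by positivity) h1
    have h2' : 0 < ‖N‖ := lt_of_lt_of_le (by positivity) h2
    rw [← Real.log_mul h2'.ne' h1'.ne']
    exact Real.log_le_log (lt_of_lt_of_le (by positivity) h3) (norm_mul_le _ _)

/-- The normalised logarithmic growth whose upper limit defines `Λ_k`. -/
def logGrowth (A : RandCocycle S m) (k n : ℕ) (ω : ℕ → S) : ℝ :=
  (1 / (n : ℝ)) * Real.log (wedgeNorm k (A.iter ω n))

theorem measurable_logGrowth (k n : ℕ) : Measurable (A.logGrowth k n) :=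
  (((continuous_wedgeNorm k).measurable.comp (A.measurable_iter n)).log).const_mul _

theorem measurable_limsup_logGrowth (k : ℕ) :
    Measurable fun ω => limsup (fun n => A.logGrowth k n ω) atTop :=
  Measurable.limsup fun n => measurable_logGrowth k n

theorem HasBound.exists_abs_logGrowth_le (hA : A.HasBound c) {k : ℕ} (hk : k ≤ m) :
    ∃ D : ℝ, ∀ n ω, |A.logGrowth k n ω| ≤ D := by
  obtain ⟨R, hR, hφ⟩ := isSubadditive_log_wedgeNorm hA.1 hk
  have hl := hA.log_nonneg
  refine ⟨R + k * Real.log c, fun n ω => ?_⟩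
  rcases Nat.eq_zero_or_pos n with rfl | hn
  · simp only [logGrowth, Nat.cast_zero, div_zero, zero_mul, abs_zero]
    positivity
  · have h := hφ.bound n _ (hA.iter ω n)
    have hn' : (1 : ℝ) ≤ n := by exact_mod_cast hn
    rw [logGrowth, abs_mul, abs_of_nonneg (by positivity), one_div, inv_mul_le_iff₀ (by positivity)]
    refine h.trans ?_
    nlinarith

theorem abs_limsup_le {u : ℕ → ℝ} {D : ℝ} (hu : ∀ n, |u n| ≤ D) : |limsup u atTop| ≤ D := by
  have hb : IsBoundedUnder (· ≤ ·) atTop u := isBoundedUnder_of ⟨D, fun n => (abs_le.1 (hu n)).2⟩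
  have hb' : IsBoundedUnder (· ≥ ·) atTop u := isBoundedUnder_of ⟨-D, fun n => (abs_le.1 (hu n)).1⟩
  rw [abs_le]
  constructor
  · exact le_limsup_of_frequently_le (Frequently.of_forall fun n => (abs_le.1 (hu n)).1) hb
  · exact limsup_le_of_le hb'.isCoboundedUnder_le
      (Eventually.of_forall fun n => (abs_le.1 (hu n)).2)

/-- By Fatou's lemma the mean growth is asymptotically at most `Λ_k`. -/
theorem HasBound.eventually_integral_le (hA : A.HasBound c) {k : ℕ} (hk : k ≤ m) {b : ℝ}
    (hb : A.lyapSum K μ k < b) :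
    ∀ᶠ n : ℕ in atTop,
      ∫ x, ∫ p, Real.log (wedgeNorm k p.2) ∂(A.law K n x) ∂μ ≤ n * b := by
  obtain ⟨D, hD⟩ := hA.exists_abs_logGrowth_le hk
  set P := markovMeasure K μ
  set L : (ℕ → S) → ℝ := fun ω => limsup (fun n => A.logGrowth k n ω) atTop
  have hLm : Measurable L := measurable_limsup_logGrowth k
  have hLb : ∀ ω, |L ω| ≤ D := fun ω => abs_limsup_le fun n => hD n ω
  have hLi : Integrable L P := Integrable.of_bound hLm.aestronglyMeasurable D
    (Eventually.of_forall hLb)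
  have hXi : ∀ n, Integrable (A.logGrowth k n) P := fun n =>
    Integrable.of_bound (measurable_logGrowth k n).aestronglyMeasurable D
      (Eventually.of_forall fun ω => hD n ω)
  -- the positive part of the excess of the growth at time `n` over its upper limit tends to zero
  set ε := (b - A.lyapSum K μ k) / 2
  have hε : 0 < ε := by simp only [ε]; linarith
  have hZ : Tendsto (fun n => ∫ ω, max (A.logGrowth k n ω - L ω - ε) 0 ∂P) atTop
      (𝓝 (∫ _, (0 : ℝ) ∂P)) := by
    refine tendsto_integral_of_dominated_convergence (fun _ => 2 * D + ε)
      (fun n => ?_) (integrable_const _) (fun n => Eventually.of_forall fun ω => ?_)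
      (Eventually.of_forall fun ω => ?_)
    · have := measurable_logGrowth (A := A) k n
      exact Measurable.aestronglyMeasurable (by fun_prop)
    · have h1 := abs_le.1 (hD n ω)
      have h2 := abs_le.1 (hLb ω)
      rw [Real.norm_eq_abs, abs_of_nonneg (le_max_right _ _)]
      exact max_le (by linarith) (by linarith)
    · have h1 : ∀ᶠ n in atTop, A.logGrowth k n ω < L ω + ε :=
        eventually_lt_of_limsup_lt (lt_add_of_pos_right _ hε)
          (isBoundedUnder_of ⟨D, fun n => (abs_le.1 (hD n ω)).2⟩)
      refine tendsto_const_nhds.congr' ?_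
      filter_upwards [h1] with n hn
      rw [max_eq_right (by linarith)]
  rw [integral_zero] at hZ
  filter_upwards [hZ.eventually_lt_const hε, eventually_gt_atTop 0] with n hn hn0
  obtain ⟨R, hR, hφ⟩ := isSubadditive_log_wedgeNorm (m := m) hA.1 hk
  have hm : Measurable fun p : S × (Euc m →L[ℝ] Euc m) => Real.log (wedgeNorm k p.2) :=
    hφ.measurable.comp measurable_snd
  have hint : Integrable (fun p : S × (Euc m →L[ℝ] Euc m) => Real.log (wedgeNorm k p.2))
      (μ.bind (A.law K n)) := by
    refine Integrable.of_bound hm.aestronglyMeasurable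
      (R + n * (k * Real.log c)) ?_
    refine Measure.ae_comp_of_ae_ae ?_ (Eventually.of_forall fun x =>
      (hA.ae_law n x).mono fun p hp => hφ.bound n _ hp)
    exact measurableSet_le hm.norm measurable_const
  rw [← integral_iter_markovMeasure A n (g := fun p => Real.log (wedgeNorm k p.2)) hm
    hint]
  have hI1 : Integrable (fun ω => L ω + ε) P := hLi.add (integrable_const _)
  have hI2 : Integrable (fun ω => max (A.logGrowth k n ω - L ω - ε) 0) P :=
    (((hXi n).sub hLi).sub (integrable_const ε)).pos_part
  have h1 : ∫ ω, A.logGrowth k n ω ∂P ≤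
      ∫ ω, (L ω + ε + max (A.logGrowth k n ω - L ω - ε) 0) ∂P := by
    refine integral_mono (hXi n) (hI1.add hI2) fun ω => ?_
    have := le_max_left (A.logGrowth k n ω - L ω - ε) 0
    simp only
    linarith
  rw [integral_add hI1 hI2, integral_add hLi (integrable_const _)] at h1
  have h2 : ∫ ω, L ω ∂P = A.lyapSum K μ k := rfl
  have h3 : ∫ ω, A.logGrowth k n ω ∂P =
      (1 / (n : ℝ)) * ∫ ω, Real.log (wedgeNorm k (A.iter ω n)) ∂P := integral_const_mul _ _
  have hn' : (0 : ℝ) < n := by exact_mod_cast hn0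
  have h4 : ∫ _, ε ∂P = ε := by simp
  have h5 : (1 / (n : ℝ)) * ∫ ω, Real.log (wedgeNorm k (A.iter ω n)) ∂P ≤ b := by
    rw [← h3]
    refine h1.trans ?_
    rw [h2, h4]
    have : A.lyapSum K μ k + ε + ε = b := by simp only [ε]; ring
    linarith
  rwa [one_div, inv_mul_le_iff₀ hn'] at h5

/-! ### Exponential moments -/

/-- A function whose mean is multiplied by at most `r` during `N` steps of the chain decays like `r
^ q` along the multiples `N q` of `N`. -/
theorem lintegral_law_le_pow {N : ℕ} {g : S × (Euc m →L[ℝ] Euc m) → ENNReal} {r : ENNReal}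
    (hg : Measurable g) (h0 : ∀ x, ∫⁻ p, g p ∂(A.law K 0 x) ≤ 1)
    (h1 : ∀ (n : ℕ) (x : S), ∀ᵐ p ∂(A.law K n x),
      ∫⁻ q, g (q.1, q.2 * p.2) ∂(A.law K N p.1) ≤ r * g p) (q : ℕ) (x : S) :
    ∫⁻ p, g p ∂(A.law K (N * q) x) ≤ r ^ q := by
  induction q with
  | zero => simpa using h0 x
  | succ q ih =>
    rw [show N * (q + 1) = N * q + N by ring, lintegral_prodLaw_add A.measurable_op _ _ _ hg]
    calc _ ≤ ∫⁻ p, r * g p ∂(A.law K (N * q) x) := lintegral_mono_ae (h1 _ x)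
      _ = r * ∫⁻ p, g p ∂(A.law K (N * q) x) := lintegral_const_mul _ hg
      _ ≤ r * r ^ q := by gcongr
      _ = _ := by rw [pow_succ']

theorem lintegral_exp_le {X : Type*} [MeasurableSpace X] {P : Measure X} [IsProbabilityMeasure P]
    {f : X → ℝ} (hf : Measurable f) {R b d α : ℝ} (hR : ∀ᵐ x ∂P, |f x| ≤ R) (hb : ∫ x, f x ∂P ≤ b)
    (hα : 0 ≤ α) (hαR : α * R ≤ 1) (hd : α * R ^ 2 ≤ d) :
    ∫⁻ x, ENNReal.ofReal (Real.exp (α * f x)) ∂P ≤ ENNReal.ofReal (Real.exp (α * (b + d))) := by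
  have hi : Integrable (fun x => Real.exp (α * f x)) P := by
    refine Integrable.of_bound (by fun_prop) (Real.exp 1) (hR.mono fun x hx => ?_)
    rw [Real.norm_eq_abs, Real.abs_exp]
    refine Real.exp_le_exp.2 (le_trans ?_ hαR)
    exact mul_le_mul_of_nonneg_left ((le_abs_self _).trans hx) hα
  rw [← ofReal_integral_eq_lintegral_ofReal hi (Eventually.of_forall fun x => (Real.exp_pos _).le)]
  refine ENNReal.ofReal_le_ofReal ((integral_exp_le hf hR hb hα hαR).trans ?_)
  have := Real.add_one_le_exp (α * (b + d))
  nlinarith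

/-- A small exponent for which the quadratic error terms are negligible. -/
theorem exists_exponent (R : ℝ) {d : ℝ} (hd : 0 < d) :
    ∃ α : ℝ, 0 < α ∧ α ≤ 1 ∧ α * R ≤ 1 ∧ α * R ^ 2 ≤ d := by
  have h1 : Tendsto (fun α : ℝ => α * R) (𝓝[>] 0) (𝓝 (0 * R)) :=
    (tendsto_id.mono_left nhdsWithin_le_nhds).mul_const R
  have h2 : Tendsto (fun α : ℝ => α * R ^ 2) (𝓝[>] 0) (𝓝 (0 * R ^ 2)) :=
    (tendsto_id.mono_left nhdsWithin_le_nhds).mul_const _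
  have h3 : Tendsto (fun α : ℝ => α) (𝓝[>] 0) (𝓝 0) := tendsto_id.mono_left nhdsWithin_le_nhds
  rw [zero_mul] at h1 h2
  obtain ⟨α, h4, h5, h6, h7⟩ := ((eventually_mem_nhdsWithin (a := (0 : ℝ)) (s := Set.Ioi 0)).and
    ((h3.eventually_le_const zero_lt_one).and
      ((h1.eventually_le_const zero_lt_one).and (h2.eventually_le_const hd)))).exists
  exact ⟨α, h4, h5, h6, h7⟩

theorem HasBound.norm_iter_add_le (hA : A.HasBound c) (ω : ℕ → S) (n r : ℕ) :
    ‖A.iter ω (n + r)‖ ≤ c ^ r * ‖A.iter ω n‖ := by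
  induction r with
  | zero => simp
  | succ r ih =>
    rw [← add_assoc, iter_succ]
    calc _ ≤ ‖A.op (ω (n + r), ω (n + r + 1))‖ * ‖A.iter ω (n + r)‖ := norm_mul_le _ _
      _ ≤ c * (c ^ r * ‖A.iter ω n‖) := by
          gcongr
          · exact hA.pos.le
          · exact (hA.2 _).norm_le hA.pos.le
      _ = _ := by ring

/-- A uniform upper bound for the mean growth at one time bounds the top Lyapunov exponent. -/
theorem HasBound.lyapSum_one_le (hA : A.HasBound c) (hm : 1 ≤ m) {N : ℕ} (hN : 1 ≤ N) {b' b : ℝ}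
    (hbb : b' < b) (hb : ∀ x, ∫ p, Real.log ‖p.2‖ ∂(A.law K N x) ≤ N * b') :
    A.lyapSum K μ 1 ≤ b := by
  have hφ := isSubadditive_log_norm (m := m) hA.1 hm
  have hφm := hφ.measurable
  have hN' : (0 : ℝ) < N := by exact_mod_cast hN
  set d := (b - b') / 2 with hd
  have hd0 : 0 < d := by rw [hd]; linarith
  obtain ⟨α, hα, -, hα1, hα2⟩ := exists_exponent (0 + N * Real.log c) (mul_pos hN' hd0)
  set g : S × (Euc m →L[ℝ] Euc m) → ENNReal := fun p =>
    ENNReal.ofReal (Real.exp (α * Real.log ‖p.2‖))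
  have hg : Measurable g := by fun_prop
  set r := ENNReal.ofReal (Real.exp (α * (N * b' + N * d)))
  have hbase : ∀ x, ∫⁻ p, g p ∂(A.law K N x) ≤ r := fun x =>
    lintegral_exp_le (f := fun p : S × (Euc m →L[ℝ] Euc m) => Real.log ‖p.2‖) (by fun_prop)
      ((hA.ae_law N x).mono fun p hp => hφ.bound N _ hp) (hb x) hα.le hα1 hα2
  have hpow := lintegral_law_le_pow (A := A) (K := K) (N := N) (r := r) hg
    (fun x => by
      change ∫⁻ p, g p ∂(prodLaw K A.op 0 x) ≤ 1
      rw [prodLaw_zero, lintegral_dirac' _ hg]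
      have : Nontrivial (Euc m) := by
        have : Nonempty (Fin m) := ⟨⟨0, hm⟩⟩
        infer_instance
      simp [g])
    (fun n x => by
      filter_upwards [hA.ae_law n x] with p hp
      calc _ ≤ ∫⁻ q, g q * g p ∂(A.law K N p.1) := by
            refine lintegral_mono_ae ?_
            filter_upwards [hA.ae_law N p.1] with q hq
            simp only [g]
            rw [← ENNReal.ofReal_mul (Real.exp_pos _).le, ← Real.exp_add, ← mul_add]
            exact ENNReal.ofReal_le_ofReal (Real.exp_le_exp.2
              (mul_le_mul_of_nonneg_left (hφ.subadd n _ hp N _ hq) hα.le))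
        _ = (∫⁻ q, g q ∂(A.law K N p.1)) * g p := lintegral_mul_const _ hg
        _ ≤ r * g p := by gcongr; exact hbase p.1)
  -- Borel–Cantelli along the multiples of `N`
  have hsum : ∫⁻ ω, ∑' q : ℕ, ENNReal.ofReal (Real.exp (-(α * (N * q * b)))) *
      g (ω (N * q), A.iter ω (N * q)) ∂(markovMeasure K μ) ≠ ⊤ := by
    have hmeas : ∀ q : ℕ, Measurable fun ω : ℕ → S => g (ω (N * q), A.iter ω (N * q)) := fun q =>
      hg.comp ((measurable_pi_apply _).prodMk (A.measurable_iter _))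
    rw [lintegral_tsum fun q => ((hmeas q).const_mul _).aemeasurable]
    have hq : ∀ q : ℕ, ∫⁻ ω, ENNReal.ofReal (Real.exp (-(α * (N * q * b)))) *
        g (ω (N * q), A.iter ω (N * q)) ∂(markovMeasure K μ) ≤
        (ENNReal.ofReal (Real.exp (-(α * (N * d))))) ^ q := by
      intro q
      rw [lintegral_const_mul _ (hmeas q), ← lintegral_map (f := g)
        (g := fun ω : ℕ → S => (ω (N * q), A.iter ω (N * q))) hg
        ((measurable_pi_apply _).prodMk (A.measurable_iter _)), map_iter_markovMeasure,
        Measure.lintegral_bind (Kernel.aemeasurable _) hg.aemeasurable]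
      calc _ ≤ ENNReal.ofReal (Real.exp (-(α * (N * q * b)))) * ∫⁻ x, r ^ q ∂μ := by
            gcongr with x; exact hpow q x
        _ = _ := by
            rw [lintegral_const, measure_univ, mul_one, ← ENNReal.ofReal_pow (Real.exp_pos _).le,
              ← ENNReal.ofReal_pow (Real.exp_pos _).le, ← ENNReal.ofReal_mul (Real.exp_pos _).le,
              ← Real.exp_nat_mul, ← Real.exp_nat_mul, ← Real.exp_add]
            congr 2
            have : b = b' + 2 * d := by rw [hd]; ring
            rw [this]; ring
    refine ne_top_of_le_ne_top ?_ (ENNReal.tsum_le_tsum hq)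
    rw [ENNReal.tsum_geometric, ENNReal.inv_ne_top, ne_eq, tsub_eq_zero_iff_le, not_le]
    rw [ENNReal.ofReal_lt_one, Real.exp_lt_one_iff]
    have : 0 < α * (N * d) := by positivity
    linarith
  have hmeas' : Measurable fun ω : ℕ → S => ∑' q : ℕ,
      ENNReal.ofReal (Real.exp (-(α * (N * q * b)))) * g (ω (N * q), A.iter ω (N * q)) :=
    Measurable.tsum fun q => (hg.comp
      ((measurable_pi_apply _).prodMk (A.measurable_iter _))).const_mul _
  have hae : ∀ᵐ ω ∂(markovMeasure K μ), limsup (fun n => A.logGrowth 1 n ω) atTop ≤ b := by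
    filter_upwards [ae_lt_top hmeas' hsum] with ω hω
    have h1 := ENNReal.tendsto_atTop_zero_of_tsum_ne_top hω.ne
    obtain ⟨q0, hq0⟩ := eventually_atTop.1 (h1.eventually_lt_const zero_lt_one)
    have h2 : ∀ q ≥ q0, Real.log ‖A.iter ω (N * q)‖ ≤ N * q * b := by
      intro q hq
      have := hq0 q hq
      simp only [g] at this
      rw [← ENNReal.ofReal_mul (Real.exp_pos _).le, ← Real.exp_add, ENNReal.ofReal_lt_one,
        Real.exp_lt_one_iff] at this
      have h3 : α * Real.log ‖A.iter ω (N * q)‖ < α * (N * q * b) := by linarith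
      exact (lt_of_mul_lt_mul_left h3 hα.le).le
    obtain ⟨R, hR, hRb⟩ := exists_wedgeNorm_le (m := m) 1
    obtain ⟨R', hR', hRb'⟩ := exists_wedgeNorm_bounds (m := m) hm
    -- `E` bounds the effect of the fewer than `N` steps after the last multiple of `N`
    set E := Real.log R + N * Real.log c + N * |b|
    have h4 : ∀ n ≥ N * q0, Real.log (wedgeNorm 1 (A.iter ω n)) ≤ E + n * b := by
      intro n hn
      have hq : q0 ≤ n / N := (Nat.le_div_iff_mul_le hN).2 (by rwa [mul_comm])
      have h5 := h2 (n / N) hq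
      have hdm : N * (n / N) + n % N = n := Nat.div_add_mod n N
      have hr : n % N < N := Nat.mod_lt _ hN
      have h6 := hA.norm_iter_add_le ω (N * (n / N)) (n % N)
      rw [hdm] at h6
      have hpos : ∀ n, 0 < ‖A.iter ω n‖ := fun n =>
        lt_of_lt_of_le (by have := hA.pos; positivity)
          ((hA.iter ω n).norm_pos (pow_pos hA.pos n) hm)
      have h7 : wedgeNorm 1 (A.iter ω n) ≤ R * (c ^ N * ‖A.iter ω (N * (n / N))‖) := by
        refine (hRb _).trans ?_
        rw [pow_one]
        gcongr
        refine h6.trans ?_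
        gcongr
        exact hA.1
      have hc0 := hA.pos
      have h8 := Real.log_le_log (hRb' _ (pow_pos hA.pos n) _ (hA.iter ω n)).1 h7
      rw [Real.log_mul (by positivity) (mul_pos (pow_pos hA.pos N) (hpos _)).ne',
        Real.log_mul (by positivity) (hpos _).ne', Real.log_pow] at h8
      have h9 : (n : ℝ) = N * (n / N : ℕ) + (n % N : ℕ) := by exact_mod_cast hdm.symm
      have h10 : -(N * |b|) ≤ (n % N : ℕ) * b := by
        have h11 : ((n % N : ℕ) : ℝ) ≤ N := by exact_mod_cast hr.le
        have h12 := neg_abs_le b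
        have h13 : (0 : ℝ) ≤ (n % N : ℕ) := Nat.cast_nonneg _
        nlinarith [abs_nonneg b]
      have h14 : (n : ℝ) * b = N * (n / N : ℕ) * b + (n % N : ℕ) * b := by
        conv_lhs => rw [h9]
        ring
      simp only [E]
      linarith
    obtain ⟨D, hD⟩ := hA.exists_abs_logGrowth_le hm
    refine le_of_forall_pos_le_add fun ε hε => ?_
    have hcob : IsCoboundedUnder (· ≤ ·) atTop fun n => A.logGrowth 1 n ω :=
      (isBoundedUnder_of ⟨-D, fun n => (abs_le.1 (hD n ω)).1⟩ :
        IsBoundedUnder (· ≥ ·) atTop fun n => A.logGrowth 1 n ω).isCoboundedUnder_le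
    refine limsup_le_of_le hcob ?_
    have h15 : Tendsto (fun n : ℕ => E / (n : ℝ)) atTop (𝓝 0) :=
      tendsto_const_div_atTop_nhds_zero_nat E
    filter_upwards [h15.eventually_le_const hε, eventually_ge_atTop (N * q0), eventually_gt_atTop 0]
      with n h16 h17 h18
    have h19 : (0 : ℝ) < n := by exact_mod_cast h18
    rw [logGrowth, one_div, inv_mul_le_iff₀ h19]
    rw [div_le_iff₀ h19] at h16
    have := h4 n h17
    nlinarith
  obtain ⟨D, hD⟩ := hA.exists_abs_logGrowth_le hm
  have hint : Integrable (fun ω => limsup (fun n => A.logGrowth 1 n ω) atTop) (markovMeasure K μ) :=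
    Integrable.of_bound (measurable_limsup_logGrowth 1).aestronglyMeasurable D
      (Eventually.of_forall fun ω => abs_limsup_le fun n => hD n ω)
  calc A.lyapSum K μ 1 ≤ ∫ _, b ∂(markovMeasure K μ) :=
        integral_mono_ae hint (integrable_const _) hae
    _ = b := by simp

end RandCocycle

namespace RandCocycle

variable {S : Type*} [MeasurableSpace S] {m : ℕ} {A : RandCocycle S m} {c : ℝ} {K : Kernel S S}
  [IsMarkovKernel K] {μ : Measure S} [IsProbabilityMeasure μ]

/-! ### Deviations from the minimal growth -/

theorem abs_le_add_exp_neg (t : ℝ) : |t| ≤ t + Real.exp (-t) := by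
  rcases le_total 0 t with h | h
  · rw [abs_of_nonneg h]
    linarith [Real.exp_pos (-t)]
  · rw [abs_of_nonpos h]
    have := Real.add_one_le_exp (-t / 2)
    have h2 : Real.exp (-t) = Real.exp (-t / 2) * Real.exp (-t / 2) := by
      rw [← Real.exp_add]; ring_nf
    nlinarith [sq_nonneg (t / 2 + 1), sq_nonneg t]

/-- If `a` bounds the mean growth rate from below uniformly, then the growth of a vector is
concentrated around its mean as soon as that mean is close to the lower bound. This follows from
Jensen's inequality being almost sharp for a small negative exponential moment. -/
theorem HasBound.exists_deviation (hA : A.HasBound c) {N : ℕ} (hN : 1 ≤ N) {a d : ℝ} (hd : 0 < d)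
    (ha : ∀ x (v : Euc m), v ≠ 0 → N * a ≤ A.meanGrowth K N x v) :
    ∃ α : ℝ, 0 < α ∧ ∀ (q : ℕ) (x : S) (v : Euc m), v ≠ 0 →
      ∫ p, |Real.log (‖p.2 v‖ / ‖v‖) - (N * q : ℕ) * (a - d)| ∂(A.law K (N * q) x) ≤
        A.meanGrowth K (N * q) x v - (N * q : ℕ) * (a - d) + 1 / α := by
  have hN' : (0 : ℝ) < N := by exact_mod_cast hN
  obtain ⟨α, hα, -, hα1, hα2⟩ := exists_exponent (N * Real.log c) (mul_pos hN' hd)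
  refine ⟨α, hα, fun q x v hv => ?_⟩
  set r := ENNReal.ofReal (Real.exp (α * (-(N * a) + N * d)))
  let g : Euc m → S × (Euc m →L[ℝ] Euc m) → ENNReal := fun v p =>
    ENNReal.ofReal (Real.exp (α * (-Real.log (‖p.2 v‖ / ‖v‖))))
  have hlm : ∀ v : Euc m, Measurable fun p : S × (Euc m →L[ℝ] Euc m) =>
      Real.log (‖p.2 v‖ / ‖v‖) := fun v =>
    measurable_log_growth.comp (f := fun p : S × (Euc m →L[ℝ] Euc m) => (p.2, v)) (by fun_prop)
  have hg : ∀ v, Measurable (g v) := fun v => by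
    have := hlm v
    fun_prop
  have hbase : ∀ x (v : Euc m), v ≠ 0 → ∫⁻ p, g v p ∂(A.law K N x) ≤ r := fun x v hv => by
    refine lintegral_exp_le (f := fun p : S × (Euc m →L[ℝ] Euc m) => -Real.log (‖p.2 v‖ / ‖v‖))
      (hlm v).neg ((hA.ae_law N x).mono fun p hp => ?_) ?_ hα.le hα1 hα2
    · rw [abs_neg]; exact hA.abs_log_growth_le hp hv
    · rw [integral_neg]
      exact neg_le_neg (ha x v hv)
  have hpow : ∫⁻ p, g v p ∂(A.law K (N * q) x) ≤ r ^ q := by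
    refine lintegral_law_le_pow (A := A) (K := K) (N := N) (r := r) (hg v) (fun x => ?_)
      (fun n x => ?_) q x
    · change ∫⁻ p, g v p ∂(prodLaw K A.op 0 x) ≤ 1
      rw [prodLaw_zero, lintegral_dirac' _ (hg v)]
      simp [g, hv]
    · filter_upwards [hA.ae_law n x] with p hp
      have hpv := hp.map_ne_zero hv
      calc _ = ∫⁻ q, g (p.2 v) q * g v p ∂(A.law K N p.1) := by
            refine lintegral_congr_ae ?_
            filter_upwards [hA.ae_law N p.1] with q hq
            have h1 := norm_ne_zero_iff.2 hv
            have h2 := norm_ne_zero_iff.2 hpv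
            have h3 := norm_ne_zero_iff.2 (hq.map_ne_zero hpv)
            simp only [g]
            rw [← ENNReal.ofReal_mul (Real.exp_pos _).le, ← Real.exp_add, ← mul_add, ← neg_add,
              ← Real.log_mul (by positivity) (by positivity)]
            congr 5
            change ‖q.2 (p.2 v)‖ / ‖v‖ = _
            field_simp
        _ = (∫⁻ q, g (p.2 v) q ∂(A.law K N p.1)) * g v p := lintegral_mul_const _ (hg _)
        _ ≤ r * g v p := by gcongr; exact hbase p.1 _ hpv
  set n := N * q with hn
  set Y : S × (Euc m →L[ℝ] Euc m) → ℝ := fun p => Real.log (‖p.2 v‖ / ‖v‖) - (n : ℕ) * (a - d)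
  have hYm : Measurable Y := (hlm v).sub_const _
  have hYi : Integrable Y (A.law K n x) :=
    (hA.integrable_log_growth n x hv).sub (integrable_const _)
  have hYe : ∫⁻ p, ENNReal.ofReal (Real.exp (-(α * Y p))) ∂(A.law K n x) ≤ 1 := by
    have h1 : ∀ p, ENNReal.ofReal (Real.exp (-(α * Y p))) =
        ENNReal.ofReal (Real.exp (α * (n * (a - d)))) * g v p := fun p => by
      simp only [g, Y]
      rw [← ENNReal.ofReal_mul (Real.exp_pos _).le, ← Real.exp_add]
      congr 2; ring
    simp_rw [h1]
    rw [lintegral_const_mul _ (hg v)]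
    calc _ ≤ ENNReal.ofReal (Real.exp (α * (n * (a - d)))) * r ^ q := by gcongr
      _ = 1 := by
          rw [← ENNReal.ofReal_pow (Real.exp_pos _).le, ← ENNReal.ofReal_mul (Real.exp_pos _).le,
            ← Real.exp_nat_mul, ← Real.exp_add]
          have : α * (n * (a - d)) + q * (α * (-(N * a) + N * d)) = 0 := by
            rw [hn]; push_cast; ring
          rw [this]; simp
  have hei : Integrable (fun p => Real.exp (-(α * Y p))) (A.law K n x) := by
    refine ⟨Measurable.aestronglyMeasurable (by fun_prop), ?_⟩
    rw [hasFiniteIntegral_iff_ofReal (Eventually.of_forall fun p => (Real.exp_pos _).le)]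
    exact hYe.trans_lt ENNReal.one_lt_top
  have hee : ∫ p, Real.exp (-(α * Y p)) ∂(A.law K n x) ≤ 1 := by
    rw [integral_eq_lintegral_of_nonneg_ae (Eventually.of_forall fun p => (Real.exp_pos _).le)
      hei.aestronglyMeasurable]
    exact ENNReal.toReal_le_of_le_ofReal zero_le_one (by simpa using hYe)
  -- `|t| ≤ t + exp (-t)` turns the exponential moment into a bound for the mean of `|Y|`
  have h2 : ∫ p, α * |Y p| ∂(A.law K n x) ≤
      ∫ p, (α * Y p + Real.exp (-(α * Y p))) ∂(A.law K n x) := by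
    refine integral_mono (hYi.abs.const_mul _) ((hYi.const_mul _).add hei) fun p => ?_
    have := abs_le_add_exp_neg (α * Y p)
    rwa [abs_mul, abs_of_pos hα] at this
  rw [integral_const_mul, integral_add (hYi.const_mul _) hei, integral_const_mul] at h2
  have h3 : ∫ p, Y p ∂(A.law K n x) = A.meanGrowth K n x v - n * (a - d) := by
    rw [integral_sub (hA.integrable_log_growth n x hv) (integrable_const _)]
    simp [meanGrowth]
  rw [h3] at h2
  have h4 : α * ∫ p, |Y p| ∂(A.law K n x) ≤ α * (A.meanGrowth K n x v - n * (a - d) + 1 / α) := by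
    have : α * (1 / α) = 1 := by field_simp
    rw [mul_add, this]
    linarith
  exact le_of_mul_le_mul_left h4 hα

/-- The truncated mean `E_x min(1, e^{-nβ} ‖A⁽ⁿ⁾ v‖)`, which is small when `v` grows at a rate
smaller than `β` with high probability. It is subadditive in `v`. -/
def truncGrowth (A : RandCocycle S m) (K : Kernel S S) (β : ℝ) (n : ℕ) (x : S) (v : Euc m) :
    ENNReal :=
  ∫⁻ p, min 1 (ENNReal.ofReal (Real.exp (-(n * β)) * ‖p.2 v‖)) ∂(A.law K n x)

theorem min_one_exp_le {Y T : ℝ} (hT : 0 < T) : min 1 (Real.exp (Y - T)) ≤ (|Y| + 1) / T := by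
  rw [le_div_iff₀ hT]
  rcases le_total T Y with h | h
  · have := min_le_left 1 (Real.exp (Y - T))
    have := le_abs_self Y
    nlinarith
  · have h1 : Real.exp (Y - T) * (1 + (T - Y)) ≤ 1 := by
      have h2 := Real.add_one_le_exp (T - Y)
      have h3 : Real.exp (Y - T) * Real.exp (T - Y) = 1 := by rw [← Real.exp_add]; simp
      nlinarith [Real.exp_pos (Y - T)]
    have h4 : T ≤ (|Y| + 1) * (1 + (T - Y)) := by
      rcases le_total 0 Y with h0 | h0
      · rw [abs_of_nonneg h0]; nlinarith
      · rw [abs_of_nonpos h0]; nlinarith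
    have h5 := min_le_right 1 (Real.exp (Y - T))
    have h6 := Real.exp_pos (Y - T)
    have h7 := abs_nonneg Y
    calc _ ≤ Real.exp (Y - T) * T := by gcongr
      _ ≤ Real.exp (Y - T) * ((|Y| + 1) * (1 + (T - Y))) := by gcongr
      _ = (|Y| + 1) * (Real.exp (Y - T) * (1 + (T - Y))) := by ring
      _ ≤ (|Y| + 1) * 1 := by gcongr
      _ = _ := mul_one _

/-- When `β₀` is the optimal uniform lower bound for mean growth rates, the truncated growth of a
unit vector `v` at a suitable large time `n` is controlled by the excess of the mean growth rate of
`v` over `β₀`. The point of the estimate is that this excess, unlike the truncated growth,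
telescopes along an orbit; `θ` absorbs all error terms. -/
theorem HasBound.exists_truncGrowth_le (hA : A.HasBound c) {β₀ β : ℝ} (hβ : β₀ < β)
    (h : ∀ ε > 0, ∃ N : ℕ, 1 ≤ N ∧ ∀ x (v : Euc m), v ≠ 0 → N * (β₀ - ε) ≤ A.meanGrowth K N x v)
    {θ : ℝ} (hθ : 0 < θ) (k : ℕ) :
    ∃ n : ℕ, k ≤ n ∧ 1 ≤ n ∧ ∀ x (v : Euc m), ‖v‖ = 1 →
      0 ≤ (A.meanGrowth K n x v / n - β₀) / (β - β₀) + θ ∧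
      A.truncGrowth K β n x v ≤
        ENNReal.ofReal ((A.meanGrowth K n x v / n - β₀) / (β - β₀) + θ) := by
  set γ := β - β₀ with hγ
  have hγ0 : 0 < γ := by rw [hγ]; linarith
  set ε := θ * γ / 8 with hε
  have hε0 : 0 < ε := by positivity
  obtain ⟨N, hN, hNa⟩ := h ε hε0
  obtain ⟨α, hα, H⟩ := hA.exists_deviation hN hε0 hNa
  obtain ⟨q, hq⟩ := exists_nat_ge (max (k + 1 : ℝ) ((1 / α + 1) / (γ * (θ / 2))))
  have hq1 : (k + 1 : ℝ) ≤ q := (le_max_left _ _).trans hq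
  have hqk : k + 1 ≤ q := by exact_mod_cast hq1
  have hnq : q ≤ N * q := Nat.le_mul_of_pos_left q hN
  refine ⟨N * q, by omega, by omega, fun x v hv => ?_⟩
  have hv0 : v ≠ 0 := by rintro rfl; simp at hv
  set n := N * q
  have hn0 : (0 : ℝ) < n := by exact_mod_cast (by omega : 0 < n)
  have hdev := H q x v hv0
  set T := n * (γ + 2 * ε) with hT
  have hT0 : 0 < T := by positivity
  set Y : S × (Euc m →L[ℝ] Euc m) → ℝ :=
    fun p => Real.log (‖p.2 v‖ / ‖v‖) - (n : ℕ) * (β₀ - ε - ε)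
  have hYi : Integrable Y (A.law K n x) :=
    (hA.integrable_log_growth n x hv0).sub (integrable_const _)
  have hi : Integrable (fun p => (|Y p| + 1) / T) (A.law K n x) :=
    (hYi.abs.add (integrable_const _)).div_const _
  have hle : ∫ p, (|Y p| + 1) / T ∂(A.law K n x) ≤
      (A.meanGrowth K n x v / n - β₀) / γ + θ := by
    have e1 : ∫ p, (|Y p| + 1) / T ∂(A.law K n x) = (∫ p, |Y p| ∂(A.law K n x) + 1) / T := by
      rw [integral_div, integral_add hYi.abs (integrable_const _)]; simp
    have h0 : 0 ≤ ∫ p, |Y p| ∂(A.law K n x) := integral_nonneg fun p => abs_nonneg _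
    rw [e1]
    have h2 : (1 / α + 1) / (γ * (θ / 2)) ≤ n := by
      refine ((le_max_right _ _).trans hq).trans ?_
      exact_mod_cast hnq
    rw [div_le_iff₀ (by positivity)] at h2
    calc _ ≤ (∫ p, |Y p| ∂(A.law K n x) + 1) / (n * γ) := by
          gcongr
          rw [hT]
          gcongr
          linarith
      _ ≤ (A.meanGrowth K n x v - n * (β₀ - ε - ε) + 1 / α + 1) / (n * γ) := by gcongr
      _ ≤ _ := by
          rw [div_le_iff₀ (by positivity)]
          have e2 : ((A.meanGrowth K n x v / n - β₀) / γ + θ) * (n * γ) =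
              A.meanGrowth K n x v - n * β₀ + θ * (n * γ) := by
            field_simp
          rw [e2]
          have e3 : n * ε = θ * (n * γ) / 8 := by rw [hε]; ring
          have h3 : 0 ≤ θ * (n * γ) := by positivity
          nlinarith
  refine ⟨(integral_nonneg fun p => by positivity).trans hle, ?_⟩
  calc A.truncGrowth K β n x v ≤ ∫⁻ p, ENNReal.ofReal ((|Y p| + 1) / T) ∂(A.law K n x) := by
        refine lintegral_mono_ae ?_
        filter_upwards [hA.ae_law n x] with p hp
        have hpv := norm_pos_iff.2 (hp.map_ne_zero hv0)
        have e : Real.exp (-(n * β)) * ‖p.2 v‖ = Real.exp (Y p - T) := by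
          simp only [Y, hv, div_one]
          rw [show Real.log ‖p.2 v‖ - n * (β₀ - ε - ε) - T = -(n * β) + Real.log ‖p.2 v‖ by
            rw [hT, hγ]; ring, Real.exp_add, Real.exp_log hpv]
        rw [e, ← ENNReal.ofReal_one, ← ENNReal.ofReal_min]
        exact ENNReal.ofReal_le_ofReal (min_one_exp_le hT0)
    _ = ENNReal.ofReal (∫ p, (|Y p| + 1) / T ∂(A.law K n x)) := by
        rw [ofReal_integral_eq_lintegral_ofReal hi (Eventually.of_forall fun p => by positivity)]
    _ ≤ _ := ENNReal.ofReal_le_ofReal hle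

end RandCocycle

/-! ### Compactness in the fibre -/

section Compactness

/-- Lower semicontinuity of an infinite sum of nonnegative functions, on a compact set. -/
theorem exists_tsum_le_of_forall_sum_le {E : Type*} [TopologicalSpace E]
    [FirstCountableTopology E] {C : Set E} (hC : IsCompact C) {g : ℕ → E → ENNReal}
    (hg : ∀ k, Continuous (g k)) {B : ENNReal} {b : ℕ → ENNReal} (hb : Tendsto b atTop (𝓝 B))
    (h : ∀ R : ℕ, ∃ v ∈ C, ∑ k ∈ Finset.range R, g k v ≤ b R) : ∃ v ∈ C, ∑' k, g k v ≤ B := by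
  choose v hvC hv using h
  obtain ⟨w, hwC, φ, hφ, hw⟩ := hC.tendsto_subseq hvC
  refine ⟨w, hwC, ?_⟩
  rw [ENNReal.tsum_eq_iSup_nat]
  refine iSup_le fun R => ?_
  have h1 : Tendsto (fun i => ∑ k ∈ Finset.range R, g k (v (φ i))) atTop
      (𝓝 (∑ k ∈ Finset.range R, g k w)) :=
    tendsto_finsetSum _ fun k _ => ((hg k).tendsto w).comp hw
  refine le_of_tendsto_of_tendsto h1 (hb.comp hφ.tendsto_atTop) ?_
  filter_upwards [eventually_ge_atTop R] with i hi
  refine le_trans ?_ (hv (φ i))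
  exact Finset.sum_le_sum_of_subset (Finset.range_mono (hi.trans (hφ.id_le i)))

/-- The set of parameters for which a sum of nonnegative continuous functions is at most `B` at
some point of a compact set is measurable: no measurable selection is needed, since finite partial
sums can be tested on a countable dense set. -/
theorem measurableSet_exists_tsum_le {X E : Type*} [MeasurableSpace X] [PseudoMetricSpace E]
    {C : Set E} (hC : IsCompact C) {g : ℕ → X → E → ENNReal}
    (hg : ∀ k x, Continuous (g k x)) (hm : ∀ k v, Measurable fun x => g k x v) {B : ENNReal}
    (hB : B ≠ ⊤) : MeasurableSet {x | ∃ v ∈ C, ∑' k, g k x v ≤ B} := by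
  obtain ⟨D, hDC, hDc, hD⟩ := hC.isSeparable.exists_countable_dense_subset
  have : {x | ∃ v ∈ C, ∑' k, g k x v ≤ B} = ⋂ R : ℕ, ⋃ v ∈ D,
      {x | ∑ k ∈ Finset.range R, g k x v < B + ((R : ENNReal) + 1)⁻¹} := by
    ext x
    simp only [Set.mem_ofPred_eq, Set.mem_iInter, Set.mem_iUnion, exists_prop]
    constructor
    · rintro ⟨v, hvC, hv⟩ R
      have hlt : ∑ k ∈ Finset.range R, g k x v < B + ((R : ENNReal) + 1)⁻¹ := by
        refine ((ENNReal.sum_le_tsum _).trans hv).trans_lt ?_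
        refine ENNReal.lt_add_right hB ?_
        simp
      have hcont : Continuous fun v => ∑ k ∈ Finset.range R, g k x v :=
        continuous_finsetSum _ fun k _ => hg k x
      have hmem : v ∈ closure D := hD hvC
      obtain ⟨w, hw, hwD⟩ := mem_closure_iff.1 hmem _ (isOpen_lt hcont continuous_const) hlt
      exact ⟨w, hwD, hw⟩
    · intro h
      refine exists_tsum_le_of_forall_sum_le hC (fun k => hg k x)
        (b := fun R => B + ((R : ENNReal) + 1)⁻¹) ?_ fun R => ?_
      · have : Tendsto (fun R : ℕ => ((R : ENNReal) + 1)⁻¹) atTop (𝓝 0) := by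
          have := (tendsto_add_atTop_iff_nat 1).2 ENNReal.tendsto_inv_nat_nhds_zero
          simpa using this
        simpa using tendsto_const_nhds.add this
      · obtain ⟨v, hv, hlt⟩ := h R
        exact ⟨v, hDC hv, hlt.le⟩
  rw [this]
  refine MeasurableSet.iInter fun R => MeasurableSet.biUnion hDc fun v _ => ?_
  exact measurableSet_lt (Finset.measurable_fun_sum _ fun k _ => hm k v) measurable_const

end Compactness

namespace RandCocycle

variable {S : Type*} [MeasurableSpace S] {m : ℕ} {A : RandCocycle S m} {c : ℝ} {K : Kernel S S}
  [IsMarkovKernel K] {μ : Measure S} [IsProbabilityMeasure μ]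

/-! ### Slowly growing directions -/

theorem measurable_truncGrowth (β : ℝ) (n : ℕ) :
    Measurable fun z : S × Euc m => A.truncGrowth K β n z.1 z.2 := by
  refine Measurable.lintegral_kernel_prod_right (κ := (A.law K n).comap Prod.fst measurable_fst)
    (f := fun (z : S × Euc m) (p : S × (Euc m →L[ℝ] Euc m)) =>
      min 1 (ENNReal.ofReal (Real.exp (-(n * β)) * ‖p.2 z.2‖))) ?_
  have : Measurable fun w : (S × Euc m) × (S × (Euc m →L[ℝ] Euc m)) => w.2.2 w.1.2 :=
    measurable_apply_op (by fun_prop) (by fun_prop)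
  exact measurable_const.min (this.norm.const_mul _).ennreal_ofReal

theorem measurable_truncGrowth_integrand (β : ℝ) (n : ℕ) (v : Euc m) :
    Measurable fun p : S × (Euc m →L[ℝ] Euc m) =>
      min 1 (ENNReal.ofReal (Real.exp (-(n * β)) * ‖p.2 v‖)) := by
  have : Measurable fun p : S × (Euc m →L[ℝ] Euc m) => p.2 v :=
    measurable_apply_op (by fun_prop) (by fun_prop)
  exact measurable_const.min (this.norm.const_mul _).ennreal_ofReal

theorem truncGrowth_le_one (β : ℝ) (n : ℕ) (x : S) (v : Euc m) : A.truncGrowth K β n x v ≤ 1 := by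
  calc _ ≤ ∫⁻ _, 1 ∂(A.law K n x) := lintegral_mono fun p => min_le_left _ _
    _ = 1 := by simp

theorem continuous_truncGrowth (β : ℝ) (n : ℕ) (x : S) :
    Continuous fun v : Euc m => A.truncGrowth K β n x v := by
  rw [continuous_iff_seqContinuous]
  intro v w hv
  refine tendsto_lintegral_of_dominated_convergence (fun _ => 1)
    (fun i => measurable_truncGrowth_integrand β n (v i))
    (fun i => Eventually.of_forall fun p => min_le_left _ _) (by simp)
    (Eventually.of_forall fun p => ?_)
  refine tendsto_const_nhds.min ((ENNReal.continuous_ofReal.tendsto _).comp ?_)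
  exact ((p.2.continuous.tendsto w).comp hv).norm.const_mul _

theorem truncGrowth_add_le (β : ℝ) (n : ℕ) (x : S) (v w : Euc m) :
    A.truncGrowth K β n x (v + w) ≤ A.truncGrowth K β n x v + A.truncGrowth K β n x w := by
  rw [truncGrowth, truncGrowth, truncGrowth,
    ← lintegral_add_left (measurable_truncGrowth_integrand β n v)]
  refine lintegral_mono fun p => ?_
  have h : ENNReal.ofReal (Real.exp (-(n * β)) * ‖p.2 (v + w)‖) ≤
      ENNReal.ofReal (Real.exp (-(n * β)) * ‖p.2 v‖) +
      ENNReal.ofReal (Real.exp (-(n * β)) * ‖p.2 w‖) := by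
    rw [← ENNReal.ofReal_add (by positivity) (by positivity), ← mul_add, map_add]
    exact ENNReal.ofReal_le_ofReal (by gcongr; exact norm_add_le _ _)
  refine (min_le_min_left 1 h).trans ?_
  generalize ENNReal.ofReal (Real.exp (-(n * β)) * ‖p.2 v‖) = a
  generalize ENNReal.ofReal (Real.exp (-(n * β)) * ‖p.2 w‖) = b
  rcases le_total 1 a with h1 | h1
  · rw [min_eq_left h1]
    exact (min_le_left _ _).trans le_self_add
  · rcases le_total 1 b with h2 | h2
    · rw [min_eq_left h2]
      exact (min_le_left _ _).trans le_add_self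
    · rw [min_eq_right h1, min_eq_right h2]
      exact min_le_right _ _

theorem min_one_mul_le (t a : ENNReal) : min 1 (t * a) ≤ max 1 t * min 1 a := by
  rcases le_total 1 a with h | h
  · rw [min_eq_left h, mul_one]
    exact (min_le_left _ _).trans (le_max_left _ _)
  · rw [min_eq_right h]
    exact (min_le_right _ _).trans (by gcongr; exact le_max_right _ _)

theorem truncGrowth_smul_le (β : ℝ) (n : ℕ) (x : S) (t : ℝ) (v : Euc m) :
    A.truncGrowth K β n x (t • v) ≤ max 1 (ENNReal.ofReal |t|) * A.truncGrowth K β n x v := by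
  rw [truncGrowth, truncGrowth, ← lintegral_const_mul _ (measurable_truncGrowth_integrand β n v)]
  refine lintegral_mono fun p => ?_
  have h : ENNReal.ofReal (Real.exp (-(n * β)) * ‖p.2 (t • v)‖) = ENNReal.ofReal |t| *
      ENNReal.ofReal (Real.exp (-(n * β)) * ‖p.2 v‖) := by
    rw [← ENNReal.ofReal_mul (abs_nonneg _), map_smul, norm_smul, Real.norm_eq_abs]
    congr 1; ring
  rw [h]
  exact min_one_mul_le _ _

theorem HasBound.lintegral_truncGrowth_le (hA : A.HasBound c) (β : ℝ) (n : ℕ) (x : S) (v : Euc m) :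
    ∫⁻ y, A.truncGrowth K β n y (A.op (x, y) v) ∂(K x) ≤
      ENNReal.ofReal c * A.truncGrowth K β n x v := by
  have hm := measurable_truncGrowth_integrand (S := S) β n v
  calc _ = ∫⁻ p, min 1 (ENNReal.ofReal (Real.exp (-(n * β)) * ‖p.2 v‖)) ∂(A.law K (n + 1) x) := by
        rw [lintegral_prodLaw_succ' A.measurable_op n x hm]
        rfl
    _ ≤ ∫⁻ p, ENNReal.ofReal c * min 1 (ENNReal.ofReal (Real.exp (-(n * β)) * ‖p.2 v‖))
          ∂(A.law K n x) := by
        rw [lintegral_prodLaw_succ A.measurable_op n x hm]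
        refine lintegral_mono fun p => ?_
        calc _ ≤ ∫⁻ _, ENNReal.ofReal c *
              min 1 (ENNReal.ofReal (Real.exp (-(n * β)) * ‖p.2 v‖)) ∂(K p.1) := by
              refine lintegral_mono fun y => ?_
              have h1 : (1 : ENNReal) ≤ ENNReal.ofReal c := by
                rw [← ENNReal.ofReal_one]; exact ENNReal.ofReal_le_ofReal hA.1
              have h2 : ENNReal.ofReal (Real.exp (-(n * β)) * ‖(A.op (p.1, y) * p.2) v‖) ≤
                  ENNReal.ofReal c * ENNReal.ofReal (Real.exp (-(n * β)) * ‖p.2 v‖) := by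
                rw [← ENNReal.ofReal_mul hA.pos.le]
                refine ENNReal.ofReal_le_ofReal ?_
                have := (hA.2 (p.1, y) (p.2 v)).1
                calc _ ≤ Real.exp (-(n * β)) * (c * ‖p.2 v‖) := by gcongr; exact this
                  _ = _ := by ring
              refine (min_le_min_left 1 h2).trans ((min_one_mul_le _ _).trans ?_)
              rw [max_eq_right h1]
          _ = _ := by simp
    _ = _ := lintegral_const_mul _ hm

theorem meanGrowth_smul (n : ℕ) (x : S) {t : ℝ} (ht : t ≠ 0) (v : Euc m) :
    A.meanGrowth K n x (t • v) = A.meanGrowth K n x v := by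
  refine integral_congr_ae (Eventually.of_forall fun p => ?_)
  simp only [map_smul, norm_smul]
  have := norm_ne_zero_iff.2 ht
  rw [mul_div_mul_left _ _ this]

theorem sum_range_shift_sub (F : ℕ → ℝ) (n l : ℕ) :
    ∑ j ∈ Finset.range n, (F (j + l) - F j) = ∑ j ∈ Finset.range l, (F (n + j) - F j) := by
  induction n with
  | zero => simp
  | succ n ih =>
    rw [Finset.sum_range_succ, ih]
    have h1 := Finset.sum_range_succ (fun j => F (n + j)) l
    have h2 := Finset.sum_range_succ' (fun j => F (n + j)) l
    simp only [Finset.sum_sub_distrib]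
    have h3 : ∀ j, F (n + 1 + j) = F (n + (j + 1)) := fun j => by congr 1; ring
    simp only [h3]
    simp only [add_zero] at h2
    linarith

/-- If some vectors grow at a mean rate arbitrarily close to `β₀`, then averaging along an orbit
of such a vector shows that slowly growing directions are present above a `μ`-typical point. -/
theorem HasBound.lintegral_le_of_le_truncGrowth (hA : A.HasBound c) (hK : IsStronglyMixing K μ)
    {β₀ β : ℝ} (hβ : β₀ < β) {n : ℕ → ℕ} (hn : ∀ k, 1 ≤ n k)
    (hu : ∀ k x (v : Euc m), ‖v‖ = 1 →
      0 ≤ (A.meanGrowth K (n k) x v / n k - β₀) / (β - β₀) + (1 / 2) ^ k ∧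
      A.truncGrowth K β (n k) x v ≤
        ENNReal.ofReal ((A.meanGrowth K (n k) x v / n k - β₀) / (β - β₀) + (1 / 2) ^ k))
    (hmin : ∀ η > 0, ∀ N : ℕ, 1 ≤ N → ∃ x, ∃ v : Euc m, v ≠ 0 ∧
      A.meanGrowth K N x v < N * (β₀ + η))
    (R : ℕ) {h : S → ENNReal} (hh : Measurable h) (hhR : ∀ y, h y ≤ R)
    (hle : ∀ y (v : Euc m), ‖v‖ = 1 → h y ≤ ∑ k ∈ Finset.range R, A.truncGrowth K β (n k) y v) :
    ∫⁻ y, h y ∂μ ≤ 4 := by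
  obtain ⟨C, ρ, hC, hρ0, hρ1, H⟩ := hK.exists_real
  set γ := β - β₀ with hγ
  have hγ0 : 0 < γ := by rw [hγ]; linarith
  set ℓ := Real.log c
  have hℓ : 0 ≤ ℓ := hA.log_nonneg
  set r : S → ℝ := fun y => (h y).toReal
  have hr0 : ∀ y, 0 ≤ r y := fun y => ENNReal.toReal_nonneg
  have hrR : ∀ y, r y ≤ R := fun y => by
    have := ENNReal.toReal_mono (ENNReal.natCast_ne_top R) (hhR y)
    simpa using this
  have hrm : Measurable r := hh.ennreal_toReal
  have hrabs : ∀ y, |r y| ≤ R := fun y => by rw [abs_of_nonneg (hr0 y)]; exact hrR y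
  set B : ℕ → S → Euc m → ℝ := fun k x v =>
    (A.meanGrowth K (n k) x v / n k - β₀) / γ + (1 / 2) ^ k
  have hrB : ∀ y (v : Euc m), v ≠ 0 → r y ≤ ∑ k ∈ Finset.range R, B k y v := by
    intro y v hv
    have hv' := norm_ne_zero_iff.2 hv
    have hu1 : ‖‖v‖⁻¹ • v‖ = 1 := by simp [norm_smul, hv']
    have e : ∀ k, B k y (‖v‖⁻¹ • v) = B k y v := fun k => by
      simp only [B, meanGrowth_smul _ _ (inv_ne_zero hv')]
    have h1 : h y ≤ ENNReal.ofReal (∑ k ∈ Finset.range R, B k y v) := by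
      refine (hle y _ hu1).trans ?_
      rw [ENNReal.ofReal_sum_of_nonneg fun k _ => by rw [← e]; exact (hu k y _ hu1).1]
      refine Finset.sum_le_sum fun k _ => ?_
      rw [← e]
      exact (hu k y _ hu1).2
    refine ENNReal.toReal_le_of_le_ofReal (Finset.sum_nonneg fun k _ => ?_) h1
    rw [← e]; exact (hu k y _ hu1).1
  -- `η` is so small, and `N` so large, that each of the three errors below is at most of order `N`
  set η := γ / (2 * (R + 1))
  have hη : 0 < η := by positivity
  obtain ⟨N, hN⟩ := exists_nat_ge (max (C * R / (1 - ρ))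
    (max 1 (∑ k ∈ Finset.range R, 4 * n k * ℓ / γ)))
  have hN1 : C * R / (1 - ρ) ≤ N := (le_max_left _ _).trans hN
  have hN2 : (1 : ℝ) ≤ N := ((le_max_left _ _).trans (le_max_right _ _)).trans hN
  have hN3 : ∑ k ∈ Finset.range R, 4 * n k * ℓ / γ ≤ N :=
    ((le_max_right _ _).trans (le_max_right _ _)).trans hN
  obtain ⟨x, v, hv, hxv⟩ := hmin η hη N (by exact_mod_cast hN2)
  set F : ℕ → ℝ := fun j => A.meanGrowth K j x v
  -- upper bound for the average along the orbit
  have hup : ∀ j, ∫ p, r p.1 ∂(A.law K j x) ≤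
      ∑ k ∈ Finset.range R, (((F (j + n k) - F j) / n k - β₀) / γ + (1 / 2) ^ k) := by
    intro j
    have hBi : ∀ k, Integrable (fun p : S × (Euc m →L[ℝ] Euc m) => B k p.1 (p.2 v)) (A.law K j x) :=
      fun k => ((((hA.integrable_meanGrowth j (n k) x hv).div_const _).sub
        (integrable_const _)).div_const _).add (integrable_const _)
    calc _ ≤ ∫ p, ∑ k ∈ Finset.range R, B k p.1 (p.2 v) ∂(A.law K j x) := by
          refine integral_mono_ae ?_ (integrable_finsetSum _ fun k _ => hBi k) ?_
          · exact hA.integrable_law j x (hrm.comp measurable_fst) R fun p _ => hrabs _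
          · filter_upwards [hA.ae_law j x] with p hp using hrB _ _ (hp.map_ne_zero hv)
      _ = _ := by
          rw [integral_finsetSum _ fun k _ => hBi k]
          refine Finset.sum_congr rfl fun k _ => ?_
          have hi := hA.integrable_meanGrowth (K := K) j (n k) x hv
          have hI0 : Integrable (fun p : S × (Euc m →L[ℝ] Euc m) =>
              A.meanGrowth K (n k) p.1 (p.2 v) / n k) (A.law K j x) := hi.div_const _
          have hI1 : Integrable (fun p : S × (Euc m →L[ℝ] Euc m) =>
              (A.meanGrowth K (n k) p.1 (p.2 v) / n k - β₀) / γ) (A.law K j x) :=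
            (hI0.sub (integrable_const _)).div_const _
          simp only [B]
          rw [integral_add hI1 (integrable_const _), integral_div,
            integral_sub hI0 (integrable_const _), integral_div]
          have := hA.meanGrowth_add (K := K) j (n k) x hv
          simp only [F, this]
          simp
  have hsum : ∑ j ∈ Finset.range N, ∫ p, r p.1 ∂(A.law K j x) ≤ 3 * N := by
    calc _ ≤ ∑ j ∈ Finset.range N, ∑ k ∈ Finset.range R,
          (((F (j + n k) - F j) / n k - β₀) / γ + (1 / 2) ^ k) := Finset.sum_le_sum fun j _ => hup j
      _ = ∑ k ∈ Finset.range R, ∑ j ∈ Finset.range N,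
          (((F (j + n k) - F j) / n k - β₀) / γ + (1 / 2) ^ k) := Finset.sum_comm
      _ ≤ ∑ k ∈ Finset.range R, (N * η / γ + 2 * n k * ℓ / γ + N * (1 / 2) ^ k) := by
          refine Finset.sum_le_sum fun k _ => ?_
          have hnk : (0 : ℝ) < n k := by exact_mod_cast hn k
          have h1 : ∑ j ∈ Finset.range N, (F (j + n k) - F j) ≤
              n k * (N * (β₀ + η) + 2 * n k * ℓ) := by
            -- the sum telescopes, up to `n k` terms at either end of the orbit
            rw [sum_range_shift_sub]
            calc _ ≤ ∑ j ∈ Finset.range (n k), (N * (β₀ + η) + 2 * n k * ℓ) := by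
                  refine Finset.sum_le_sum fun j hj => ?_
                  have hj' : (j : ℝ) ≤ n k := by exact_mod_cast (Finset.mem_range.1 hj).le
                  have h2 := hA.meanGrowth_add (K := K) N j x hv
                  have h3 : ∫ p, A.meanGrowth K j p.1 (p.2 v) ∂(A.law K N x) ≤ j * ℓ :=
                    (le_abs_self _).trans (hA.abs_integral_law_le N x _ fun p hp =>
                      hA.abs_meanGrowth_le j p.1 (hp.map_ne_zero hv))
                  have h4 := (abs_le.1 (hA.abs_meanGrowth_le (K := K) j x hv)).1
                  have h5 : (j : ℝ) * ℓ ≤ n k * ℓ := by gcongr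
                  simp only [F]
                  linarith
              _ = _ := by simp; ring
          have e : ∑ j ∈ Finset.range N, (((F (j + n k) - F j) / n k - β₀) / γ + (1 / 2) ^ k) =
              ((∑ j ∈ Finset.range N, (F (j + n k) - F j)) / n k - N * β₀) / γ +
                N * (1 / 2) ^ k := by
            rw [Finset.sum_add_distrib, ← Finset.sum_div, Finset.sum_sub_distrib, ← Finset.sum_div]
            simp
          rw [e]
          gcongr
          rw [← add_div]
          gcongr
          rw [sub_le_iff_le_add, div_le_iff₀ hnk]
          linarith
      _ = R * (N * η / γ) + (∑ k ∈ Finset.range R, 4 * n k * ℓ / γ) / 2 +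
            N * ∑ k ∈ Finset.range R, (1 / 2 : ℝ) ^ k := by
          rw [Finset.sum_add_distrib, Finset.sum_add_distrib, ← Finset.mul_sum, Finset.sum_div]
          simp only [Finset.sum_const, Finset.card_range, nsmul_eq_mul]
          congr 2
          refine Finset.sum_congr rfl fun k _ => ?_
          ring
      _ ≤ N / 2 + N / 2 + N * 2 := by
          have h1 : (R : ℝ) * (N * η / γ) ≤ N / 2 := by
            have : (R : ℝ) * (N * η / γ) = N / 2 * (R / (R + 1)) := by
              simp only [η]; field_simp
            rw [this]
            refine mul_le_of_le_one_right (by positivity) ?_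
            rw [div_le_one (by positivity)]
            linarith
          have h2 := sum_geometric_two_le R
          gcongr
      _ = _ := by ring
  -- lower bound by mixing
  have hlow : (N : ℝ) * (∫ y, r y ∂μ - 1) ≤ ∑ j ∈ Finset.range N, ∫ p, r p.1 ∂(A.law K j x) := by
    have h1 : ∀ j, ∫ y, r y ∂μ - C * R * ρ ^ j ≤ ∫ p, r p.1 ∂(A.law K j x) := fun j => by
      have := (abs_le.1 (H r hrm R hrabs x j)).1
      rw [← integral_fst_prodLaw (c := A.op) A.measurable_op j x hrm.stronglyMeasurable] at this
      linarith
    have h2 : ∑ j ∈ Finset.range N, ρ ^ j ≤ (1 - ρ)⁻¹ := by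
      rw [← tsum_geometric_of_lt_one hρ0.le hρ1]
      exact (summable_geometric_of_lt_one hρ0.le hρ1).sum_le_tsum _ fun j _ => by positivity
    calc _ ≤ (N : ℝ) * ∫ y, r y ∂μ - C * R * ∑ j ∈ Finset.range N, ρ ^ j := by
          have : C * R * ∑ j ∈ Finset.range N, ρ ^ j ≤ N := by
            refine le_trans ?_ hN1
            rw [div_eq_mul_inv]
            gcongr
          linarith
      _ = ∑ j ∈ Finset.range N, (∫ y, r y ∂μ - C * R * ρ ^ j) := by
          rw [Finset.sum_sub_distrib, Finset.mul_sum]; simp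
      _ ≤ _ := Finset.sum_le_sum fun j _ => h1 j
  have hfin : ∫ y, r y ∂μ ≤ 4 := by
    have h1 : (N : ℝ) * (∫ y, r y ∂μ - 1) ≤ N * 3 := by linarith
    have := le_of_mul_le_mul_left h1 (by linarith)
    linarith
  have e : ∫⁻ y, h y ∂μ = ENNReal.ofReal (∫ y, r y ∂μ) := by
    rw [ofReal_integral_eq_lintegral_ofReal
      (Integrable.of_bound hrm.aestronglyMeasurable R (Eventually.of_forall hrabs))
      (Eventually.of_forall hr0)]
    refine lintegral_congr fun y => ?_
    rw [ENNReal.ofReal_toReal (ne_top_of_le_ne_top (ENNReal.natCast_ne_top R) (hhR y))]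
  rw [e]
  exact (ENNReal.ofReal_le_ofReal hfin).trans (by simp)

/-- Above `μ`-almost every point there is a direction which is slow at all the times `n k`:
finitely many times are handled by the bound on the mean of the minimum over the unit sphere, which
does not depend on their number, and compactness of the sphere yields a common direction. -/
theorem HasBound.ae_exists_tsum_lt_top (hA : A.HasBound c) (hm : 1 ≤ m)
    (hK : IsStronglyMixing K μ) {β₀ β : ℝ} (hβ : β₀ < β) {n : ℕ → ℕ} (hn : ∀ k, 1 ≤ n k)
    (hu : ∀ k x (v : Euc m), ‖v‖ = 1 →
      0 ≤ (A.meanGrowth K (n k) x v / n k - β₀) / (β - β₀) + (1 / 2) ^ k ∧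
      A.truncGrowth K β (n k) x v ≤
        ENNReal.ofReal ((A.meanGrowth K (n k) x v / n k - β₀) / (β - β₀) + (1 / 2) ^ k))
    (hmin : ∀ η > 0, ∀ N : ℕ, 1 ≤ N → ∃ x, ∃ v : Euc m, v ≠ 0 ∧
      A.meanGrowth K N x v < N * (β₀ + η)) :
    ∀ᵐ y ∂μ, ∃ v : Euc m, ‖v‖ = 1 ∧ ∑' k, A.truncGrowth K β (n k) y v < ⊤ := by
  have hne : (Metric.sphere (0 : Euc m) 1).Nonempty :=
    ⟨EuclideanSpace.single ⟨0, hm⟩ 1, by simp⟩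
  have := hne.to_subtype
  let e : ℕ → Metric.sphere (0 : Euc m) 1 := TopologicalSpace.denseSeq _
  -- the minimum over the sphere, taken over a dense sequence for the sake of measurability
  let h : ℕ → S → ENNReal := fun R y =>
    ⨅ i, ∑ k ∈ Finset.range R, A.truncGrowth K β (n k) y (e i)
  have hcont : ∀ R y, Continuous fun v : Euc m =>
      ∑ k ∈ Finset.range R, A.truncGrowth K β (n k) y v := fun R y =>
    continuous_finsetSum _ fun k _ => continuous_truncGrowth β (n k) y
  have hhm : ∀ R, Measurable (h R) := fun R => by
    refine Measurable.iInf fun i => Finset.measurable_fun_sum _ fun k _ => ?_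
    exact (measurable_truncGrowth β (n k)).comp (measurable_id.prodMk measurable_const)
  have hhle : ∀ R y (v : Euc m), ‖v‖ = 1 →
      h R y ≤ ∑ k ∈ Finset.range R, A.truncGrowth K β (n k) y v := by
    intro R y v hv
    have hcl : IsClosed {w : Metric.sphere (0 : Euc m) 1 |
        h R y ≤ ∑ k ∈ Finset.range R, A.truncGrowth K β (n k) y w} :=
      isClosed_le continuous_const ((hcont R y).comp continuous_subtype_val)
    have hd : DenseRange e := TopologicalSpace.denseRange_denseSeq _
    exact hd.induction_on (p := fun w : Metric.sphere (0 : Euc m) 1 =>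
      h R y ≤ ∑ k ∈ Finset.range R, A.truncGrowth K β (n k) y w) ⟨v, by simpa using hv⟩ hcl
      fun i => iInf_le _ i
  have hhR : ∀ R y, h R y ≤ R := fun R y => by
    refine (iInf_le _ 0).trans ?_
    calc _ ≤ ∑ k ∈ Finset.range R, (1 : ENNReal) :=
          Finset.sum_le_sum fun k _ => truncGrowth_le_one _ _ _ _
      _ = R := by simp
  have hmono : Monotone h := fun R R' hRR y =>
    iInf_mono fun i => Finset.sum_le_sum_of_subset (Finset.range_mono hRR)
  have hint : ∫⁻ y, ⨆ R, h R y ∂μ ≠ ⊤ := by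
    rw [lintegral_iSup hhm hmono]
    refine ne_top_of_le_ne_top (by simp : (4 : ENNReal) ≠ ⊤) (iSup_le fun R => ?_)
    exact hA.lintegral_le_of_le_truncGrowth hK hβ hn hu hmin R (hhm R) (hhR R) (hhle R)
  filter_upwards [ae_lt_top (Measurable.iSup hhm) hint] with y hy
  obtain ⟨v, hv, hle⟩ := exists_tsum_le_of_forall_sum_le (isCompact_sphere (0 : Euc m) 1)
    (g := fun k v => A.truncGrowth K β (n k) y v) (fun k => continuous_truncGrowth β (n k) y)
    (b := fun _ => (⨆ R, h R y) + 1) tendsto_const_nhds fun R => by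
      have h1 : h R y < (⨆ R, h R y) + 1 :=
        (le_iSup (fun R => h R y) R).trans_lt (ENNReal.lt_add_right hy.ne one_ne_zero)
      obtain ⟨i, hi⟩ := iInf_lt_iff.1 h1
      exact ⟨e i, (e i).2, hi.le⟩
  exact ⟨v, by simpa using hv, hle.trans_lt (ENNReal.add_lt_top.2 ⟨hy, ENNReal.one_lt_top⟩)⟩

end RandCocycle

/-! ### Measurable fields of subspaces -/

section SubspaceField

variable {X : Type*} [MeasurableSpace X] {m : ℕ}

theorem clm_eq_sum_inner_smulRight (T : Euc m →L[ℝ] Euc m) :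
    T = ∑ i, ∑ j, inner ℝ (EuclideanSpace.basisFun (Fin m) ℝ j)
      (T (EuclideanSpace.basisFun (Fin m) ℝ i)) •
      (innerSL ℝ (EuclideanSpace.basisFun (Fin m) ℝ i)).smulRight
        (EuclideanSpace.basisFun (Fin m) ℝ j) := by
  set b := EuclideanSpace.basisFun (Fin m) ℝ
  ext1 v
  have h1 : T v = ∑ i, inner ℝ (b i) v • T (b i) := by
    conv_lhs => rw [← b.sum_repr' v]
    simp
  rw [h1, sum_apply]
  refine Finset.sum_congr rfl fun i _ => ?_
  conv_lhs => rw [← b.sum_repr' (T (b i))]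
  rw [Finset.smul_sum, sum_apply]
  refine Finset.sum_congr rfl fun j _ => ?_
  simp only [smul_apply, ContinuousLinearMap.smulRight_apply,
    innerSL_apply_apply]
  exact smul_comm _ _ _

theorem measurable_clm_of_inner {T : X → (Euc m →L[ℝ] Euc m)}
    (h : ∀ v w, Measurable fun x => inner ℝ w (T x v)) : Measurable T := by
  have : T = fun x => _ := funext fun x => clm_eq_sum_inner_smulRight (T x)
  rw [this]
  refine Finset.measurable_fun_sum _ fun i _ => Finset.measurable_fun_sum _ fun j _ => ?_
  exact (h _ _).smul_const _

/-- A field of subspaces is measurable as soon as the sets of parameters whose subspace meets a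
given closed ball are measurable: these sets are the sublevel sets of the distance to the subspace,
and the orthogonal projection is recovered from such distances by polarization. -/
theorem measurable_starProjection_of_inter_closedBall {V : X → Submodule ℝ (Euc m)}
    (h : ∀ w r, MeasurableSet {x | ∃ v ∈ Metric.closedBall w r, v ∈ V x}) :
    Measurable fun x => (V x).starProjection := by
  have hd : ∀ w, Measurable fun x => ‖w - (V x).starProjection w‖ := by
    intro w
    refine measurable_of_Iic fun r => ?_
    convert h w r using 1
    ext x
    simp only [Set.mem_preimage, Set.mem_Iic, Set.mem_ofPred_eq, Metric.mem_closedBall,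
      dist_eq_norm]
    constructor
    · intro hr
      exact ⟨_, by rwa [norm_sub_rev], (V x).starProjection_apply_mem w⟩
    · rintro ⟨v, hv, hvV⟩
      rw [norm_sub_rev] at hv
      refine le_trans ?_ hv
      rw [Submodule.starProjection_minimal]
      exact ciInf_le ⟨0, Set.forall_mem_range.mpr fun _ => norm_nonneg _⟩ (⟨v, hvV⟩ : V x)
  have hn : ∀ w, Measurable fun x => ‖(V x).starProjection w‖ ^ 2 := by
    intro w
    have : (fun x => ‖(V x).starProjection w‖ ^ 2) =
        fun x => ‖w‖ ^ 2 - ‖w - (V x).starProjection w‖ ^ 2 := by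
      funext x
      have h0 : inner ℝ (w - (V x).starProjection w) ((V x).starProjection w) = 0 :=
        Submodule.starProjection_inner_eq_zero w _ ((V x).starProjection_apply_mem w)
      have h1 := norm_add_sq_real (w - (V x).starProjection w) ((V x).starProjection w)
      rw [h0, sub_add_cancel] at h1
      linarith
    rw [this]
    exact measurable_const.sub ((hd w).pow_const 2)
  refine measurable_clm_of_inner fun v w => ?_
  have : (fun x => inner ℝ w ((V x).starProjection v)) = fun x =>
      (‖(V x).starProjection (w + v)‖ ^ 2 - ‖(V x).starProjection w‖ ^ 2 -
        ‖(V x).starProjection v‖ ^ 2) / 2 := by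
    funext x
    have h0 : inner ℝ (w - (V x).starProjection w) ((V x).starProjection v) = 0 :=
      Submodule.starProjection_inner_eq_zero w _ ((V x).starProjection_apply_mem v)
    rw [inner_sub_left, sub_eq_zero] at h0
    rw [h0, map_add, norm_add_sq_real]
    ring
  rw [this]
  exact (((hn _).sub (hn _)).sub (hn _)).div_const _

theorem measurable_finrank {V : X → Submodule ℝ (Euc m)}
    (h : Measurable fun x => (V x).starProjection) :
    Measurable fun x => Module.finrank ℝ (V x) := by
  have h1 : ∀ x, (Module.finrank ℝ (V x) : ℝ) = ∑ i,
      inner ℝ (EuclideanSpace.basisFun (Fin m) ℝ i)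
        ((V x).starProjection (EuclideanSpace.basisFun (Fin m) ℝ i)) := by
    intro x
    have hp : LinearMap.IsProj (V x) (V x).starProjection.toLinearMap :=
      ⟨fun v => (V x).starProjection_apply_mem v,
        fun v hv => Submodule.starProjection_eq_self_iff.2 hv⟩
    rw [← hp.trace, LinearMap.trace_eq_sum_inner _ (EuclideanSpace.basisFun (Fin m) ℝ)]
    rfl
  have h2 : Measurable fun x => (Module.finrank ℝ (V x) : ℝ) := by
    simp_rw [h1]
    refine Finset.measurable_fun_sum _ fun i _ => ?_
    exact measurable_const.inner (RandCocycle.measurable_apply_op h measurable_const)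
  have : (fun x => Module.finrank ℝ (V x)) = fun x => ⌊(Module.finrank ℝ (V x) : ℝ)⌋₊ := by
    simp
  rw [this]
  exact Nat.measurable_floor.comp h2

end SubspaceField

namespace RandCocycle

variable {S : Type*} [MeasurableSpace S] {m : ℕ} {A : RandCocycle S m} {c : ℝ} {K : Kernel S S}
  [IsMarkovKernel K] {μ : Measure S} [IsProbabilityMeasure μ]

/-! ### The slow subspace -/

/-- The subspace of the directions `v` along which the cocycle started from `x` grows slower than
`exp (n β)` with large probability at the times `n 0, n 1, …`, in the sense that the truncated means
`truncGrowth` at these times are summable. -/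
def slowSpace (A : RandCocycle S m) (K : Kernel S S) [IsMarkovKernel K] (β : ℝ) (n : ℕ → ℕ)
    (x : S) : Submodule ℝ (Euc m) where
  carrier := {v | ∑' k, A.truncGrowth K β (n k) x v ≠ ⊤}
  zero_mem' := by simp [truncGrowth]
  add_mem' {v w} hv hw := by
    refine ne_top_of_le_ne_top (ENNReal.add_ne_top.2 ⟨hv, hw⟩) ?_
    rw [← ENNReal.tsum_add]
    exact ENNReal.tsum_le_tsum fun k => truncGrowth_add_le β (n k) x v w
  smul_mem' t v hv := by
    refine ne_top_of_le_ne_top (ENNReal.mul_ne_top (a := max 1 (ENNReal.ofReal |t|)) ?_ hv) ?_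
    · exact max_lt ENNReal.one_lt_top ENNReal.ofReal_lt_top |>.ne
    · rw [← ENNReal.tsum_mul_left]
      exact ENNReal.tsum_le_tsum fun k => truncGrowth_smul_le β (n k) x t v

theorem mem_slowSpace {β : ℝ} {n : ℕ → ℕ} {x : S} {v : Euc m} :
    v ∈ A.slowSpace K β n x ↔ ∑' k, A.truncGrowth K β (n k) x v ≠ ⊤ := Iff.rfl

theorem measurable_starProjection_slowSpace (β : ℝ) (n : ℕ → ℕ) :
    Measurable fun x => (A.slowSpace K β n x).starProjection := by
  refine measurable_starProjection_of_inter_closedBall fun w r => ?_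
  have : {x | ∃ v ∈ Metric.closedBall w r, v ∈ A.slowSpace K β n x} =
      ⋃ B : ℕ, {x | ∃ v ∈ Metric.closedBall w r,
        ∑' k, A.truncGrowth K β (n k) x v ≤ (B : ENNReal)} := by
    ext x
    simp only [Set.mem_ofPred_eq, Set.mem_iUnion, mem_slowSpace]
    constructor
    · rintro ⟨v, hv, h⟩
      obtain ⟨B, hB⟩ := ENNReal.exists_nat_gt h
      exact ⟨B, v, hv, hB.le⟩
    · rintro ⟨B, v, hv, h⟩
      exact ⟨v, hv, ne_top_of_le_ne_top (ENNReal.natCast_ne_top B) h⟩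
  rw [this]
  refine MeasurableSet.iUnion fun B => ?_
  exact measurableSet_exists_tsum_le (isCompact_closedBall w r)
    (fun k x => continuous_truncGrowth β (n k) x)
    (fun k v => (measurable_truncGrowth β (n k)).comp (measurable_id.prodMk measurable_const))
    (ENNReal.natCast_ne_top B)

/-- The field of slow subspaces is forward invariant, for every starting point: by the Markov
property the mean of the sum defining `slowSpace` over one step of the chain is at most `c` times
the sum at the starting point. A finite spanning set makes the exceptional set independent of the
vector. -/
theorem HasBound.map_slowSpace_le (hA : A.HasBound c) (β : ℝ) (n : ℕ → ℕ) (x : S) :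
    ∀ᵐ y ∂(K x), (A.slowSpace K β n x).map (A.op (x, y)).toLinearMap ≤ A.slowSpace K β n y := by
  obtain ⟨s, hs⟩ := IsNoetherian.noetherian (A.slowSpace K β n x)
  have hmeas : ∀ k (v : Euc m), Measurable fun y => A.truncGrowth K β (n k) y (A.op (x, y) v) :=
    fun k v => (measurable_truncGrowth β (n k)).comp (measurable_id.prodMk
      (measurable_apply_op (A.measurable_op.comp (by fun_prop)) measurable_const))
  have h1 : ∀ v ∈ s, ∀ᵐ y ∂(K x), A.op (x, y) v ∈ A.slowSpace K β n y := by
    intro v hv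
    have hvV : v ∈ A.slowSpace K β n x := by rw [← hs]; exact Submodule.subset_span hv
    have hle : ∫⁻ y, ∑' k, A.truncGrowth K β (n k) y (A.op (x, y) v) ∂(K x) ≠ ⊤ := by
      rw [lintegral_tsum fun k => (hmeas k v).aemeasurable]
      refine ne_top_of_le_ne_top (ENNReal.mul_ne_top (ENNReal.ofReal_ne_top (r := c)) hvV) ?_
      rw [← ENNReal.tsum_mul_left]
      exact ENNReal.tsum_le_tsum fun k => hA.lintegral_truncGrowth_le β (n k) x v
    filter_upwards [ae_lt_top (Measurable.tsum fun k => hmeas k v) hle] with y hy using hy.ne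
  have h2 : ∀ᵐ y ∂(K x), ∀ v ∈ s, A.op (x, y) v ∈ A.slowSpace K β n y := by
    rw [eventually_all_finset]
    exact h1
  filter_upwards [h2] with y hy
  rw [← hs, Submodule.map_span, Submodule.span_le]
  rintro _ ⟨v, hv, rfl⟩
  exact hy v hv

theorem finrank_map_op (z : S × S) (V : Submodule ℝ (Euc m)) :
    Module.finrank ℝ (V.map (A.op z).toLinearMap) = Module.finrank ℝ V :=
  LinearEquiv.finrank_map_eq (A.toFun z.1 z.2).toLinearEquiv V

/-- The dimension of an invariant field of subspaces can only increase along the chain, so that it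
is constant by mixing. -/
theorem exists_ae_finrank_eq (hK : IsStronglyMixing K μ) {V : S → Submodule ℝ (Euc m)}
    (hV : Measurable fun x => (V x).starProjection)
    (hinv : ∀ x, ∀ᵐ y ∂(K x), (V x).map (A.op (x, y)).toLinearMap ≤ V y) :
    ∃ d, ∀ᵐ x ∂μ, Module.finrank ℝ (V x) = d := by
  have hm : ∀ x, Module.finrank ℝ (V x) ≤ m := fun x => by
    simpa using Submodule.finrank_le (V x)
  have hne : Nonempty S := by
    by_contra hne
    rw [not_nonempty_iff] at hne
    have := measure_univ (μ := μ)
    rw [Set.univ_eq_empty_iff.2 hne] at this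
    simp at this
  obtain ⟨d, ⟨x0, hx0⟩, hmax⟩ : ∃ d, (∃ x, Module.finrank ℝ (V x) = d) ∧
      ∀ x, Module.finrank ℝ (V x) ≤ d := by
    have hbdd : BddAbove (Set.range fun x => Module.finrank ℝ (V x)) :=
      ⟨m, by rintro _ ⟨x, rfl⟩; exact hm x⟩
    have := Nat.sSup_mem (Set.range_nonempty fun x => Module.finrank ℝ (V x)) hbdd
    exact ⟨_, this, fun x => le_csSup hbdd ⟨x, rfl⟩⟩
  have hfm := measurable_finrank hV
  have hDm : MeasurableSet {x | Module.finrank ℝ (V x) = d} := hfm (measurableSet_singleton d)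
  -- once the dimension is maximal, it stays so; mixing propagates this to `μ`-almost every point
  have hstep : ∀ x, Module.finrank ℝ (V x) = d → ∀ᵐ y ∂(K x), Module.finrank ℝ (V y) = d := by
    intro x hx
    filter_upwards [hinv x] with y hy
    refine le_antisymm (hmax y) ?_
    rw [← hx, ← finrank_map_op (A := A) (x, y)]
    exact Submodule.finrank_mono hy
  have hpow : ∀ n : ℕ, ∀ᵐ y ∂((K ^ n) x0), Module.finrank ℝ (V y) = d := by
    intro n
    induction n with
    | zero =>
      have : (K ^ 0) x0 = Measure.dirac x0 := by
        rw [pow_zero]; exact Kernel.id_apply x0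
      rw [this, ae_dirac_iff hDm]
      exact hx0
    | succ n ih =>
      have : (K ^ (n + 1)) x0 = ((K ^ n) x0).bind K := by
        rw [pow_succ']; exact Kernel.comp_apply _ _ _
      rw [this]
      change (((K ^ n) x0).bind K) {x | Module.finrank ℝ (V x) = d}ᶜ = 0
      rw [Measure.bind_apply hDm.compl K.aemeasurable, lintegral_eq_zero_iff
        (Kernel.measurable_coe K hDm.compl)]
      filter_upwards [ih] with x hx using hstep x hx
  obtain ⟨C, ρ, hC, hρ0, hρ1, H⟩ := hK.exists_real
  have hind : ∀ n : ℕ, |1 - μ.real {x | Module.finrank ℝ (V x) = d}| ≤ C * ρ ^ n * 1 := by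
    intro n
    have hind1 : ∀ x, |({x | Module.finrank ℝ (V x) = d}.indicator (fun _ => (1 : ℝ))) x| ≤ 1 := by
      intro x
      by_cases hx : x ∈ {x | Module.finrank ℝ (V x) = d} <;> simp [hx]
    have := H _ (measurable_const.indicator hDm) 1 hind1 x0 n
    rw [integral_indicator_const _ hDm, integral_indicator_const _ hDm] at this
    have hp : IsProbabilityMeasure ((K ^ n) x0) := (isMarkovKernel_pow K n).isProbabilityMeasure x0
    have h1 : ((K ^ n) x0).real {x | Module.finrank ℝ (V x) = d} = 1 := by
      rw [measureReal_def, (prob_compl_eq_zero_iff hDm).1 (hpow n)]; simp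
    simpa [h1] using this
  have hlim : Tendsto (fun n : ℕ => C * ρ ^ n * 1) atTop (𝓝 (C * 0 * 1)) :=
    ((tendsto_pow_atTop_nhds_zero_of_lt_one hρ0.le hρ1).const_mul C).mul_const 1
  have h0 : |1 - μ.real {x | Module.finrank ℝ (V x) = d}| ≤ 0 := by
    refine ge_of_tendsto' (by simpa using hlim) fun n => by simpa using hind n
  have h1 : μ.real {x | Module.finrank ℝ (V x) = d} = 1 := by
    have := abs_nonpos_iff.1 h0; linarith
  refine ⟨d, ?_⟩
  have h2 : μ {x | Module.finrank ℝ (V x) = d} = 1 := by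
    rw [measureReal_def] at h1
    rwa [← ENNReal.toReal_eq_one_iff]
  exact (prob_compl_eq_zero_iff hDm).2 h2

/-- For an irreducible cocycle, a nonzero forward invariant measurable field of subspaces of
constant dimension is everything: inclusion along the chain is equality, because dimensions agree.
-/
theorem IsIrreducible.finrank_eq (hirr : A.IsIrreducible K μ) (hμ : Kernel.Invariant K μ)
    {V : S → Submodule ℝ (Euc m)} (hV : Measurable fun x => (V x).starProjection)
    (hinv : ∀ x, ∀ᵐ y ∂(K x), (V x).map (A.op (x, y)).toLinearMap ≤ V y) {d : ℕ} (hd : 0 < d)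
    (hfin : ∀ᵐ x ∂μ, Module.finrank ℝ (V x) = d) : m ≤ d := by
  by_contra hdm
  push Not at hdm
  refine hirr ⟨V, hV, ⟨d, hd, hdm, hfin⟩, ?_⟩
  rw [ae_all_iff]
  intro n
  -- the inclusion is an equation between projections, hence a measurable condition
  have hiff : ∀ z : S × S, (V z.1).map (A.op z).toLinearMap ≤ V z.2 ↔
      (V z.2).starProjection * A.op z * (V z.1).starProjection =
        A.op z * (V z.1).starProjection := by
    intro z
    constructor
    · intro h
      ext1 v
      exact Submodule.starProjection_eq_self_iff.2
        (h ⟨_, (V z.1).starProjection_apply_mem v, rfl⟩)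
    · rintro h _ ⟨v, hv, rfl⟩
      have h1 := congrArg (fun T : Euc m →L[ℝ] Euc m => T v) h
      have h2 : (V z.1).starProjection v = v := Submodule.starProjection_eq_self_iff.2 hv
      simp only [mul_apply_eq_comp, h2] at h1
      exact Submodule.starProjection_eq_self_iff.1 h1
  have hmeas : MeasurableSet {z : S × S | (V z.1).map (A.op z).toLinearMap ≤ V z.2} := by
    simp_rw [hiff]
    have h1 : Measurable fun z : S × S => (V z.1).starProjection := hV.comp measurable_fst
    have h2 : Measurable fun z : S × S => (V z.2).starProjection := hV.comp measurable_snd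
    exact measurableSet_eq_fun ((h2.mul A.measurable_op).mul h1) (A.measurable_op.mul h1)
  have h1 : ∀ᵐ z ∂(μ ⊗ₘ K), (V z.1).map (A.op z).toLinearMap ≤ V z.2 :=
    Measure.ae_compProd_of_ae_ae hmeas (Eventually.of_forall hinv)
  rw [← map_pair_markovMeasure hμ n] at h1
  have hfin' : ∀ n, ∀ᵐ ω ∂(markovMeasure K μ), Module.finrank ℝ (V (ω n)) = d := by
    intro n
    have h2 := hfin
    rw [← map_coord_markovMeasure (K := K) hμ n] at h2
    exact ae_of_ae_map (measurable_pi_apply n).aemeasurable h2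
  filter_upwards [ae_of_ae_map (by fun_prop) h1, hfin' n, hfin' (n + 1)] with ω h2 h3 h4
  refine Submodule.eq_of_le_of_finrank_eq h2 ?_
  rw [finrank_map_op, h3, h4]

end RandCocycle

namespace RandCocycle

variable {S : Type*} [MeasurableSpace S] {m : ℕ} {A : RandCocycle S m} {c : ℝ} {K : Kernel S S}
  [IsMarkovKernel K] {μ : Measure S} [IsProbabilityMeasure μ]

/-! ### Uniform mean growth of all directions -/

theorem norm_le_sum_norm_apply (M : Euc m →L[ℝ] Euc m) :
    ‖M‖ ≤ ∑ i, ‖M (EuclideanSpace.single i 1)‖ := by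
  refine M.opNorm_le_bound (Finset.sum_nonneg fun _ _ => norm_nonneg _) fun v => ?_
  have h1 : M v = ∑ i, v i • M (EuclideanSpace.single i 1) := by
    conv_lhs => rw [← (EuclideanSpace.basisFun (Fin m) ℝ).sum_repr v]
    simp
  rw [h1, Finset.sum_mul]
  refine (norm_sum_le _ _).trans (Finset.sum_le_sum fun i _ => ?_)
  rw [norm_smul, mul_comm]
  gcongr
  exact PiLp.norm_apply_le v i

/-- The logarithm of the norm is controlled by the truncated growth of the basis vectors. -/
theorem HasBound.log_norm_le_truncated (hA : A.HasBound c) (hm : 1 ≤ m) (β : ℝ) (n : ℕ)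
    {M : Euc m →L[ℝ] Euc m} (hM : HasDistortion (c ^ n) M) :
    Real.log ‖M‖ ≤ n * β + Real.log m + n * (Real.log c + |β|) *
      ∑ i, (min 1 (ENNReal.ofReal
        (Real.exp (-(n * β)) * ‖M (EuclideanSpace.single i 1)‖))).toReal := by
  have hm0 : (1 : ℝ) ≤ m := by exact_mod_cast hm
  have hlm : 0 ≤ Real.log m := Real.log_nonneg hm0
  have hpos := hM.norm_pos (pow_pos hA.pos n) hm
  have hpos' : 0 < ‖M‖ := lt_of_lt_of_le (by have := hA.pos; positivity) hpos
  have hℓ := hA.log_nonneg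
  have hs0 : 0 ≤ ∑ i, (min 1 (ENNReal.ofReal
      (Real.exp (-(n * β)) * ‖M (EuclideanSpace.single i 1)‖))).toReal :=
    Finset.sum_nonneg fun _ _ => ENNReal.toReal_nonneg
  by_cases h : ∀ i, Real.exp (-(n * β)) * ‖M (EuclideanSpace.single i 1)‖ ≤ 1
  · have h1 : ‖M‖ ≤ m * Real.exp (n * β) := by
      refine (norm_le_sum_norm_apply M).trans ?_
      calc _ ≤ ∑ _i : Fin m, Real.exp (n * β) := by
            refine Finset.sum_le_sum fun i _ => ?_
            have := h i
            rw [Real.exp_neg, inv_mul_le_iff₀ (Real.exp_pos _), mul_one] at this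
            exact this
        _ = _ := by simp
    have h2 := Real.log_le_log hpos' h1
    rw [Real.log_mul (by positivity) (Real.exp_pos _).ne', Real.log_exp] at h2
    have : 0 ≤ n * (Real.log c + |β|) * ∑ i, (min 1 (ENNReal.ofReal
        (Real.exp (-(n * β)) * ‖M (EuclideanSpace.single i 1)‖))).toReal := by positivity
    linarith
  · push Not at h
    obtain ⟨i, hi⟩ := h
    have h1 : 1 ≤ ∑ i, (min 1 (ENNReal.ofReal
        (Real.exp (-(n * β)) * ‖M (EuclideanSpace.single i 1)‖))).toReal := by
      refine le_trans ?_ (Finset.single_le_sum (fun _ _ => ENNReal.toReal_nonneg)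
        (Finset.mem_univ i))
      rw [min_eq_left (by rw [← ENNReal.ofReal_one]; exact ENNReal.ofReal_le_ofReal hi.le)]
      simp
    have h2 : Real.log ‖M‖ ≤ n * Real.log c := by
      rw [← Real.log_pow]
      exact Real.log_le_log hpos' (hM.norm_le (pow_nonneg hA.pos.le n))
    have h3 : (n : ℝ) * (Real.log c + |β|) ≤ n * (Real.log c + |β|) *
        ∑ i, (min 1 (ENNReal.ofReal
          (Real.exp (-(n * β)) * ‖M (EuclideanSpace.single i 1)‖))).toReal :=
      le_mul_of_one_le_right (by positivity) h1
    have h4 : -(n * β) ≤ n * |β| := by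
      have := neg_abs_le β
      nlinarith [(Nat.cast_nonneg n : (0 : ℝ) ≤ n)]
    nlinarith

theorem HasBound.integral_log_norm_le (hA : A.HasBound c) (hm : 1 ≤ m) (β : ℝ) (n : ℕ) :
    ∫ x, ∫ p, Real.log ‖p.2‖ ∂(A.law K n x) ∂μ ≤ n * β + Real.log m + n * (Real.log c + |β|) *
      ∑ i, ∫ x, (A.truncGrowth K β n x (EuclideanSpace.single i 1)).toReal ∂μ := by
  have hφ := isSubadditive_log_norm (m := m) hA.1 hm
  have hφm := hφ.measurable
  have htm : ∀ i, Measurable fun p : S × (Euc m →L[ℝ] Euc m) => (min 1 (ENNReal.ofReal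
      (Real.exp (-(n * β)) * ‖p.2 (EuclideanSpace.single i 1)‖))).toReal := fun i =>
    (measurable_truncGrowth_integrand β n _).ennreal_toReal
  have hti : ∀ i x, Integrable (fun p : S × (Euc m →L[ℝ] Euc m) => (min 1 (ENNReal.ofReal
      (Real.exp (-(n * β)) * ‖p.2 (EuclideanSpace.single i 1)‖))).toReal) (A.law K n x) := by
    intro i x
    refine hA.integrable_law n x (htm i) 1 fun p _ => ?_
    rw [abs_of_nonneg ENNReal.toReal_nonneg]
    exact ENNReal.toReal_le_of_le_ofReal zero_le_one (by simp)
  have hte : ∀ i x, ∫ p, (min 1 (ENNReal.ofReal (Real.exp (-(n * β)) *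
      ‖p.2 (EuclideanSpace.single i 1)‖))).toReal ∂(A.law K n x) =
      (A.truncGrowth K β n x (EuclideanSpace.single i 1)).toReal := by
    intro i x
    rw [integral_toReal (measurable_truncGrowth_integrand β n _).aemeasurable
      (Eventually.of_forall fun p => (min_le_left _ _).trans_lt ENNReal.one_lt_top)]
    rfl
  have hgm : ∀ i, Measurable fun x =>
      (A.truncGrowth K β n x (EuclideanSpace.single i 1)).toReal := fun i =>
    ((measurable_truncGrowth β n).comp (measurable_id.prodMk measurable_const)).ennreal_toReal
  have hgi : ∀ i, Integrable (fun x =>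
      (A.truncGrowth K β n x (EuclideanSpace.single i 1)).toReal) μ := fun i => by
    refine Integrable.of_bound (hgm i).aestronglyMeasurable 1 (Eventually.of_forall fun x => ?_)
    rw [Real.norm_eq_abs, abs_of_nonneg ENNReal.toReal_nonneg]
    exact ENNReal.toReal_le_of_le_ofReal zero_le_one (by simpa using truncGrowth_le_one β n x _)
  have hin : ∀ x, ∫ p, Real.log ‖p.2‖ ∂(A.law K n x) ≤ n * β + Real.log m +
      n * (Real.log c + |β|) *
        ∑ i, (A.truncGrowth K β n x (EuclideanSpace.single i 1)).toReal := by
    intro x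
    have hsi := integrable_finsetSum Finset.univ fun i _ => hti i x
    calc _ ≤ ∫ p, (n * β + Real.log m + n * (Real.log c + |β|) *
          ∑ i, (min 1 (ENNReal.ofReal (Real.exp (-(n * β)) *
            ‖p.2 (EuclideanSpace.single i 1)‖))).toReal) ∂(A.law K n x) := by
          refine integral_mono_ae ?_ ((integrable_const _).add (hsi.const_mul _)) ?_
          · exact hA.integrable_law n x (g := fun p => Real.log ‖p.2‖) (by fun_prop) _
              fun p hp => hφ.bound _ _ hp
          · filter_upwards [hA.ae_law n x] with p hp using hA.log_norm_le_truncated hm β n hp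
      _ = _ := by
          rw [integral_add (integrable_const _) (hsi.const_mul _), integral_const_mul,
            integral_finsetSum _ fun i _ => hti i x]
          simp [hte]
  have hsi := integrable_finsetSum Finset.univ fun i _ => hgi i
  calc _ ≤ ∫ x, (n * β + Real.log m + n * (Real.log c + |β|) *
        ∑ i, (A.truncGrowth K β n x (EuclideanSpace.single i 1)).toReal) ∂μ := by
        refine integral_mono ?_ ((integrable_const _).add (hsi.const_mul _)) hin
        refine Integrable.of_bound (measurable_integral_law' n
          (g := fun p => Real.log ‖p.2‖) (by fun_prop)).aestronglyMeasurable
          (0 + n * Real.log c) (Eventually.of_forall fun x => ?_)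
        exact hA.abs_integral_law_le n x _ fun p hp => hφ.bound _ _ hp
    _ = _ := by
        rw [integral_add (integrable_const _) (hsi.const_mul _), integral_const_mul,
          integral_finsetSum _ fun i _ => hgi i]
        simp

/-- If all the basis vectors are slow, then so is the norm of the product, and the top exponent is
at most `β`. -/
theorem HasBound.lyapSum_one_le_of_slowSpace_eq_top (hA : A.HasBound c) (hm : 1 ≤ m)
    (hK : IsStronglyMixing K μ) {β : ℝ} {n : ℕ → ℕ} (hn : ∀ k, k ≤ n k)
    (htop : ∀ᵐ x ∂μ, A.slowSpace K β n x = ⊤) : A.lyapSum K μ 1 ≤ β := by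
  refine le_of_forall_pos_le_add fun ε hε => ?_
  have hφ := isSubadditive_log_norm (m := m) hA.1 hm
  have ht : ∀ i : Fin m, Tendsto (fun k => ∫ x, (A.truncGrowth K β (n k) x
      (EuclideanSpace.single i 1)).toReal ∂μ) atTop (𝓝 0) := by
    intro i
    have : Tendsto (fun k => ∫ x, (A.truncGrowth K β (n k) x
        (EuclideanSpace.single i 1)).toReal ∂μ) atTop (𝓝 (∫ _, (0 : ℝ) ∂μ)) := by
      refine tendsto_integral_of_dominated_convergence (fun _ => 1) (fun k => ?_)
        (integrable_const _) (fun k => Eventually.of_forall fun x => ?_) ?_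
      · exact ((measurable_truncGrowth β (n k)).comp
          (measurable_id.prodMk measurable_const)).ennreal_toReal.aestronglyMeasurable
      · rw [Real.norm_eq_abs, abs_of_nonneg ENNReal.toReal_nonneg]
        exact ENNReal.toReal_le_of_le_ofReal zero_le_one
          (by simpa using truncGrowth_le_one β (n k) x _)
      · filter_upwards [htop] with x hx
        have h1 : EuclideanSpace.single i (1 : ℝ) ∈ A.slowSpace K β n x := by
          rw [hx]; trivial
        have h2 := ENNReal.tendsto_atTop_zero_of_tsum_ne_top (mem_slowSpace.1 h1)
        have h3 := (ENNReal.tendsto_toReal ENNReal.zero_ne_top).comp h2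
        simpa [Function.comp_def] using h3
    simpa using this
  have hev : ∀ᶠ k : ℕ in atTop, ∫ x, ∫ p, Real.log ‖p.2‖ ∂(A.law K (n k) x) ∂μ ≤
      (n k : ℝ) * (β + ε / 3) := by
    have h1 : Tendsto (fun k : ℕ => Real.log m / (k : ℝ) + (Real.log c + |β|) *
        ∑ i, ∫ x, (A.truncGrowth K β (n k) x (EuclideanSpace.single i 1)).toReal ∂μ) atTop
        (𝓝 (0 + (Real.log c + |β|) * ∑ _i : Fin m, 0)) :=
      (tendsto_const_div_atTop_nhds_zero_nat _).add
        ((tendsto_finsetSum _ fun i _ => ht i).const_mul _)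
    have h2 := h1.eventually_le_const (u := ε / 3) (by simpa using by positivity)
    filter_upwards [h2, eventually_gt_atTop 0] with k hk hk0
    refine (hA.integral_log_norm_le hm β (n k)).trans ?_
    have hk0' : (0 : ℝ) < k := by exact_mod_cast hk0
    have hkn : (k : ℝ) ≤ n k := by exact_mod_cast hn k
    have hlm : 0 ≤ Real.log m := Real.log_nonneg (by exact_mod_cast hm)
    have h3 : Real.log m ≤ n k * (Real.log m / k) := by
      rw [mul_div_assoc', le_div_iff₀ hk0', mul_comm]
      gcongr
    have h4 := mul_le_mul_of_nonneg_left hk (hk0'.le.trans hkn)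
    linarith
  have hfr : ∃ᶠ j : ℕ in atTop, ∫ x, ∫ p, Real.log ‖p.2‖ ∂(A.law K j x) ∂μ ≤
      (j : ℝ) * (β + ε / 3) := by
    rw [Filter.frequently_atTop]
    intro a
    obtain ⟨k, hk, hka⟩ := (hev.and (eventually_ge_atTop a)).exists
    exact ⟨n k, hka.trans (hn k), hk⟩
  obtain ⟨N, hN, hNb⟩ := hφ.exists_uniform hA le_rfl hK (by positivity : 0 < ε / 3) hfr
  exact hA.lyapSum_one_le hm hN (by linarith) hNb

/-- Irreducibility forces every direction to grow, uniformly in the mean, at any rate below the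
top Lyapunov exponent. Otherwise, directions whose growth is too slow exist above typical points,
and they form a proper invariant field of subspaces. -/
theorem HasBound.exists_le_meanGrowth (hA : A.HasBound c) (hm : 1 ≤ m) (hμ : Kernel.Invariant K μ)
    (hK : IsStronglyMixing K μ) (hirr : A.IsIrreducible K μ) {β₁ : ℝ}
    (hβ₁ : β₁ < A.lyapSum K μ 1) :
    ∃ n : ℕ, 1 ≤ n ∧ ∀ x (v : Euc m), v ≠ 0 → n * β₁ ≤ A.meanGrowth K n x v := by
  by_contra hcon
  -- `β₀ = sup T` is the best uniform rate, and `β` lies strictly between it and the exponent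
  set T : Set ℝ := {β | ∃ n : ℕ, 1 ≤ n ∧ ∀ x (v : Euc m), v ≠ 0 → n * β ≤ A.meanGrowth K n x v}
  have hTb : ∀ β ∈ T, β ≤ β₁ := by
    rintro β ⟨n, hn, h⟩
    by_contra hlt
    push Not at hlt
    exact hcon ⟨n, hn, fun x v hv => le_trans (by gcongr) (h x v hv)⟩
  have hTne : T.Nonempty := by
    refine ⟨-Real.log c, 1, le_rfl, fun x v hv => ?_⟩
    have := (abs_le.1 (hA.abs_meanGrowth_le (K := K) 1 x hv)).1
    simpa using this
  have hTbdd : BddAbove T := ⟨β₁, hTb⟩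
  set β₀ := sSup T
  have hβ₀ : β₀ ≤ β₁ := csSup_le hTne hTb
  set β := (β₀ + A.lyapSum K μ 1) / 2 with hβdef
  have hβ : β₀ < β := by rw [hβdef]; linarith
  have hβ' : β < A.lyapSum K μ 1 := by rw [hβdef]; linarith
  have hlow : ∀ ε > 0, ∃ N : ℕ, 1 ≤ N ∧
      ∀ x (v : Euc m), v ≠ 0 → N * (β₀ - ε) ≤ A.meanGrowth K N x v := by
    intro ε hε
    obtain ⟨t, ⟨N, hN, h⟩, ht⟩ := exists_lt_of_lt_csSup hTne (by linarith : β₀ - ε < sSup T)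
    exact ⟨N, hN, fun x v hv => le_trans (by gcongr) (h x v hv)⟩
  have hmin : ∀ η > 0, ∀ N : ℕ, 1 ≤ N → ∃ x, ∃ v : Euc m, v ≠ 0 ∧
      A.meanGrowth K N x v < N * (β₀ + η) := by
    intro η hη N hN
    have : β₀ + η ∉ T := fun h => by
      have := le_csSup hTbdd h
      linarith
    by_contra hno
    push Not at hno
    exact this ⟨N, hN, fun x v hv => hno x v hv⟩
  choose n hkn hn1 hu using fun k : ℕ =>
    hA.exists_truncGrowth_le hβ hlow (by positivity : (0 : ℝ) < (1 / 2) ^ k) k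
  have hex := hA.ae_exists_tsum_lt_top hm hK hβ hn1 hu hmin
  have hV := measurable_starProjection_slowSpace (A := A) (K := K) β n
  have hinv := hA.map_slowSpace_le (K := K) β n
  obtain ⟨d, hd⟩ := exists_ae_finrank_eq hK hV hinv
  have hd0 : 0 < d := by
    obtain ⟨x, ⟨v, hv, hlt⟩, hxd⟩ := (hex.and hd).exists
    rw [← hxd, Nat.pos_iff_ne_zero, Ne, Submodule.finrank_eq_zero]
    intro hbot
    have h1 : v ∈ A.slowSpace K β n x := mem_slowSpace.2 hlt.ne
    rw [hbot, Submodule.mem_bot] at h1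
    simp [h1] at hv
  have hmd := hirr.finrank_eq hμ hV hinv hd0 hd
  have htop : ∀ᵐ x ∂μ, A.slowSpace K β n x = ⊤ := by
    filter_upwards [hd] with x hx
    refine Submodule.eq_top_of_finrank_eq (le_antisymm (Submodule.finrank_le _) ?_)
    simpa [hx] using hmd
  have := hA.lyapSum_one_le_of_slowSpace_eq_top hm hK hkn htop
  linarith

/-- An upper bound for the logarithm of the expansion factor, at the direction of `v`, of the action
of `M` on projective space: `log ‖∧₂ M‖ - 2 log (‖M v‖ / ‖v‖)`. -/
def projRate (M : Euc m →L[ℝ] Euc m) (v : Euc m) : ℝ :=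
  Real.log (wedgeNorm 2 M) - 2 * Real.log (‖M v‖ / ‖v‖)

/-- The gap between the first two Lyapunov exponents and the uniform growth of all directions make
the projective action contracting in the mean, uniformly in the starting point. -/
theorem HasBound.exists_integral_projRate_le (hA : A.HasBound c) (hm : 2 ≤ m)
    (hμ : Kernel.Invariant K μ) (hK : IsStronglyMixing K μ) (hirr : A.IsIrreducible K μ)
    (hgap : A.lyapExp K μ 2 < A.lyapExp K μ 1) :
    ∃ n : ℕ, 1 ≤ n ∧ ∀ x (v : Euc m), v ≠ 0 → ∫ p, projRate p.2 v ∂(A.law K n x) ≤ -1 := by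
  have hg : 0 < 2 * A.lyapSum K μ 1 - A.lyapSum K μ 2 := by
    simp only [lyapExp, lyapSum_zero, Nat.sub_self, Nat.add_one_sub_one] at hgap
    linarith
  set g := 2 * A.lyapSum K μ 1 - A.lyapSum K μ 2 with hgdef
  obtain ⟨R, hR, hφ⟩ := isSubadditive_log_wedgeNorm (m := m) hA.1 hm
  have hev := hA.eventually_integral_le (K := K) (μ := μ) hm
    (b := A.lyapSum K μ 2 + g / 6) (by linarith)
  obtain ⟨N₁, hN₁, h1⟩ := hφ.exists_uniform hA hR hK (by positivity : 0 < g / 6) hev.frequently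
  obtain ⟨N₂, hN₂, h2⟩ := hA.exists_le_meanGrowth (by omega) hμ hK hirr
    (β₁ := A.lyapSum K μ 1 - g / 6) (by linarith)
  obtain ⟨q, hq⟩ := exists_nat_ge (3 / g)
  refine ⟨N₁ * N₂ * (q + 1), Nat.mul_pos (Nat.mul_pos hN₁ hN₂) q.succ_pos, fun x v hv => ?_⟩
  have hφm := hφ.measurable
  have hi1 : Integrable (fun p : S × (Euc m →L[ℝ] Euc m) => Real.log (wedgeNorm 2 p.2))
      (A.law K (N₁ * N₂ * (q + 1)) x) :=
    hA.integrable_law _ x (hφm.comp measurable_snd) _ fun p hp => hφ.bound _ _ hp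
  have hi2 := hA.integrable_log_growth (K := K) (N₁ * N₂ * (q + 1)) x hv
  simp only [projRate]
  rw [integral_sub hi1 (hi2.const_mul 2), integral_const_mul]
  have h3 := hφ.integral_law_mul_le hA h1 (N₂ * (q + 1) - 1) x
  have h4 := hA.mul_le_meanGrowth h2 (N₁ * (q + 1)) x hv
  have e1 : N₂ * (q + 1) - 1 + 1 = N₂ * (q + 1) := Nat.sub_add_cancel (Nat.mul_pos hN₂ q.succ_pos)
  have e2 : ((N₂ * (q + 1) - 1 : ℕ) : ℝ) + 1 = N₂ * (q + 1) := by exact_mod_cast e1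
  rw [e1, e2, ← mul_assoc] at h3
  rw [show N₂ * (N₁ * (q + 1)) = N₁ * N₂ * (q + 1) by ring, meanGrowth] at h4
  push_cast at h4
  have hn1 : (1 : ℝ) ≤ N₁ := by exact_mod_cast hN₁
  have hn2 : (1 : ℝ) ≤ N₂ := by exact_mod_cast hN₂
  have h5 : 1 ≤ (N₁ : ℝ) * N₂ := by nlinarith
  rw [div_le_iff₀ hg] at hq
  have h6 : (3 : ℝ) ≤ N₁ * N₂ * (q + 1) * g := by
    have h7 : (3 : ℝ) ≤ (q + 1) * g := by linarith
    nlinarith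
  nlinarith

end RandCocycle

namespace RandCocycle

variable {S : Type*} [MeasurableSpace S] {m : ℕ} {A : RandCocycle S m} {c : ℝ} {K : Kernel S S}
  [IsMarkovKernel K] {μ : Measure S} [IsProbabilityMeasure μ]

/-! ### Stability under perturbation of the cocycle -/

theorem projRate_smul (M : Euc m →L[ℝ] Euc m) {t : ℝ} (ht : t ≠ 0) (v : Euc m) :
    projRate M (t • v) = projRate M v := by
  rw [projRate, projRate, map_smul, norm_smul, norm_smul,
    mul_div_mul_left _ _ (norm_ne_zero_iff.2 ht)]

theorem measurable_projRate (v : Euc m) : Measurable fun M => projRate M v := by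
  have h1 : Measurable fun M : Euc m →L[ℝ] Euc m => wedgeNorm 2 M :=
    (continuous_wedgeNorm 2).measurable
  unfold projRate
  fun_prop

theorem exists_abs_projRate_le (hm : 2 ≤ m) :
    ∃ R : ℝ, 1 ≤ R ∧ ∀ C : ℝ, 0 < C → ∀ M : Euc m →L[ℝ] Euc m, HasDistortion C M →
      ∀ v, v ≠ 0 → |projRate M v| ≤ Real.log R + 4 * Real.log C := by
  obtain ⟨R, hR, H⟩ := exists_wedgeNorm_bounds hm
  refine ⟨R, hR, fun C hC M hM v hv => ?_⟩
  have h1 := (H C hC M hM).2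
  have h2 := hM.abs_log_le hC hv
  rw [projRate]
  have h3 := abs_sub (Real.log (wedgeNorm 2 M)) (2 * Real.log (‖M v‖ / ‖v‖))
  rw [abs_mul, abs_two] at h3
  push_cast at h1
  linarith

/-- The rate is uniformly continuous on maps of bounded distortion, uniformly in the direction. -/
theorem exists_abs_projRate_sub_le (hm : 2 ≤ m) {C : ℝ} (hC : 0 < C) {ε : ℝ} (hε : 0 < ε) :
    ∃ δ > 0, ∀ M N : Euc m →L[ℝ] Euc m, HasDistortion C M → HasDistortion C N → ‖M - N‖ ≤ δ →
      ∀ v, v ≠ 0 → |projRate M v - projRate N v| ≤ ε := by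
  obtain ⟨R, hR, H⟩ := exists_wedgeNorm_bounds hm
  have hcpt : IsCompact ({M : Euc m →L[ℝ] Euc m | HasDistortion C M} ×ˢ
      Metric.sphere (0 : Euc m) 1) := by
    have : ProperSpace (Euc m →L[ℝ] Euc m) := FiniteDimensional.proper ℝ _
    refine IsCompact.prod ?_ (isCompact_sphere 0 1)
    refine (isCompact_closedBall (0 : Euc m →L[ℝ] Euc m) C).of_isClosed_subset
      (isClosed_hasDistortion C) fun M hM => ?_
    rw [mem_closedBall_zero_iff]
    exact HasDistortion.norm_le hM hC.le
  have hcont : ContinuousOn (fun z : (Euc m →L[ℝ] Euc m) × Euc m => projRate z.1 z.2)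
      ({M : Euc m →L[ℝ] Euc m | HasDistortion C M} ×ˢ Metric.sphere (0 : Euc m) 1) := by
    refine ContinuousOn.sub ?_ (ContinuousOn.const_mul ?_ 2)
    · exact ((continuous_wedgeNorm 2).comp continuous_fst).continuousOn.log
        fun z hz => (H C hC z.1 hz.1).1.ne'
    · refine ContinuousOn.log ?_ fun z hz => ?_
      · refine ContinuousOn.div (Continuous.continuousOn ?_) continuous_snd.norm.continuousOn
          fun z hz => ?_
        · exact (continuous_fst.clm_apply continuous_snd).norm
        · have : ‖z.2‖ = 1 := by simpa using hz.2
          rw [this]; exact one_ne_zero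
      · have h1 : ‖z.2‖ = 1 := by simpa using hz.2
        have h2 : z.2 ≠ 0 := by
          rintro h0
          rw [h0, norm_zero] at h1
          exact zero_ne_one h1
        rw [h1, div_one, norm_ne_zero_iff]
        exact HasDistortion.map_ne_zero hz.1 h2
  have hu := hcpt.uniformContinuousOn_of_continuous hcont
  obtain ⟨δ, hδ, h⟩ := Metric.uniformContinuousOn_iff.1 hu ε hε
  refine ⟨δ / 2, by positivity, fun M N hM hN hMN v hv => ?_⟩
  have hv' := norm_ne_zero_iff.2 hv
  have h1 : ‖v‖⁻¹ • v ∈ Metric.sphere (0 : Euc m) 1 := by simp [norm_smul, hv']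
  have h2 := h (M, ‖v‖⁻¹ • v) ⟨hM, h1⟩ (N, ‖v‖⁻¹ • v) ⟨hN, h1⟩ (by
    rw [Prod.dist_eq, dist_self, max_eq_left dist_nonneg, dist_eq_norm]
    exact hMN.trans_lt (by linarith))
  simp only [projRate_smul _ (inv_ne_zero hv'), Real.dist_eq] at h2
  exact h2.le

theorem norm_op_sub_le (A B : RandCocycle S m) (z : S × S) : ‖A.op z - B.op z‖ ≤ dist A B :=
  le_ciSup (bddAbove_op_sub A B) z

theorem HasBound.of_dist_le (hA : A.HasBound c) {B : RandCocycle S m}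
    (h : dist A B ≤ (2 * c)⁻¹) : B.HasBound (2 * c) := by
  have hc := hA.1
  have hc0 := hA.pos
  refine ⟨by linarith, fun z v => ?_⟩
  have h1 : ‖A.op z v - B.op z v‖ ≤ (2 * c)⁻¹ * ‖v‖ := by
    have := (A.op z - B.op z).le_opNorm v
    rw [sub_apply] at this
    refine this.trans ?_
    gcongr
    exact (norm_op_sub_le A B z).trans h
  obtain ⟨h2, h3⟩ := hA.2 z v
  have h4 : (2 * c)⁻¹ * ‖v‖ ≤ c * ‖v‖ := by
    gcongr
    exact (inv_le_one_of_one_le₀ (by linarith)).trans hc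
  have h5 := norm_sub_norm_le (A.op z v) (B.op z v)
  have h6 := norm_sub_norm_le (B.op z v) (A.op z v)
  rw [norm_sub_rev] at h6
  refine ⟨by linarith, ?_⟩
  have h7 : c * ‖A.op z v‖ ≤ c * (‖B.op z v‖ + (2 * c)⁻¹ * ‖v‖) := by gcongr; linarith
  have h8 : c * ((2 * c)⁻¹ * ‖v‖) = ‖v‖ / 2 := by field_simp
  nlinarith

/-- The products of two cocycles along the same path of the chain form a Markov chain, which
couples their laws. -/
theorem HasBound.integral_projRate_sub_le {B : RandCocycle S m} (hm : 2 ≤ m) (hA : A.HasBound c)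
    (hB : B.HasBound c) (n : ℕ) {δ ε : ℝ}
    (hδ : ∀ M N : Euc m →L[ℝ] Euc m, HasDistortion (c ^ n) M → HasDistortion (c ^ n) N →
      ‖M - N‖ ≤ δ → ∀ v, v ≠ 0 → |projRate M v - projRate N v| ≤ ε)
    (hd : n * c ^ n * dist A B ≤ δ) (x : S) {v : Euc m} (hv : v ≠ 0) :
    ∫ p, projRate p.2 v ∂(B.law K n x) ≤ ∫ p, projRate p.2 v ∂(A.law K n x) + ε := by
  have hc := hA.1
  have hc0 := hA.pos
  set pair : S × S → (Euc m →L[ℝ] Euc m) × (Euc m →L[ℝ] Euc m) := fun z => (A.op z, B.op z)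
  have hpair : Measurable pair := A.measurable_op.prodMk B.measurable_op
  obtain ⟨R, hR, H⟩ := exists_abs_projRate_le (m := m) hm
  have hae : ∀ᵐ p ∂(prodLaw K pair n x), p.2 ∈ {g : (Euc m →L[ℝ] Euc m) × (Euc m →L[ℝ] Euc m) |
      (HasDistortion (c ^ n) g.1 ∧ HasDistortion (c ^ n) g.2) ∧
        ‖g.1 - g.2‖ ≤ n * c ^ n * dist A B} := by
    refine ae_prodLaw_mem hpair
      (D := fun n => {g : (Euc m →L[ℝ] Euc m) × (Euc m →L[ℝ] Euc m) |
      (HasDistortion (c ^ n) g.1 ∧ HasDistortion (c ^ n) g.2) ∧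
        ‖g.1 - g.2‖ ≤ n * c ^ n * dist A B}) (fun n => ?_) ?_ ?_ n x
    · refine MeasurableSet.inter (MeasurableSet.inter ?_ ?_) ?_
      · exact ((isClosed_hasDistortion _).preimage continuous_fst).measurableSet
      · exact ((isClosed_hasDistortion _).preimage continuous_snd).measurableSet
      · exact (isClosed_le (continuous_fst.sub continuous_snd).norm continuous_const).measurableSet
    · simpa using hasDistortion_one
    · rintro n z ⟨M, N⟩ ⟨⟨hM, hN⟩, hMN⟩
      simp only at hM hN hMN
      have hcn : 0 ≤ c ^ n := by positivity
      refine ⟨⟨?_, ?_⟩, ?_⟩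
      · have := (hA.2 z).mul hM hcn hc0.le
        rw [pow_succ]; simpa [mul_comm] using this
      · have := (hB.2 z).mul hN hcn hc0.le
        rw [pow_succ]; simpa [mul_comm] using this
      · change ‖A.op z * M - B.op z * N‖ ≤ _
        have e : A.op z * M - B.op z * N = A.op z * (M - N) + (A.op z - B.op z) * N := by
          rw [mul_sub, sub_mul]; abel
        rw [e]
        have h1 : ‖A.op z * (M - N)‖ ≤ c * (n * c ^ n * dist A B) :=
          (norm_mul_le _ _).trans (by gcongr; exact (hA.2 z).norm_le hc0.le)
        have h2 : ‖(A.op z - B.op z) * N‖ ≤ dist A B * c ^ n :=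
          (norm_mul_le _ _).trans (by
            gcongr
            · exact norm_op_sub_le A B z
            · exact hN.norm_le hcn)
        have h3 : dist A B * c ^ n ≤ c * (dist A B * c ^ n) :=
          le_mul_of_one_le_left (by positivity) hc
        refine (norm_add_le _ _).trans ?_
        push_cast
        rw [pow_succ]
        linarith
  have hmapA : (prodLaw K pair n x).map (fun p => (p.1, p.2.1)) = A.law K n x :=
    map_prodLaw_hom (MonoidHom.fst _ _) measurable_fst hpair n x
  have hmapB : (prodLaw K pair n x).map (fun p => (p.1, p.2.2)) = B.law K n x :=
    map_prodLaw_hom (MonoidHom.snd _ _) measurable_snd hpair n x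
  have hXm := measurable_projRate v
  have : IsProbabilityMeasure (prodLaw K pair n x) := isProbabilityMeasure_prodLaw hpair n x
  have hXm' : Measurable fun p : S × (Euc m →L[ℝ] Euc m) => projRate p.2 v :=
    hXm.comp measurable_snd
  rw [← hmapA, ← hmapB, integral_map (by fun_prop) hXm'.aestronglyMeasurable,
    integral_map (by fun_prop) hXm'.aestronglyMeasurable]
  have hcn : 0 < c ^ n := by positivity
  have hiA : Integrable (fun p : S × ((Euc m →L[ℝ] Euc m) × (Euc m →L[ℝ] Euc m)) =>
      projRate p.2.1 v) (prodLaw K pair n x) :=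
    Integrable.of_bound (hXm.comp (by fun_prop)).aestronglyMeasurable _
      (hae.mono fun p hp => H _ hcn _ hp.1.1 v hv)
  have hiB : Integrable (fun p : S × ((Euc m →L[ℝ] Euc m) × (Euc m →L[ℝ] Euc m)) =>
      projRate p.2.2 v) (prodLaw K pair n x) :=
    Integrable.of_bound (hXm.comp (by fun_prop)).aestronglyMeasurable _
      (hae.mono fun p hp => H _ hcn _ hp.1.2 v hv)
  calc _ ≤ ∫ p, (projRate p.2.1 v + ε) ∂(prodLaw K pair n x) := by
        refine integral_mono_ae hiB (hiA.add (integrable_const _)) ?_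
        filter_upwards [hae] with p hp
        have := abs_le.1 (hδ p.2.1 p.2.2 hp.1.1 hp.1.2 (hp.2.trans hd) v hv)
        linarith [this.1]
    _ = _ := by
        rw [integral_add hiA (integrable_const _)]
        simp

/-- The mean contraction of the projective action gives a contraction of small moments, with
constants which are uniform in a neighbourhood of the cocycle. -/
theorem exists_nhds_lintegral_exp_projRate_le (hm : 2 ≤ m) {n : ℕ}
    (h : ∀ x (v : Euc m), v ≠ 0 → ∫ p, projRate p.2 v ∂(A.law K n x) ≤ -1) :
    ∃ V ∈ 𝓝 A, ∃ c α₀ : ℝ, 0 < α₀ ∧ α₀ ≤ 1 ∧ ∀ B ∈ V, B.HasBound c ∧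
      ∀ α, 0 ≤ α → α ≤ α₀ → ∀ x (v : Euc m), v ≠ 0 →
        ∫⁻ p, ENNReal.ofReal (Real.exp (α * projRate p.2 v)) ∂(B.law K n x) ≤
          ENNReal.ofReal (1 - α / 4) := by
  obtain ⟨a, ha⟩ := A.exists_hasBound
  have ha1 := ha.1
  set c := 2 * a
  have hc1 : 1 ≤ c := by simp only [c]; linarith
  have hc0 : 0 < c := by linarith
  have hcn : 0 < c ^ n := by positivity
  obtain ⟨δ, hδ, hunif⟩ := exists_abs_projRate_sub_le (m := m) hm hcn
    (by norm_num : (0 : ℝ) < 1 / 2)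
  obtain ⟨R', hR', H⟩ := exists_abs_projRate_le (m := m) hm
  set R := Real.log R' + 4 * Real.log (c ^ n)
  have hR : 0 ≤ R := by
    have h1 := Real.log_nonneg hR'
    have h2 := Real.log_nonneg (one_le_pow₀ hc1 (n := n))
    positivity
  -- `1 / c` keeps the bounds of nearby cocycles under control, the other term their products
  set r := min c⁻¹ (δ / ((n + 1) * c ^ n))
  have hr : 0 < r := by positivity
  set α₀ := min 1 (1 / (4 * (R + 1) ^ 2))
  have hα₀ : 0 < α₀ := by positivity
  refine ⟨Metric.ball A r, Metric.ball_mem_nhds A hr, c, α₀, hα₀, min_le_left _ _,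
    fun B hB => ?_⟩
  have hd : dist A B ≤ r := by rw [dist_comm]; exact (Metric.mem_ball.1 hB).le
  have hBb : B.HasBound c := ha.of_dist_le (hd.trans (min_le_left _ _))
  have hAb : A.HasBound c := ha.of_dist_le (by rw [dist_self]; positivity)
  refine ⟨hBb, fun α hα hαα x v hv => ?_⟩
  have hdn : n * c ^ n * dist A B ≤ δ := by
    have h1 : dist A B ≤ δ / ((n + 1) * c ^ n) := hd.trans (min_le_right _ _)
    rw [le_div_iff₀ (by positivity)] at h1
    have : (0 : ℝ) ≤ c ^ n * dist A B := by positivity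
    linarith
  have h1 : ∫ p, projRate p.2 v ∂(B.law K n x) ≤ -(1 / 2) := by
    have := hAb.integral_projRate_sub_le (K := K) hm hBb n hunif hdn x hv
    have := h x v hv
    linarith
  have hm' : Measurable fun p : S × (Euc m →L[ℝ] Euc m) => projRate p.2 v :=
    (measurable_projRate v).comp measurable_snd
  have hb : ∀ᵐ p ∂(B.law K n x), |projRate p.2 v| ≤ R :=
    (hBb.ae_law n x).mono fun p hp => H _ hcn _ hp v hv
  have hα1 : α * (R + 1) ^ 2 ≤ 1 / 4 := by
    have h2 : α ≤ 1 / (4 * (R + 1) ^ 2) := hαα.trans (min_le_right _ _)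
    rw [le_div_iff₀ (by positivity)] at h2
    linarith
  have hαR : α * R ≤ 1 := by nlinarith
  have h3 := integral_exp_le hm' hb h1 hα hαR
  have hint : Integrable (fun p : S × (Euc m →L[ℝ] Euc m) => Real.exp (α * projRate p.2 v))
      (B.law K n x) := by
    refine Integrable.of_bound (hm'.const_mul α).exp.aestronglyMeasurable (Real.exp 1)
      (hb.mono fun p hp => ?_)
    rw [Real.norm_eq_abs, Real.abs_exp]
    refine Real.exp_le_exp.2 (le_trans ?_ hαR)
    exact mul_le_mul_of_nonneg_left ((le_abs_self _).trans hp) hα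
  rw [← ofReal_integral_eq_lintegral_ofReal hint
    (Eventually.of_forall fun p => (Real.exp_pos _).le)]
  refine ENNReal.ofReal_le_ofReal (h3.trans ?_)
  have h4 : α * R ^ 2 ≤ 1 / 4 := by nlinarith
  nlinarith

end RandCocycle

namespace RandCocycle

variable {S : Type*} [MeasurableSpace S] {m : ℕ} {A : RandCocycle S m} {c : ℝ} {K : Kernel S S}
  [IsMarkovKernel K] {μ : Measure S} [IsProbabilityMeasure μ]

/-! ### Contraction of angles in the mean -/

/-- The mean of `δ(A⁽ⁿ⁾ v, A⁽ⁿ⁾ w)^α` for the chain started from `x`. -/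
def angleMoment (A : RandCocycle S m) (K : Kernel S S) (α : ℝ) (n : ℕ) (x : S) (v w : Euc m) :
    ENNReal :=
  ∫⁻ p, ENNReal.ofReal (sinAngle (p.2 v) (p.2 w) ^ α) ∂(A.law K n x)

theorem measurable_angleMoment_integrand (α : ℝ) (v w : Euc m) :
    Measurable fun p : S × (Euc m →L[ℝ] Euc m) =>
      ENNReal.ofReal (sinAngle (p.2 v) (p.2 w) ^ α) := by
  have h1 : ∀ v : Euc m, Measurable fun p : S × (Euc m →L[ℝ] Euc m) => p.2 v := fun v =>
    measurable_apply_op (by fun_prop) (by fun_prop)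
  exact ((measurable_sinAngle.comp ((h1 v).prodMk (h1 w))).pow_const α).ennreal_ofReal

theorem angleMoment_zero (α : ℝ) (x : S) (v w : Euc m) :
    A.angleMoment K α 0 x v w = ENNReal.ofReal (sinAngle v w ^ α) := by
  rw [angleMoment, law, prodLaw_zero, lintegral_dirac' _ (measurable_angleMoment_integrand α v w)]
  rfl

theorem angleMoment_add (α : ℝ) (n k : ℕ) (x : S) (v w : Euc m) :
    A.angleMoment K α (n + k) x v w =
      ∫⁻ p, A.angleMoment K α k p.1 (p.2 v) (p.2 w) ∂(A.law K n x) := by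
  rw [angleMoment, law,
    lintegral_prodLaw_add A.measurable_op n k x (measurable_angleMoment_integrand α v w)]
  rfl

theorem angleMoment_succ (α : ℝ) (n : ℕ) (x : S) (v w : Euc m) :
    A.angleMoment K α (n + 1) x v w =
      ∫⁻ y, A.angleMoment K α n y (A.op (x, y) v) (A.op (x, y) w) ∂(K x) := by
  rw [angleMoment, law,
    lintegral_prodLaw_succ' A.measurable_op n x (measurable_angleMoment_integrand α v w)]
  rfl

/-- The geometric mean of the expansion rates at the two directions bounds the distortion of their
angle; it is replaced by the arithmetic mean, which involves a single direction at a time. -/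
theorem sinAngle_rpow_le {C : ℝ} (hC : 0 < C) (hm : 2 ≤ m) {M : Euc m →L[ℝ] Euc m}
    (hM : HasDistortion C M) {α : ℝ} (hα : 0 ≤ α) {v w : Euc m} (hv : v ≠ 0) (hw : w ≠ 0) :
    sinAngle (M v) (M w) ^ α ≤
      (Real.exp (α * projRate M v) + Real.exp (α * projRate M w)) / 2 * sinAngle v w ^ α := by
  obtain ⟨R, -, H⟩ := exists_wedgeNorm_bounds (m := m) hm
  have hw2 := (H C hC M hM).1
  have hpos : ∀ u : Euc m, u ≠ 0 → 0 < ‖M u‖ / ‖u‖ := fun u hu =>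
    div_pos (norm_pos_iff.2 (hM.map_ne_zero hu)) (norm_pos_iff.2 hu)
  have h1 := sinAngle_map_le M hv hw
  have e : wedgeNorm 2 M * (‖M v‖ / ‖v‖)⁻¹ * (‖M w‖ / ‖w‖)⁻¹ =
      Real.exp ((projRate M v + projRate M w) / 2) := by
    have : (projRate M v + projRate M w) / 2 = Real.log (wedgeNorm 2 M) +
        -Real.log (‖M v‖ / ‖v‖) + -Real.log (‖M w‖ / ‖w‖) := by
      rw [projRate, projRate]; ring
    rw [this, Real.exp_add, Real.exp_add, Real.exp_neg, Real.exp_neg, Real.exp_log hw2,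
      Real.exp_log (hpos v hv), Real.exp_log (hpos w hw)]
  rw [e] at h1
  calc _ ≤ (Real.exp ((projRate M v + projRate M w) / 2) * sinAngle v w) ^ α :=
        Real.rpow_le_rpow (sinAngle_nonneg _ _) h1 hα
    _ = Real.exp (α * projRate M v / 2) * Real.exp (α * projRate M w / 2) * sinAngle v w ^ α := by
        rw [Real.mul_rpow (Real.exp_pos _).le (sinAngle_nonneg _ _), ← Real.exp_mul,
          ← Real.exp_add]
        congr 2; ring
    _ ≤ _ := by
        have h2 := Real.rpow_nonneg (sinAngle_nonneg v w) α
        gcongr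
        have h3 : ∀ t : ℝ, Real.exp t = Real.exp (t / 2) ^ 2 := fun t => by
          rw [← Real.exp_nat_mul]; congr 1; push_cast; ring
        rw [h3 (α * projRate M v), h3 (α * projRate M w)]
        nlinarith [sq_nonneg (Real.exp (α * projRate M v / 2) - Real.exp (α * projRate M w / 2))]

theorem HasBound.angleMoment_le (hA : A.HasBound c) (hm : 2 ≤ m) {N : ℕ} {α s : ℝ} (hα : 0 ≤ α)
    (h : ∀ x (v : Euc m), v ≠ 0 →
      ∫⁻ p, ENNReal.ofReal (Real.exp (α * projRate p.2 v)) ∂(A.law K N x) ≤ ENNReal.ofReal s)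
    (x : S) {v w : Euc m} (hv : v ≠ 0) (hw : w ≠ 0) :
    A.angleMoment K α N x v w ≤ ENNReal.ofReal s * ENNReal.ofReal (sinAngle v w ^ α) := by
  have hexp : ∀ v : Euc m, Measurable fun p : S × (Euc m →L[ℝ] Euc m) =>
      ENNReal.ofReal (Real.exp (α * projRate p.2 v)) := fun v =>
    (((measurable_projRate v).comp measurable_snd).const_mul α).exp.ennreal_ofReal
  calc A.angleMoment K α N x v w
      ≤ ∫⁻ p, 2⁻¹ * (ENNReal.ofReal (Real.exp (α * projRate p.2 v)) +
          ENNReal.ofReal (Real.exp (α * projRate p.2 w))) * ENNReal.ofReal (sinAngle v w ^ α)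
          ∂(A.law K N x) := by
        refine lintegral_mono_ae ?_
        filter_upwards [hA.ae_law N x] with p hp
        refine (ENNReal.ofReal_le_ofReal
          (sinAngle_rpow_le (pow_pos hA.pos N) hm hp hα hv hw)).trans_eq ?_
        rw [ENNReal.ofReal_mul (by positivity), div_eq_inv_mul, ENNReal.ofReal_mul (by positivity),
          ENNReal.ofReal_add (by positivity) (by positivity), ENNReal.ofReal_inv_of_pos two_pos]
        simp
    _ = 2⁻¹ * (∫⁻ p, ENNReal.ofReal (Real.exp (α * projRate p.2 v)) ∂(A.law K N x) +
          ∫⁻ p, ENNReal.ofReal (Real.exp (α * projRate p.2 w)) ∂(A.law K N x)) *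
          ENNReal.ofReal (sinAngle v w ^ α) := by
        have h1 : Measurable fun p : S × (Euc m →L[ℝ] Euc m) =>
            ENNReal.ofReal (Real.exp (α * projRate p.2 v)) +
            ENNReal.ofReal (Real.exp (α * projRate p.2 w)) := (hexp v).add (hexp w)
        rw [lintegral_mul_const _ (h1.const_mul _), lintegral_const_mul _ h1,
          lintegral_add_left (hexp v)]
    _ ≤ 2⁻¹ * (ENNReal.ofReal s + ENNReal.ofReal s) * ENNReal.ofReal (sinAngle v w ^ α) := by
        gcongr
        · exact h x v hv
        · exact h x w hw
    _ = _ := by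
        rw [← two_mul, ← mul_assoc, ENNReal.inv_mul_cancel two_ne_zero ENNReal.ofNat_ne_top,
          one_mul]

theorem HasBound.angleMoment_mul_le (hA : A.HasBound c) {N : ℕ} {α : ℝ} {s : ENNReal}
    (h : ∀ x (v w : Euc m), v ≠ 0 → w ≠ 0 →
      A.angleMoment K α N x v w ≤ s * ENNReal.ofReal (sinAngle v w ^ α))
    (q : ℕ) (x : S) {v w : Euc m} (hv : v ≠ 0) (hw : w ≠ 0) :
    A.angleMoment K α (N * q) x v w ≤ s ^ q * ENNReal.ofReal (sinAngle v w ^ α) := by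
  induction q with
  | zero => simp [angleMoment_zero]
  | succ q ih =>
    rw [mul_add, mul_one, angleMoment_add]
    calc _ ≤ ∫⁻ p, s * ENNReal.ofReal (sinAngle (p.2 v) (p.2 w) ^ α) ∂(A.law K (N * q) x) := by
          refine lintegral_mono_ae ?_
          filter_upwards [hA.ae_law (N * q) x] with p hp
          exact h p.1 _ _ (hp.map_ne_zero hv) (hp.map_ne_zero hw)
      _ = s * A.angleMoment K α (N * q) x v w :=
          lintegral_const_mul _ (measurable_angleMoment_integrand α v w)
      _ ≤ s * (s ^ q * ENNReal.ofReal (sinAngle v w ^ α)) := by gcongr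
      _ = _ := by rw [pow_succ]; ring

theorem exists_sinAngle_rpow_le (hm : 2 ≤ m) (C : ℝ) (hC : 1 ≤ C) :
    ∃ L : ℝ, 1 ≤ L ∧ ∀ M : Euc m →L[ℝ] Euc m, HasDistortion C M → ∀ α : ℝ, 0 ≤ α → α ≤ 1 →
      ∀ v w : Euc m, v ≠ 0 → w ≠ 0 → sinAngle (M v) (M w) ^ α ≤ L * sinAngle v w ^ α := by
  obtain ⟨R, hR, H⟩ := exists_abs_projRate_le (m := m) hm
  have hC0 : 0 < C := by linarith
  set r := Real.log R + 4 * Real.log C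
  have hr : 0 ≤ r := by
    have h1 := Real.log_nonneg hR
    have h2 := Real.log_nonneg hC
    positivity
  refine ⟨Real.exp r, Real.one_le_exp hr, fun M hM α hα hα1 v w hv hw => ?_⟩
  refine (sinAngle_rpow_le hC0 hm hM hα hv hw).trans ?_
  have h1 : ∀ u : Euc m, u ≠ 0 → Real.exp (α * projRate M u) ≤ Real.exp r := by
    intro u hu
    refine Real.exp_le_exp.2 ?_
    have h2 := (le_abs_self _).trans (H C hC0 M hM u hu)
    nlinarith
  have h2 := Real.rpow_nonneg (sinAngle_nonneg v w) α
  gcongr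
  linarith [h1 v hv, h1 w hw]

/-- Geometric decay of the moments of the angle, with a constant which depends only on the bounds
of the cocycle. -/
theorem exists_angleMoment_le (hm : 2 ≤ m) (c : ℝ) (hc : 1 ≤ c) {N : ℕ} (hN : 1 ≤ N) :
    ∃ L : ℝ, 1 ≤ L ∧ ∀ (A : RandCocycle S m), A.HasBound c → ∀ α s : ℝ, 0 ≤ α → α ≤ 1 → 0 ≤ s →
      (∀ x (v : Euc m), v ≠ 0 → ∫⁻ p, ENNReal.ofReal (Real.exp (α * projRate p.2 v))
        ∂(A.law K N x) ≤ ENNReal.ofReal s) →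
      ∀ n x (v w : Euc m), v ≠ 0 → w ≠ 0 →
        A.angleMoment K α n x v w ≤ ENNReal.ofReal (L * s ^ (n / N) * sinAngle v w ^ α) := by
  have hc0 : 0 < c := by linarith
  obtain ⟨L, hL, H⟩ := exists_sinAngle_rpow_le (m := m) hm (c ^ N) (one_le_pow₀ hc)
  refine ⟨L, hL, fun A hA α s hα hα1 hs h n x v w hv hw => ?_⟩
  have h1 := hA.angleMoment_mul_le (K := K)
    (fun x v w hv hw => hA.angleMoment_le hm hα h x hv hw) (n / N) x hv hw
  have hr : c ^ (n % N) ≤ c ^ N := pow_le_pow_right₀ hc (Nat.mod_lt n hN).le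
  rw [← Nat.div_add_mod n N, angleMoment_add, Nat.div_add_mod]
  calc _ ≤ ∫⁻ p, ENNReal.ofReal L * ENNReal.ofReal (sinAngle (p.2 v) (p.2 w) ^ α)
        ∂(A.law K (N * (n / N)) x) := by
        refine lintegral_mono_ae ?_
        filter_upwards [hA.ae_law (N * (n / N)) x] with p hp
        calc _ ≤ ∫⁻ _, ENNReal.ofReal L * ENNReal.ofReal (sinAngle (p.2 v) (p.2 w) ^ α)
              ∂(A.law K (n % N) p.1) := by
              refine lintegral_mono_ae ?_
              filter_upwards [hA.ae_law (n % N) p.1] with q hq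
              rw [← ENNReal.ofReal_mul (by linarith)]
              exact ENNReal.ofReal_le_ofReal (H q.2 (hq.mono hr) α hα hα1 _ _
                (hp.map_ne_zero hv) (hp.map_ne_zero hw))
          _ = _ := by simp
    _ = ENNReal.ofReal L * A.angleMoment K α (N * (n / N)) x v w :=
        lintegral_const_mul _ (measurable_angleMoment_integrand α v w)
    _ ≤ ENNReal.ofReal L * (ENNReal.ofReal s ^ (n / N) * ENNReal.ofReal (sinAngle v w ^ α)) := by
        gcongr
    _ = _ := by
        rw [ENNReal.ofReal_mul (by positivity), ENNReal.ofReal_mul (by linarith),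
          ENNReal.ofReal_pow hs, mul_assoc]

end RandCocycle

/-! ### Hölder functions and the Markov operator -/

section Holder

variable {S : Type*} [MeasurableSpace S] {m : ℕ}

/-- Explicit bounds `R` for the sup norm and `H` for the Hölder seminorm of a function in `H_α`. -/
structure IsHolder (α R H : ℝ) (f : S × S × Proj m → ℂ) : Prop where
  measurable : Measurable f
  bound : ∀ w, ‖f w‖ ≤ R
  holder : ∀ x y p q, ‖f (x, y, p) - f (x, y, q)‖ ≤ H * projDist p q ^ α
  indep : ∀ x x' y p, f (x, y, p) = f (x', y, p)

theorem projDist_self (p : Proj m) : projDist p p = 0 := by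
  by_contra h
  have h1 := dist_lineProj p p
  rw [dist_self] at h1
  have : 0 < projDist p p := lt_of_le_of_ne (projDist_nonneg p p) (Ne.symm h)
  have : 0 < √2 * projDist p p := by positivity
  linarith

theorem supNorm_nonneg {Y : Type*} (f : Y → ℂ) : 0 ≤ supNorm f :=
  Real.iSup_nonneg fun _ => norm_nonneg _

theorem holderSeminorm_nonneg (α : ℝ) (f : S × S × Proj m → ℂ) : 0 ≤ holderSeminorm α f := by
  refine Real.sSup_nonneg ?_
  rintro r ⟨x, y, p, q, -, rfl⟩
  exact div_nonneg (norm_nonneg _) (Real.rpow_nonneg (projDist_nonneg p q) α)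

theorem MemHolder.isHolder {α : ℝ} (hα : 0 < α) {f : S × S × Proj m → ℂ} (hf : MemHolder α f) :
    IsHolder α (supNorm f) (holderSeminorm α f) f := by
  refine ⟨hf.1, fun w => le_ciSup hf.2.1 w, fun x y p q => ?_, hf.2.2.2⟩
  by_cases hpq : p = q
  · rw [hpq, sub_self, norm_zero, projDist_self, Real.zero_rpow hα.ne', mul_zero]
  · have h1 := Real.rpow_pos_of_pos (projDist_pos hpq) α
    rw [← div_le_iff₀ h1]
    exact le_csSup hf.2.2.1 ⟨x, y, p, q, hpq, rfl⟩

theorem IsHolder.le_of_mem_holderQuotients {α R H : ℝ} {f : S × S × Proj m → ℂ}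
    (hf : IsHolder α R H f) {r : ℝ} (hr : r ∈ holderQuotients α f) : r ≤ H := by
  obtain ⟨x, y, p, q, hpq, rfl⟩ := hr
  rw [div_le_iff₀ (Real.rpow_pos_of_pos (projDist_pos hpq) α)]
  exact hf.holder x y p q

theorem IsHolder.memHolder {α R H : ℝ} {f : S × S × Proj m → ℂ} (hf : IsHolder α R H f) :
    MemHolder α f := by
  refine ⟨hf.measurable, ⟨R, ?_⟩, ⟨H, fun r hr => hf.le_of_mem_holderQuotients hr⟩, hf.indep⟩
  rintro _ ⟨w, rfl⟩
  exact hf.bound w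

theorem IsHolder.holderNorm_le {α R H : ℝ} (hR : 0 ≤ R) (hH : 0 ≤ H) {f : S × S × Proj m → ℂ}
    (hf : IsHolder α R H f) : holderNorm α f ≤ H + R :=
  add_le_add (Real.sSup_le (fun _ hr => hf.le_of_mem_holderQuotients hr) hH)
    (Real.iSup_le hf.bound hR)

theorem IsHolder.sub_const {α R H R' : ℝ} {f : S × S × Proj m → ℂ} (hf : IsHolder α R H f) (a : ℂ)
    (hb : ∀ w, ‖f w - a‖ ≤ R') : IsHolder α R' H fun w => f w - a :=
  ⟨hf.measurable.sub_const a, hb, fun x y p q => by simpa using hf.holder x y p q,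
    fun x x' y p => by rw [hf.indep x x' y p]⟩

end Holder

namespace RandCocycle

variable {S : Type*} [MeasurableSpace S] {m : ℕ} {A : RandCocycle S m} {c : ℝ} {K : Kernel S S}
  [IsMarkovKernel K] {μ : Measure S} [IsProbabilityMeasure μ]

theorem measurable_markovOp {f : S × S × Proj m → ℂ} (hf : Measurable f) :
    Measurable (A.markovOp K f) :=
  (StronglyMeasurable.integral_kernel_prod_right'
    (κ := K.comap (fun w : S × S × Proj m => w.2.1) (by fun_prop))
    (hf.comp A.measurable_step).stronglyMeasurable).measurable

theorem norm_markovOp_le {f : S × S × Proj m → ℂ} {R : ℝ} (hf : ∀ w, ‖f w‖ ≤ R)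
    (w : S × S × Proj m) : ‖A.markovOp K f w‖ ≤ R := by
  have := norm_integral_le_of_norm_le_const (μ := K w.2.1)
    (f := fun z => f (w.2.1, z, projAct (A.toFun w.2.1 z) w.2.2)) (C := R)
    (Eventually.of_forall fun z => hf _)
  simpa [markovOp] using this

theorem integrable_markovOp {f : S × S × Proj m → ℂ} (hf : Measurable f) {R : ℝ}
    (hb : ∀ w, ‖f w‖ ≤ R) (y : S) (p : Proj m) :
    Integrable (fun z => f (y, z, projAct (A.toFun y z) p)) (K y) := by
  refine Integrable.of_bound (Measurable.aestronglyMeasurable ?_) R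
    (Eventually.of_forall fun z => hb _)
  exact hf.comp (A.measurable_step.comp (f := fun z => ((y, y, p), z)) (by fun_prop))

theorem measurable_iterate_markovOp {f : S × S × Proj m → ℂ} (hf : Measurable f) (n : ℕ) :
    Measurable ((A.markovOp K)^[n] f) := by
  induction n with
  | zero => exact hf
  | succ n ih => rw [Function.iterate_succ_apply']; exact measurable_markovOp ih

theorem norm_iterate_markovOp_le {f : S × S × Proj m → ℂ} {R : ℝ} (hf : ∀ w, ‖f w‖ ≤ R) (n : ℕ)
    (w : S × S × Proj m) : ‖(A.markovOp K)^[n] f w‖ ≤ R := by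
  induction n generalizing w with
  | zero => exact hf w
  | succ n ih => rw [Function.iterate_succ_apply']; exact norm_markovOp_le ih w

theorem projAct_mk (x y : S) {v : Euc m} (hv : v ≠ 0) (hv' : A.op (x, y) v ≠ 0) :
    projAct (A.toFun x y) (Projectivization.mk ℝ v hv) =
      Projectivization.mk ℝ (A.op (x, y) v) hv' := rfl

/-- Two chains driven by the same base trajectory are compared through the angle of their fibre
components. The first coordinates may differ, since `f` does not see them. -/
theorem HasBound.enorm_iterate_markovOp_sub_le (hA : A.HasBound c) {α R H : ℝ} (hH : 0 ≤ H)
    {f : S × S × Proj m → ℂ} (hf : IsHolder α R H f) (n : ℕ) (x x' y : S) {v w : Euc m}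
    (hv : v ≠ 0) (hw : w ≠ 0) :
    ‖(A.markovOp K)^[n] f (x, y, Projectivization.mk ℝ v hv) -
      (A.markovOp K)^[n] f (x', y, Projectivization.mk ℝ w hw)‖ₑ ≤
      ENNReal.ofReal H * A.angleMoment K α n y v w := by
  induction n generalizing x x' y v w with
  | zero =>
    rw [angleMoment_zero, Function.iterate_zero, id, hf.indep x' x, ← ENNReal.ofReal_mul hH,
      ← ofReal_norm, ← projDist_mk hv hw]
    exact ENNReal.ofReal_le_ofReal (hf.holder _ _ _ _)
  | succ n ih =>
    rw [Function.iterate_succ_apply', angleMoment_succ,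
      ← lintegral_const_mul' _ _ ENNReal.ofReal_ne_top]
    set g := (A.markovOp K)^[n] f
    have hgm : Measurable g := measurable_iterate_markovOp hf.measurable n
    have hgb : ∀ w, ‖g w‖ ≤ R := norm_iterate_markovOp_le hf.bound n
    simp only [markovOp]
    rw [← integral_sub (integrable_markovOp hgm hgb y _) (integrable_markovOp hgm hgb y _)]
    refine (enorm_integral_le_lintegral_enorm _).trans (lintegral_mono fun z => ?_)
    exact ih y y z ((hA.2 (y, z)).map_ne_zero hv) ((hA.2 (y, z)).map_ne_zero hw)

theorem HasBound.isHolder_iterate_markovOp (hA : A.HasBound c) {α R H : ℝ} (hH : 0 ≤ H)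
    {f : S × S × Proj m → ℂ} (hf : IsHolder α R H f) {n : ℕ} {L : ℝ} (hL : 0 ≤ L)
    (h : ∀ x (v w : Euc m), v ≠ 0 → w ≠ 0 →
      A.angleMoment K α n x v w ≤ ENNReal.ofReal (L * sinAngle v w ^ α)) :
    IsHolder α R (L * H) ((A.markovOp K)^[n] f) := by
  refine ⟨measurable_iterate_markovOp hf.measurable n, norm_iterate_markovOp_le hf.bound n,
    fun x y p q => ?_, fun x x' y p => ?_⟩
  · induction p using Projectivization.ind with | h v hv
    induction q using Projectivization.ind with | h w hw
    have h1 := hA.enorm_iterate_markovOp_sub_le (K := K) hH hf n x x y hv hw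
    have h2 := h1.trans (mul_le_mul_right (h y v w hv hw) (ENNReal.ofReal H))
    have h3 := Real.rpow_nonneg (sinAngle_nonneg v w) α
    rw [← ENNReal.ofReal_mul hH, ← ofReal_norm,
      ENNReal.ofReal_le_ofReal_iff (by positivity)] at h2
    rw [projDist_mk]
    linarith
  · cases n with
    | zero => exact hf.indep x x' y p
    | succ n => rw [Function.iterate_succ_apply']; rfl

/-- Iterates of a function which is close to a function `h` of the base point are close to the
iterates of `h` under the base kernel. -/
theorem norm_iterate_markovOp_sub_integral_le {f : S × S × Proj m → ℂ} (hf : Measurable f) {R : ℝ}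
    (hb : ∀ w, ‖f w‖ ≤ R) {h : S → ℂ} (hh : Measurable h) (hhR : ∀ y, ‖h y‖ ≤ R) {ε : ℝ}
    (hε : ∀ x y p, ‖f (x, y, p) - h y‖ ≤ ε) (n : ℕ) (x y : S) (p : Proj m) :
    ‖(A.markovOp K)^[n] f (x, y, p) - ∫ z, h z ∂((K ^ n) y)‖ ≤ ε := by
  induction n generalizing x y p with
  | zero =>
    have : (K ^ 0) y = Measure.dirac y := by rw [pow_zero]; exact Kernel.id_apply y
    rw [this, integral_dirac' _ _ hh.stronglyMeasurable]
    exact hε x y p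
  | succ n ih =>
    have := isMarkovKernel_pow K n
    have e : (K ^ (n + 1)) y = ((K ^ n) ∘ₖ K) y := by
      rw [pow_succ]; rfl
    have hi : Integrable h (((K ^ n) ∘ₖ K) y) := by
      rw [← e]
      have := isMarkovKernel_pow K (n + 1)
      exact Integrable.of_bound hh.aestronglyMeasurable R (Eventually.of_forall hhR)
    rw [e, Kernel.integral_comp hi,
      Function.iterate_succ_apply', markovOp]
    rw [← integral_sub (integrable_markovOp (measurable_iterate_markovOp hf n)
      (norm_iterate_markovOp_le hb n) y p)]
    · have := norm_integral_le_of_norm_le_const (μ := K y) (C := ε)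
        (f := fun z => (A.markovOp K)^[n] f (y, z, projAct (A.toFun y z) p) -
          ∫ z', h z' ∂((K ^ n) z)) (Eventually.of_forall fun z => ih y z _)
      simpa using this
    · refine Integrable.of_bound hh.stronglyMeasurable.integral_kernel.aestronglyMeasurable R
        (Eventually.of_forall fun z => ?_)
      have := norm_integral_le_of_norm_le_const (μ := (K ^ n) z) (f := h) (C := R)
        (Eventually.of_forall hhR)
      simpa using this

theorem exists_pow_div_le {N : ℕ} (hN : 1 ≤ N) {s : ℝ} (hs0 : 0 < s) (hs1 : s < 1) :
    ∃ σ : ℝ, 0 < σ ∧ σ < 1 ∧ ∀ n : ℕ, s ^ (n / N) ≤ s⁻¹ * σ ^ n := by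
  have hN0 : (0 : ℝ) < N := by exact_mod_cast hN
  refine ⟨s ^ (1 / (N : ℝ)), by positivity, Real.rpow_lt_one hs0.le hs1 (by positivity),
    fun n => ?_⟩
  have e : (s ^ (1 / (N : ℝ))) ^ N = s := by
    rw [← Real.rpow_natCast, ← Real.rpow_mul hs0.le, one_div_mul_cancel hN0.ne', Real.rpow_one]
  have h1 : s ^ (n / N + 1) ≤ (s ^ (1 / (N : ℝ))) ^ n := by
    conv_lhs => rw [← e]
    rw [← pow_mul]
    exact pow_le_pow_of_le_one (by positivity) (Real.rpow_le_one hs0.le hs1.le (by positivity))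
      (by have := Nat.lt_mul_div_succ n (by omega : 0 < N); omega)
  rw [le_inv_mul_iff₀ hs0, ← pow_succ']
  exact h1

/-- Iterates of Hölder functions converge to constants exponentially fast: the contraction of
angles flattens them in the fibre, and mixing flattens them in the base. -/
theorem exists_markovOp_contraction (hm : 2 ≤ m) (hK : IsStronglyMixing K μ) {c : ℝ} (hc : 1 ≤ c)
    {N : ℕ} (hN : 1 ≤ N) {s : ℝ} (hs0 : 0 < s) (hs1 : s < 1) :
    ∃ C σ : ℝ, 0 < C ∧ 0 < σ ∧ σ < 1 ∧ ∀ A : RandCocycle S m, A.HasBound c → ∀ α : ℝ, 0 ≤ α →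
      α ≤ 1 → (∀ x (v : Euc m), v ≠ 0 → ∫⁻ p, ENNReal.ofReal (Real.exp (α * projRate p.2 v))
        ∂(A.law K N x) ≤ ENNReal.ofReal s) →
      ∀ (f : S × S × Proj m → ℂ) (R H : ℝ), 0 ≤ H → IsHolder α R H f → ∀ n : ℕ,
        IsHolder α R (C * σ ^ n * H) ((A.markovOp K)^[n] f) ∧
        ∃ a : ℂ, ∀ w, ‖(A.markovOp K)^[n] f w - a‖ ≤ C * σ ^ n * (H + R) := by
  obtain ⟨L, hL, hmom⟩ := exists_angleMoment_le (S := S) (K := K) hm c hc hN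
  obtain ⟨D, ρ, hD, hρ0, hρ1, hmix⟩ := hK
  obtain ⟨σ₁, h10, h11, hσ₁⟩ := exists_pow_div_le hN hs0 hs1
  obtain ⟨σ₂, h20, h21, hσ₂⟩ := exists_pow_div_le (by omega : 1 ≤ 2 * N) hs0 hs1
  obtain ⟨σ₃, h30, h31, hσ₃⟩ := exists_pow_div_le one_le_two hρ0 hρ1
  set σ := max σ₁ (max σ₂ σ₃)
  have hσ0 : 0 < σ := lt_max_of_lt_left h10
  have hpow : ∀ n : ℕ, σ₁ ^ n ≤ σ ^ n ∧ σ₂ ^ n ≤ σ ^ n ∧ σ₃ ^ n ≤ σ ^ n := fun n =>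
    ⟨pow_le_pow_left₀ h10.le (le_max_left _ _) n,
      pow_le_pow_left₀ h20.le ((le_max_left _ _).trans (le_max_right _ _)) n,
      pow_le_pow_left₀ h30.le ((le_max_right _ _).trans (le_max_right _ _)) n⟩
  set C := L * s⁻¹ + D * ρ⁻¹
  have hLs : 0 < L * s⁻¹ := by positivity
  have hDρ : 0 < D * ρ⁻¹ := by positivity
  refine ⟨C, σ, by positivity, hσ0, max_lt h11 (max_lt h21 h31),
    fun A hA α hα hα1 h f R H hH hf n => ?_⟩
  have hhol : ∀ k, IsHolder α R (L * s ^ (k / N) * H) ((A.markovOp K)^[k] f) := fun k =>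
    hA.isHolder_iterate_markovOp hH hf (by positivity) fun x v w hv hw =>
      hmom A hA α s hα hα1 hs0.le h k x v w hv hw
  constructor
  · refine ⟨(hhol n).measurable, (hhol n).bound, fun x y p q => ?_, (hhol n).indep⟩
    refine ((hhol n).holder x y p q).trans ?_
    have h1 := Real.rpow_nonneg (projDist_nonneg p q) α
    have h2 : L * s ^ (n / N) ≤ C * σ ^ n := by
      calc _ ≤ L * (s⁻¹ * σ ^ n) := by
            gcongr
            exact (hσ₁ n).trans (mul_le_mul_of_nonneg_left (hpow n).1 (by positivity))
        _ = L * s⁻¹ * σ ^ n := by ring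
        _ ≤ _ := by gcongr; simp only [C]; linarith
    gcongr
  · rcases isEmpty_or_nonempty (S × S × Proj m) with he | ⟨⟨x₀, y₀, p₀⟩⟩
    · exact ⟨0, fun w => he.elim w⟩
    have hR : 0 ≤ R := (norm_nonneg _).trans (hf.bound (x₀, y₀, p₀))
    -- the first half of the time flattens `f` in the fibre, the second half in the base
    set k := n / 2
    set g := (A.markovOp K)^[k] f
    set h' : S → ℂ := fun y => g (x₀, y, p₀)
    have hh' : Measurable h' := (hhol k).measurable.comp (by fun_prop)
    have hh'R : ∀ y, ‖h' y‖ ≤ R := fun y => (hhol k).bound _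
    refine ⟨∫ y, h' y ∂μ, ?_⟩
    rintro ⟨x, y, p⟩
    have e : (A.markovOp K)^[n] f = (A.markovOp K)^[n - k] g := by
      rw [← Function.iterate_add_apply]
      congr 2
      omega
    have h1 := norm_iterate_markovOp_sub_integral_le (A := A) (K := K) (hhol k).measurable
      (hhol k).bound hh' hh'R (ε := L * s ^ (k / N) * H) (fun x y p => by
        change ‖(A.markovOp K)^[k] f (x, y, p) - (A.markovOp K)^[k] f (x₀, y, p₀)‖ ≤ _
        rw [(hhol k).indep x₀ x y p₀]
        refine ((hhol k).holder x y p p₀).trans (mul_le_of_le_one_right (by positivity) ?_)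
        exact Real.rpow_le_one (projDist_nonneg _ _) (projDist_le_one _ _) hα) (n - k) x y p
    have h2 := hmix h' hh' ⟨R, by rintro _ ⟨y, rfl⟩; exact hh'R y⟩ y (n - k)
    have h3 : supNorm h' ≤ R := Real.iSup_le hh'R hR
    have h4 : L * s ^ (k / N) * H ≤ L * s⁻¹ * σ ^ n * H := by
      rw [Nat.div_div_eq_div_mul]
      have := (hσ₂ n).trans (mul_le_mul_of_nonneg_left (hpow n).2.1 (by positivity))
      calc _ ≤ L * (s⁻¹ * σ ^ n) * H := by gcongr
        _ = _ := by ring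
    have h5 : D * ρ ^ (n - k) * supNorm h' ≤ D * ρ⁻¹ * σ ^ n * R := by
      have h6 : ρ ^ (n - k) ≤ ρ ^ (n / 2) :=
        pow_le_pow_of_le_one hρ0.le hρ1.le (by omega)
      have h7 := (h6.trans (hσ₃ n)).trans
        (mul_le_mul_of_nonneg_left (hpow n).2.2 (by positivity))
      calc _ ≤ D * (ρ⁻¹ * σ ^ n) * R :=
            mul_le_mul (mul_le_mul_of_nonneg_left h7 hD.le) h3 (supNorm_nonneg _) (by positivity)
        _ = _ := by ring
    rw [e]
    refine (norm_sub_le_norm_sub_add_norm_sub _ (∫ z, h' z ∂((K ^ (n - k)) y)) _).trans ?_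
    have h8 : 0 ≤ σ ^ n * R := by positivity
    have h9 : 0 ≤ σ ^ n * H := by positivity
    have h10 : C * σ ^ n * (H + R) = L * s⁻¹ * σ ^ n * H + D * ρ⁻¹ * σ ^ n * R +
        (L * s⁻¹ * (σ ^ n * R) + D * ρ⁻¹ * (σ ^ n * H)) := by simp only [C]; ring
    have h11 : 0 ≤ L * s⁻¹ * (σ ^ n * R) + D * ρ⁻¹ * (σ ^ n * H) := by positivity
    linarith

end RandCocycle

/-! ### Test functions on the projective space -/

section Test

variable {m : ℕ}

/-- A finite measure on projective space is determined by the integrals of functions which are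
Lipschitz for the projective distance. -/
theorem measure_proj_ext {ν₁ ν₂ : Measure (Proj m)} [IsFiniteMeasure ν₁] [IsFiniteMeasure ν₂]
    (h : ∀ (φ : Proj m → ℝ) (H : ℝ), 0 ≤ H → Continuous φ → (∀ p, 0 ≤ φ p) → (∀ p, φ p ≤ 1) →
      (∀ p q, |φ p - φ q| ≤ H * projDist p q) → ∫ p, φ p ∂ν₁ = ∫ p, φ p ∂ν₂) : ν₁ = ν₂ := by
  have hme := (isClosedEmbedding_lineProj (m := m)).measurableEmbedding
  have hcl : ∀ F : Set (EuclideanSpace ℝ (Fin m × Fin m)), IsClosed F →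
      ν₁.map lineProj F = ν₂.map lineProj F := by
    intro F hF
    have hδ : ∀ n : ℕ, (0 : ℝ) < 1 / ((n : ℝ) + 1) := fun n => by positivity
    have hlim : Tendsto (fun n : ℕ => 1 / ((n : ℝ) + 1)) atTop (𝓝 0) :=
      tendsto_one_div_add_atTop_nhds_zero_nat
    have h1 := tendsto_lintegral_thickenedIndicator_of_isClosed (ν₁.map lineProj) hF hδ hlim
    have h2 := tendsto_lintegral_thickenedIndicator_of_isClosed (ν₂.map lineProj) hF hδ hlim
    refine tendsto_nhds_unique h1 (h2.congr fun n => ?_)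
    set ψ := thickenedIndicator (hδ n) F
    have hψ : Continuous fun p : Proj m => (ψ (lineProj p) : ℝ) :=
      NNReal.continuous_coe.comp (ψ.continuous.comp continuous_lineProj)
    have key := h (fun p => (ψ (lineProj p) : ℝ)) ((1 / ((n : ℝ) + 1)).toNNReal⁻¹ * √2)
      (by positivity) hψ (fun p => NNReal.coe_nonneg _)
      (fun p => NNReal.coe_le_one.2 (thickenedIndicator_le_one (hδ n) F _)) (fun p q => by
        have h3 := (lipschitzWith_thickenedIndicator (hδ n) F).dist_le_mul (lineProj p) (lineProj q)
        rw [dist_lineProj, ← mul_assoc] at h3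
        rw [NNReal.dist_eq] at h3
        exact h3)
    have hl : ∀ ν : Measure (Proj m), IsFiniteMeasure ν →
        ∫⁻ x, (ψ x : ENNReal) ∂(ν.map lineProj) =
          ENNReal.ofReal (∫ p, (ψ (lineProj p) : ℝ) ∂ν) := by
      intro ν hν
      rw [hme.lintegral_map, ofReal_integral_eq_lintegral_ofReal]
      · simp
      · refine Integrable.of_bound hψ.measurable.aestronglyMeasurable 1
          (Eventually.of_forall fun p => ?_)
        rw [Real.norm_eq_abs, abs_of_nonneg (NNReal.coe_nonneg _)]
        exact NNReal.coe_le_one.2 (thickenedIndicator_le_one (hδ n) F _)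
      · exact Eventually.of_forall fun p => NNReal.coe_nonneg _
    rw [hl ν₂ inferInstance, hl ν₁ inferInstance, key]
  have hmap : ν₁.map lineProj = ν₂.map lineProj := by
    refine ext_of_generate_finite {s | IsClosed s} ?_ isPiSystem_isClosed (fun F hF => hcl F hF)
      (hcl _ isClosed_univ)
    rw [BorelSpace.measurable_eq (α := EuclideanSpace ℝ (Fin m × Fin m)),
      borel_eq_generateFrom_isClosed]
  rw [← hme.comap_map ν₁, hmap, hme.comap_map]

/-- Partitions of unity of projective space subordinate to balls of a given radius. -/
theorem exists_partition_of_unity_proj {r : ℝ} (hr : 0 < r) :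
    ∃ (t : Finset (Proj m)) (χ : Proj m → Proj m → ℝ), (∀ i, Continuous (χ i)) ∧
      (∀ i p, 0 ≤ χ i p) ∧ (∀ i ∈ t, ∀ p, χ i p ≤ 1) ∧ (∀ p, ∑ i ∈ t, χ i p = 1) ∧
      ∀ i p, χ i p ≠ 0 → projDist p i ≤ r := by
  have hdc : ∀ i : Proj m, Continuous fun p => projDist p i := fun i =>
    Continuous.comp (g := fun z : Proj m × Proj m => projDist z.1 z.2) (f := fun p => (p, i))
      continuous_projDist (by fun_prop)
  obtain ⟨t, ht⟩ := CompactSpace.elim_nhds_subcover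
    (fun i : Proj m => (fun p => projDist p i) ⁻¹' Set.Iio r) (fun i =>
      (hdc i).continuousAt.preimage_mem_nhds (Iio_mem_nhds (by rwa [projDist_self])))
  set θ : Proj m → Proj m → ℝ := fun i p => max 0 (r - projDist p i)
  have hθ0 : ∀ i p, 0 ≤ θ i p := fun i p => le_max_left _ _
  have hθc : ∀ i, Continuous (θ i) := fun i => continuous_const.max (continuous_const.sub (hdc i))
  have hpos : ∀ p, 0 < ∑ i ∈ t, θ i p := by
    intro p
    obtain ⟨i, hi, hp⟩ : ∃ i ∈ t, projDist p i < r := by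
      have hp : p ∈ ⋃ i ∈ t, (fun p => projDist p i) ⁻¹' Set.Iio r := by rw [ht]; trivial
      simpa using hp
    exact Finset.sum_pos' (fun i _ => hθ0 i p) ⟨i, hi, lt_max_of_lt_right (by linarith)⟩
  refine ⟨t, fun i p => θ i p / ∑ j ∈ t, θ j p, fun i => ?_, fun i p => ?_, fun i hi p => ?_,
    fun p => ?_, fun i p hp => ?_⟩
  · exact (hθc i).div (continuous_finsetSum _ fun j _ => hθc j) fun p => (hpos p).ne'
  · exact div_nonneg (hθ0 i p) (hpos p).le
  · rw [div_le_one (hpos p)]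
    exact Finset.single_le_sum (fun j _ => hθ0 j p) hi
  · rw [← Finset.sum_div, div_self (hpos p).ne']
  · by_contra hlt
    push Not at hlt
    refine hp ?_
    simp only [θ]
    rw [max_eq_left (by linarith), zero_div]

theorem tendsto_of_approx {ι : Type*} {F : Filter ι} {a : ι → ℂ} {b : ℂ}
    (h : ∀ ε > 0, ∃ (a' : ι → ℂ) (b' : ℂ), Tendsto a' F (𝓝 b') ∧ (∀ i, ‖a i - a' i‖ ≤ ε) ∧
      ‖b - b'‖ ≤ ε) : Tendsto a F (𝓝 b) := by
  rw [Metric.tendsto_nhds]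
  intro ε hε
  obtain ⟨a', b', ht, ha, hb⟩ := h (ε / 4) (by positivity)
  filter_upwards [Metric.tendsto_nhds.1 ht (ε / 4) (by positivity)] with i hi
  rw [dist_eq_norm] at hi ⊢
  have e : a i - b = (a i - a' i) + (a' i - b') - (b - b') := by ring
  rw [e]
  have h1 := norm_sub_le ((a i - a' i) + (a' i - b')) (b - b')
  have h2 := norm_add_le (a i - a' i) (a' i - b')
  have := ha i
  linarith

end Test

section Limit

variable {S : Type*} [MetricSpace S] [CompactSpace S] [MeasurableSpace S] [BorelSpace S] {m : ℕ}
  {μ : Measure S} [IsProbabilityMeasure μ]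

/-- If all the measures have the same marginal on the base, weak convergence tests functions which
are merely measurable in the base variable. -/
theorem tendsto_integral_mul {ι : Type*} {F : Filter ι}
    {P : ι → ProbabilityMeasure (S × S × Proj m)} {ν : ProbabilityMeasure (S × S × Proj m)}
    (ht : Tendsto P F (𝓝 ν))
    (hP : ∀ i, (P i : Measure (S × S × Proj m)).map (fun w => w.2.1) = μ)
    (hν : (ν : Measure (S × S × Proj m)).map (fun w => w.2.1) = μ) {h : S → ℂ} (hh : Measurable h)
    {R : ℝ} (hR : ∀ y, ‖h y‖ ≤ R) {χ : Proj m → ℝ} (hχ : Continuous χ) (hχ0 : ∀ p, 0 ≤ χ p)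
    (hχ1 : ∀ p, χ p ≤ 1) :
    Tendsto (fun i => ∫ w, h w.2.1 * χ w.2.2 ∂(P i : Measure (S × S × Proj m))) F
      (𝓝 (∫ w, h w.2.1 * χ w.2.2 ∂(ν : Measure (S × S × Proj m)))) := by
  refine tendsto_of_approx fun ε hε => ?_
  have hi : Integrable h μ :=
    Integrable.of_bound hh.aestronglyMeasurable R (Eventually.of_forall hR)
  obtain ⟨g, hg, hgi⟩ := hi.exists_boundedContinuous_integral_sub_le hε
  have hχn : ∀ p, ‖(χ p : ℂ)‖ ≤ 1 := fun p => by
    rw [Complex.norm_real, Real.norm_eq_abs, abs_of_nonneg (hχ0 p)]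
    exact hχ1 p
  have hgc : Continuous fun w : S × S × Proj m => g w.2.1 * (χ w.2.2 : ℂ) :=
    (g.continuous.comp (by fun_prop)).mul
      (Complex.continuous_ofReal.comp (hχ.comp (by fun_prop)))
  have hgb : ∀ w : S × S × Proj m, ‖g w.2.1 * (χ w.2.2 : ℂ)‖ ≤ ‖g‖ := fun w => by
    rw [norm_mul]
    exact (mul_le_of_le_one_right (norm_nonneg _) (hχn _)).trans (g.norm_coe_le_norm _)
  let G : BoundedContinuousFunction (S × S × Proj m) ℂ :=
    BoundedContinuousFunction.ofNormedAddCommGroup _ hgc ‖g‖ hgb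
  have happ : ∀ Q : ProbabilityMeasure (S × S × Proj m),
      (Q : Measure (S × S × Proj m)).map (fun w => w.2.1) = μ →
      ‖∫ w, h w.2.1 * χ w.2.2 ∂(Q : Measure (S × S × Proj m)) -
        ∫ w, G w ∂(Q : Measure (S × S × Proj m))‖ ≤ ε := by
    intro Q hQ
    have hm : Measurable fun w : S × S × Proj m => w.2.1 := by fun_prop
    have h1 : Integrable (fun w : S × S × Proj m => h w.2.1 * (χ w.2.2 : ℂ)) Q := by
      refine Integrable.of_bound (Measurable.aestronglyMeasurable ?_) R
        (Eventually.of_forall fun w => ?_)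
      · exact (hh.comp hm).mul (Complex.measurable_ofReal.comp (hχ.measurable.comp (by fun_prop)))
      · rw [norm_mul]
        exact (mul_le_of_le_one_right (norm_nonneg _) (hχn _)).trans (hR _)
    have h2 : Integrable (fun w : S × S × Proj m => G w) Q := G.integrable _
    rw [← integral_sub h1 h2]
    have hgh : Integrable (fun y => ‖h y - g y‖) ((Q : Measure (S × S × Proj m)).map
        (fun w => w.2.1)) := by
      rw [hQ]; exact (hi.sub hgi).norm
    calc _ ≤ ∫ w, ‖h w.2.1 * (χ w.2.2 : ℂ) - G w‖ ∂(Q : Measure (S × S × Proj m)) :=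
          norm_integral_le_integral_norm _
      _ ≤ ∫ w, ‖h w.2.1 - g w.2.1‖ ∂(Q : Measure (S × S × Proj m)) := by
          refine integral_mono (h1.sub h2).norm (hgh.comp_measurable hm) fun w => ?_
          change ‖h w.2.1 * (χ w.2.2 : ℂ) - g w.2.1 * (χ w.2.2 : ℂ)‖ ≤ _
          rw [← sub_mul, norm_mul]
          exact mul_le_of_le_one_right (norm_nonneg _) (hχn _)
      _ = ∫ y, ‖h y - g y‖ ∂μ := by
          rw [← hQ, integral_map hm.aemeasurable]
          exact hgh.aestronglyMeasurable
      _ ≤ ε := hg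
  exact ⟨_, _, (ProbabilityMeasure.tendsto_iff_forall_integral_rclike_tendsto ℂ).1 ht G,
    fun i => happ (P i) (hP i), happ ν hν⟩

/-- Hölder functions are uniform limits of sums of products `h(y) χ(p)` with `h` measurable and `χ`
continuous, obtained from a fine partition of unity of the fibre, so that `tendsto_integral_mul`
applies. -/
theorem IsHolder.tendsto_integral {ι : Type*} {F : Filter ι}
    {P : ι → ProbabilityMeasure (S × S × Proj m)} {ν : ProbabilityMeasure (S × S × Proj m)}
    (ht : Tendsto P F (𝓝 ν))
    (hP : ∀ i, (P i : Measure (S × S × Proj m)).map (fun w => w.2.1) = μ)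
    (hν : (ν : Measure (S × S × Proj m)).map (fun w => w.2.1) = μ) {α R H : ℝ} (hα : 0 < α)
    (hH : 0 ≤ H) {f : S × S × Proj m → ℂ} (hf : IsHolder α R H f) :
    Tendsto (fun i => ∫ w, f w ∂(P i : Measure (S × S × Proj m))) F
      (𝓝 (∫ w, f w ∂(ν : Measure (S × S × Proj m)))) := by
  refine tendsto_of_approx fun ε hε => ?_
  obtain ⟨x₀⟩ : Nonempty S := μ.nonempty_of_neZero
  obtain ⟨r, hr, hrε⟩ : ∃ r : ℝ, 0 < r ∧ H * r ^ α ≤ ε := by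
    have h1 : Tendsto (fun r : ℝ => H * r ^ α) (𝓝[>] 0) (𝓝 (H * 0)) := by
      refine Tendsto.const_mul H ?_
      have := (Real.continuousAt_rpow_const 0 α (Or.inr hα.le)).tendsto
      rw [Real.zero_rpow hα.ne'] at this
      exact this.mono_left nhdsWithin_le_nhds
    rw [mul_zero] at h1
    obtain ⟨r, hr, hr0⟩ := ((h1.eventually_le_const hε).and self_mem_nhdsWithin).exists
    exact ⟨r, hr0, hr⟩
  obtain ⟨t, χ, hχc, hχ0, hχ1, hχs, hχr⟩ := exists_partition_of_unity_proj (m := m) hr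
  have hhm : ∀ i : Proj m, Measurable fun y => f (x₀, y, i) := fun i =>
    hf.measurable.comp (by fun_prop)
  have hχn : ∀ i ∈ t, ∀ p, ‖(χ i p : ℂ)‖ ≤ 1 := fun i hi p => by
    rw [Complex.norm_real, Real.norm_eq_abs, abs_of_nonneg (hχ0 i p)]
    exact hχ1 i hi p
  have hint : ∀ Q : ProbabilityMeasure (S × S × Proj m), ∀ i ∈ t,
      Integrable (fun w : S × S × Proj m => f (x₀, w.2.1, i) * (χ i w.2.2 : ℂ)) Q := by
    intro Q i hi
    refine Integrable.of_bound (Measurable.aestronglyMeasurable ?_) R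
      (Eventually.of_forall fun w => ?_)
    · exact ((hhm i).comp (by fun_prop)).mul
        (Complex.measurable_ofReal.comp ((hχc i).measurable.comp (by fun_prop)))
    · rw [norm_mul]
      exact (mul_le_of_le_one_right (norm_nonneg _) (hχn i hi _)).trans (hf.bound _)
  have hpt : ∀ w : S × S × Proj m,
      ‖f w - ∑ i ∈ t, f (x₀, w.2.1, i) * (χ i w.2.2 : ℂ)‖ ≤ ε := by
    rintro ⟨x, y, p⟩
    have h1 : f (x, y, p) = ∑ i ∈ t, f (x, y, p) * (χ i p : ℂ) := by
      rw [← Finset.mul_sum, ← Complex.ofReal_sum, hχs, Complex.ofReal_one, mul_one]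
    rw [h1, ← Finset.sum_sub_distrib]
    calc _ ≤ ∑ i ∈ t, ‖f (x, y, p) * (χ i p : ℂ) - f (x₀, y, i) * (χ i p : ℂ)‖ := norm_sum_le _ _
      _ ≤ ∑ i ∈ t, ε * χ i p := by
          refine Finset.sum_le_sum fun i _ => ?_
          rw [← sub_mul, norm_mul, Complex.norm_real, Real.norm_eq_abs, abs_of_nonneg (hχ0 i p)]
          by_cases h0 : χ i p = 0
          · simp [h0]
          · refine mul_le_mul_of_nonneg_right ?_ (hχ0 i p)
            rw [hf.indep x₀ x]
            refine (hf.holder x y p i).trans (le_trans ?_ hrε)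
            have := projDist_nonneg p i
            gcongr
            exact hχr i p h0
      _ = ε := by rw [← Finset.mul_sum, hχs, mul_one]
  have happ : ∀ Q : ProbabilityMeasure (S × S × Proj m),
      ‖∫ w, f w ∂(Q : Measure (S × S × Proj m)) -
        ∑ i ∈ t, ∫ w, f (x₀, w.2.1, i) * (χ i w.2.2 : ℂ) ∂(Q : Measure (S × S × Proj m))‖ ≤ ε := by
    intro Q
    rw [← integral_finsetSum _ (hint Q), ← integral_sub]
    · have := norm_integral_le_of_norm_le_const (μ := (Q : Measure (S × S × Proj m)))
        (f := fun w => f w - ∑ i ∈ t, f (x₀, w.2.1, i) * (χ i w.2.2 : ℂ)) (C := ε)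
        (Eventually.of_forall hpt)
      simpa using this
    · exact Integrable.of_bound hf.measurable.aestronglyMeasurable R (Eventually.of_forall hf.bound)
    · exact integrable_finsetSum _ (hint Q)
  refine ⟨_, _, tendsto_finsetSum t fun i hi => ?_, fun i => happ (P i), happ ν⟩
  exact tendsto_integral_mul ht hP hν (hhm i) (fun y => hf.bound _) (hχc i) (hχ0 i) (hχ1 i hi)

end Limit

/-! ### Stationary measures -/

theorem integral_bind_kernel {X : Type*} [MeasurableSpace X] {κ : Kernel X X} [IsMarkovKernel κ]
    {ν : Measure X} [IsProbabilityMeasure ν] {f : X → ℂ} (hf : Measurable f) {R : ℝ}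
    (hb : ∀ w, ‖f w‖ ≤ R) : ∫ w, f w ∂(ν.bind κ) = ∫ w, ∫ w', f w' ∂(κ w) ∂ν := by
  have e : (κ ∘ₖ Kernel.const Unit ν) () = ν.bind κ := by
    rw [Kernel.comp_apply, Kernel.const_apply]
  have hi : Integrable f ((κ ∘ₖ Kernel.const Unit ν) ()) :=
    Integrable.of_bound hf.aestronglyMeasurable R (Eventually.of_forall hb)
  rw [← e, Kernel.integral_comp hi, Kernel.const_apply]

instance isProbabilityMeasure_bind_kernel {X : Type*} [MeasurableSpace X] {κ : Kernel X X}
    [IsMarkovKernel κ] {ν : Measure X} [IsProbabilityMeasure ν] :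
    IsProbabilityMeasure (ν.bind κ) :=
  ⟨by rw [Measure.bind_apply MeasurableSet.univ κ.aemeasurable]; simp⟩

section Ext

variable {S : Type*} [MeasurableSpace S] {m : ℕ}

/-- A finite measure on `S × S × P(ℝᵐ)` is determined by the integrals of bounded measurable
functions which are Lipschitz in the fibre. -/
theorem measure_ext_of_lipschitz {ν₁ ν₂ : Measure (S × S × Proj m)} [IsFiniteMeasure ν₁]
    [IsFiniteMeasure ν₂]
    (h : ∀ (F : S × S × Proj m → ℂ) (H : ℝ), 0 ≤ H → Measurable F → (∀ w, ‖F w‖ ≤ 1) →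
      (∀ x y p q, ‖F (x, y, p) - F (x, y, q)‖ ≤ H * projDist p q) →
      ∫ w, F w ∂ν₁ = ∫ w, F w ∂ν₂) : ν₁ = ν₂ := by
  refine Measure.ext_prod₃ fun {s t u} hs ht hu => ?_
  set D : Set (S × S × Proj m) := s ×ˢ t ×ˢ Set.univ
  have hD : MeasurableSet D := hs.prod (ht.prod MeasurableSet.univ)
  have hpm : Measurable fun w : S × S × Proj m => w.2.2 := by fun_prop
  have key : (ν₁.restrict D).map (fun w => w.2.2) = (ν₂.restrict D).map (fun w => w.2.2) := by
    refine measure_proj_ext fun φ H hH hφ hφ0 hφ1 hφL => ?_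
    have hF := h (D.indicator fun w => (φ w.2.2 : ℂ)) H hH
      ((Complex.measurable_ofReal.comp (hφ.measurable.comp hpm)).indicator hD) (fun w => by
        refine (norm_indicator_le_norm_self _ _).trans ?_
        rw [Complex.norm_real, Real.norm_eq_abs, abs_of_nonneg (hφ0 _)]
        exact hφ1 _) (fun x y p q => by
        have h0 := projDist_nonneg p q
        by_cases hxy : x ∈ s ∧ y ∈ t
        · have h1 : ∀ p, (x, y, p) ∈ D := fun p => ⟨hxy.1, hxy.2, trivial⟩
          rw [Set.indicator_of_mem (h1 p), Set.indicator_of_mem (h1 q), ← Complex.ofReal_sub,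
            Complex.norm_real]
          exact hφL p q
        · have h1 : ∀ p, (x, y, p) ∉ D := fun p hp => hxy ⟨hp.1, hp.2.1⟩
          rw [Set.indicator_of_notMem (h1 p), Set.indicator_of_notMem (h1 q), sub_zero, norm_zero]
          positivity)
    rw [integral_indicator hD, integral_indicator hD, integral_complex_ofReal,
      integral_complex_ofReal, Complex.ofReal_inj] at hF
    rw [integral_map hpm.aemeasurable hφ.measurable.aestronglyMeasurable,
      integral_map hpm.aemeasurable hφ.measurable.aestronglyMeasurable]
    exact hF
  have h1 := congrArg (fun ν : Measure (Proj m) => ν u) key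
  simp only [Measure.map_apply hpm hu, Measure.restrict_apply (hpm hu)] at h1
  have e : (fun w : S × S × Proj m => w.2.2) ⁻¹' u ∩ D = s ×ˢ t ×ˢ u := by
    ext w
    simp only [D, Set.mem_inter_iff, Set.mem_preimage, Set.mem_prod, Set.mem_univ]
    tauto
  rwa [e] at h1

end Ext

namespace RandCocycle

section Kernel

variable {S : Type*} [MeasurableSpace S] {m : ℕ} {A : RandCocycle S m} {c : ℝ} {K : Kernel S S}
  [IsMarkovKernel K] {μ : Measure S} [IsProbabilityMeasure μ]

instance isMarkovKernel_kernel : IsMarkovKernel (A.kernel K) :=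
  Kernel.IsMarkovKernel.map _ A.measurable_step

theorem integral_kernel {f : S × S × Proj m → ℂ} (hf : Measurable f) (w : S × S × Proj m) :
    ∫ w', f w' ∂(A.kernel K w) = A.markovOp K f w := by
  rw [kernel_apply, integral_map _ hf.aestronglyMeasurable]
  · rfl
  · exact (A.measurable_step.comp (f := fun z => (w, z)) (by fun_prop)).aemeasurable

theorem integral_bind {ν : Measure (S × S × Proj m)} [IsProbabilityMeasure ν]
    {f : S × S × Proj m → ℂ} (hf : Measurable f) {R : ℝ} (hb : ∀ w, ‖f w‖ ≤ R) :
    ∫ w, f w ∂(ν.bind (A.kernel K)) = ∫ w, A.markovOp K f w ∂ν := by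
  rw [integral_bind_kernel hf hb]
  simp_rw [integral_kernel hf]

theorem map_bind_kernel (ν : Measure (S × S × Proj m)) :
    (ν.bind (A.kernel K)).map (fun w => w.2.1) = (ν.map fun w => w.2.1).bind K := by
  have hm : Measurable fun w : S × S × Proj m => w.2.1 := by fun_prop
  ext s hs
  rw [Measure.map_apply hm hs, Measure.bind_apply (hm hs) (A.kernel K).aemeasurable,
    Measure.bind_apply hs K.aemeasurable, lintegral_map (K.measurable_coe hs) hm]
  refine lintegral_congr fun w => ?_
  rw [kernel_apply, Measure.map_apply _ (hm hs)]
  · rfl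
  · exact A.measurable_step.comp (f := fun z => (w, z)) (by fun_prop)

/-- One step of the Markov operator removes the dependence on the first coordinate, so that it
sends functions which are Lipschitz in the fibre, and otherwise arbitrary, to Hölder functions. -/
theorem HasBound.isHolder_markovOp_of_lipschitz (hA : A.HasBound c) (hm : 2 ≤ m) :
    ∃ L : ℝ, 0 ≤ L ∧ ∀ (F : S × S × Proj m → ℂ) (R H α : ℝ), 0 ≤ H → 0 ≤ α → α ≤ 1 →
      Measurable F → (∀ w, ‖F w‖ ≤ R) →
      (∀ x y p q, ‖F (x, y, p) - F (x, y, q)‖ ≤ H * projDist p q) →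
      IsHolder α R (L * H) (A.markovOp K F) := by
  obtain ⟨L, hL, h⟩ := exists_sinAngle_rpow_le (m := m) hm c hA.1
  refine ⟨L, by linarith, fun F R H α hH hα hα1 hF hR hFL =>
    ⟨measurable_markovOp hF, norm_markovOp_le hR, fun x y p q => ?_, fun _ _ _ _ => rfl⟩⟩
  simp only [markovOp]
  rw [← integral_sub (integrable_markovOp hF hR y p) (integrable_markovOp hF hR y q)]
  have hδ : L * H * projDist p q ≤ L * H * projDist p q ^ α := by
    have h0 := projDist_nonneg p q
    refine mul_le_mul_of_nonneg_left ?_ (by positivity)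
    rcases h0.eq_or_lt with h1 | h1
    · rw [← h1]; exact Real.rpow_nonneg le_rfl α
    · simpa using Real.rpow_le_rpow_of_exponent_ge h1 (projDist_le_one p q) hα1
  refine le_trans ?_ hδ
  have := norm_integral_le_of_norm_le_const (μ := K y) (C := L * H * projDist p q)
    (f := fun z => F (y, z, projAct (A.toFun y z) p) - F (y, z, projAct (A.toFun y z) q))
    (Eventually.of_forall fun z => ?_)
  · simpa using this
  · refine (hFL _ _ _ _).trans ?_
    rw [mul_comm L H, mul_assoc]
    refine mul_le_mul_of_nonneg_left ?_ hH
    induction p using Projectivization.ind with | h v hv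
    induction q using Projectivization.ind with | h w hw
    have hM := hA.2 (y, z)
    rw [projAct_mk y z hv (hM.map_ne_zero hv), projAct_mk y z hw (hM.map_ne_zero hw), projDist_mk,
      projDist_mk]
    simpa using h _ hM 1 zero_le_one le_rfl v w hv hw

/-- All iterates `Qⁿ f` of Hölder functions `f` approach constants, uniformly. -/
def IsFlattening (A : RandCocycle S m) (K : Kernel S S) (α : ℝ) : Prop :=
  ∀ (f : S × S × Proj m → ℂ) (R H : ℝ), 0 ≤ H → IsHolder α R H f →
    ∃ ε : ℕ → ℝ, Tendsto ε atTop (𝓝 0) ∧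
      ∀ n, ∃ a : ℂ, ∀ w, ‖(A.markovOp K)^[n] f w - a‖ ≤ ε n

theorem norm_integral_sub_le {ν : Measure (S × S × Proj m)} [IsProbabilityMeasure ν]
    {f : S × S × Proj m → ℂ} (hf : Measurable f) {R : ℝ} (hb : ∀ w, ‖f w‖ ≤ R) {a : ℂ} {ε : ℝ}
    (h : ∀ w, ‖f w - a‖ ≤ ε) : ‖∫ w, f w ∂ν - a‖ ≤ ε := by
  have hi : Integrable f ν :=
    Integrable.of_bound hf.aestronglyMeasurable R (Eventually.of_forall hb)
  have h1 : ∫ w, f w ∂ν - a = ∫ w, (f w - a) ∂ν := by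
    rw [integral_sub hi (integrable_const a)]
    simp
  rw [h1]
  have := norm_integral_le_of_norm_le_const (μ := ν) (f := fun w => f w - a) (C := ε)
    (Eventually.of_forall h)
  simpa using this

theorem integral_iterate_markovOp {ν : Measure (S × S × Proj m)} [IsProbabilityMeasure ν]
    (hν : Kernel.Invariant (A.kernel K) ν) {f : S × S × Proj m → ℂ} (hf : Measurable f) {R : ℝ}
    (hb : ∀ w, ‖f w‖ ≤ R) (n : ℕ) : ∫ w, (A.markovOp K)^[n] f w ∂ν = ∫ w, f w ∂ν := by
  induction n with
  | zero => rfl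
  | succ n ih =>
    rw [Function.iterate_succ_apply', ← integral_bind (measurable_iterate_markovOp hf n)
      (norm_iterate_markovOp_le hb n), hν.def, ih]

/-- A stationary measure integrates `Q F` like all `Qⁿ⁺¹ F`, hence like the constant approached by
these functions, and the class of functions `F` for which this applies determines measures. -/
theorem HasBound.invariant_unique (hA : A.HasBound c) (hm : 2 ≤ m) {α : ℝ} (hα : 0 ≤ α)
    (hα1 : α ≤ 1) (hfl : A.IsFlattening K α) {ν₁ ν₂ : Measure (S × S × Proj m)}
    [IsProbabilityMeasure ν₁] [IsProbabilityMeasure ν₂] (h₁ : Kernel.Invariant (A.kernel K) ν₁)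
    (h₂ : Kernel.Invariant (A.kernel K) ν₂) : ν₁ = ν₂ := by
  obtain ⟨L, hL, hQ⟩ := hA.isHolder_markovOp_of_lipschitz (K := K) hm
  refine measure_ext_of_lipschitz fun F H hH hF hF1 hFL => ?_
  have hg := hQ F 1 H α hH hα hα1 hF hF1 hFL
  obtain ⟨ε, hε, h⟩ := hfl _ _ _ (mul_nonneg hL hH) hg
  rw [← integral_iterate_markovOp h₁ hF hF1 1, ← integral_iterate_markovOp h₂ hF hF1 1]
  simp only [Function.iterate_one]
  refine sub_eq_zero.1 (norm_le_zero_iff.1 ?_)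
  refine ge_of_tendsto' (x := atTop) (f := fun n => ε n + ε n) (by simpa using hε.add hε)
    fun n => ?_
  obtain ⟨a, ha⟩ := h n
  have hgm := measurable_iterate_markovOp (A := A) (K := K) hg.measurable n
  have hgb := norm_iterate_markovOp_le (A := A) (K := K) hg.bound n
  rw [← integral_iterate_markovOp h₁ hg.measurable hg.bound n,
    ← integral_iterate_markovOp h₂ hg.measurable hg.bound n]
  have e1 := norm_integral_sub_le (ν := ν₁) hgm hgb ha
  have e2 := norm_integral_sub_le (ν := ν₂) hgm hgb ha
  rw [norm_sub_rev] at e2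
  exact (norm_sub_le_norm_sub_add_norm_sub _ a _).trans (add_le_add e1 e2)

end Kernel

section Existence

variable {S : Type*} [MetricSpace S] [CompactSpace S] [MeasurableSpace S] [BorelSpace S] {m : ℕ}
  {A : RandCocycle S m} {c : ℝ} {K : Kernel S S} [IsMarkovKernel K] {μ : Measure S}
  [IsProbabilityMeasure μ]

/-- Existence of a stationary measure. The fibre kernel is not Feller, so that a weak limit `ν` of
the laws of the chain at time `n` is only known to be stationary against Hölder functions; one
further step of the chain turns `ν` into a stationary measure. -/
theorem HasBound.exists_invariant (hA : A.HasBound c) (hm : 2 ≤ m) (hμ : Kernel.Invariant K μ)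
    {α : ℝ} (hα : 0 < α) (hα1 : α ≤ 1) (hfl : A.IsFlattening K α) :
    ∃ ν : Measure (S × S × Proj m), IsProbabilityMeasure ν ∧ Kernel.Invariant (A.kernel K) ν := by
  let p₀ : Proj m := Projectivization.mk ℝ (EuclideanSpace.single ⟨0, by omega⟩ 1) (by simp)
  have hι : Measurable fun y : S => (y, y, p₀) := by fun_prop
  have hsnd : Measurable fun w : S × S × Proj m => w.2.1 := by fun_prop
  set ν₀ : Measure (S × S × Proj m) := μ.map fun y => (y, y, p₀)
  have hν₀ : IsProbabilityMeasure ν₀ := Measure.isProbabilityMeasure_map hι.aemeasurable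
  obtain ⟨P, hP0, hPs⟩ : ∃ P : ℕ → ProbabilityMeasure (S × S × Proj m),
      ProbabilityMeasure.toMeasure (P 0) = ν₀ ∧ ∀ n, ProbabilityMeasure.toMeasure (P (n + 1)) =
        (ProbabilityMeasure.toMeasure (P n)).bind (A.kernel K) :=
    ⟨fun n => Nat.rec ⟨ν₀, hν₀⟩ (fun _ Q => ⟨(ProbabilityMeasure.toMeasure Q).bind (A.kernel K),
      inferInstance⟩) n, rfl, fun _ => rfl⟩
  have hmarg : ∀ n, (P n : Measure (S × S × Proj m)).map (fun w => w.2.1) = μ := by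
    intro n
    induction n with
    | zero =>
      rw [hP0, Measure.map_map hsnd hι]
      exact Measure.map_id
    | succ n ih => rw [hPs, map_bind_kernel, ih, hμ.def]
  have hint : ∀ n (f : S × S × Proj m → ℂ), Measurable f → ∀ R : ℝ, (∀ w, ‖f w‖ ≤ R) →
      ∫ w, f w ∂(P n : Measure (S × S × Proj m)) = ∫ w, (A.markovOp K)^[n] f w ∂ν₀ := by
    intro n
    induction n with
    | zero => intro f _ _ _; rw [hP0]; rfl
    | succ n ih =>
      intro f hf R hR
      rw [hPs, integral_bind hf hR, ih _ (measurable_markovOp hf) R (norm_markovOp_le hR),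
        Function.iterate_succ_apply]
  -- an ultrafilter limit avoids metrizability of the space of probability measures
  set U : Ultrafilter ℕ := hyperfilter ℕ
  have hU : (U : Filter ℕ) ≤ atTop := by
    rw [← Nat.cofinite_eq_atTop]; exact hyperfilter_le_cofinite
  set ν : ProbabilityMeasure (S × S × Proj m) := (U.map P).lim
  have hlim : Tendsto P U (𝓝 ν) := (U.map P).le_nhds_lim
  have hνmarg : (ν : Measure (S × S × Proj m)).map (fun w => w.2.1) = μ := by
    have hc : Continuous fun w : S × S × Proj m => w.2.1 := by fun_prop
    let μ' : ProbabilityMeasure S := ⟨μ, inferInstance⟩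
    have h1 := ((ProbabilityMeasure.continuous_map hc).tendsto ν).comp hlim
    have h2 : Tendsto ((fun Q : ProbabilityMeasure (S × S × Proj m) =>
        Q.map hc.measurable.aemeasurable) ∘ P) U (𝓝 μ') := by
      refine tendsto_const_nhds.congr fun n => ?_
      exact Subtype.ext (hmarg n).symm
    exact congrArg ProbabilityMeasure.toMeasure (tendsto_nhds_unique h1 h2)
  -- the limit is stationary against Hölder functions
  have hstat : ∀ (f : S × S × Proj m → ℂ) (R H : ℝ), 0 ≤ H → IsHolder α R H f →
      ∀ H', 0 ≤ H' → IsHolder α R H' (A.markovOp K f) →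
      ∫ w, A.markovOp K f w ∂(ν : Measure (S × S × Proj m)) =
        ∫ w, f w ∂(ν : Measure (S × S × Proj m)) := by
    intro f R H hH hf H' hH' hf'
    obtain ⟨ε, hε, h⟩ := hfl f R H hH hf
    have h1 := hf.tendsto_integral hlim hmarg hνmarg hα hH
    have h2 := hf'.tendsto_integral hlim hmarg hνmarg hα hH'
    refine sub_eq_zero.1 (norm_le_zero_iff.1 ?_)
    refine le_of_tendsto_of_tendsto (h2.sub h1).norm ((hε.add hε).mono_left hU |>.trans
      (by rw [add_zero])) (Eventually.of_forall fun n => ?_)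
    obtain ⟨a, ha⟩ := h n
    have hgm := measurable_iterate_markovOp (A := A) (K := K) hf.measurable n
    have hgb := norm_iterate_markovOp_le (A := A) (K := K) hf.bound n
    have e1 := norm_integral_sub_le (ν := ν₀) hgm hgb ha
    have e2 : ‖∫ w, (A.markovOp K)^[n + 1] f w ∂ν₀ - a‖ ≤ ε n := by
      rw [Function.iterate_succ_apply', ← integral_bind hgm hgb]
      exact norm_integral_sub_le hgm hgb ha
    simp only
    rw [hint n _ hf'.measurable R hf'.bound, ← Function.iterate_succ_apply,
      hint n _ hf.measurable R hf.bound]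
    rw [norm_sub_rev] at e1
    exact (norm_sub_le_norm_sub_add_norm_sub _ a _).trans (add_le_add e2 e1)
  obtain ⟨L, hL, hQ⟩ := hA.isHolder_markovOp_of_lipschitz (K := K) hm
  refine ⟨(ν : Measure (S × S × Proj m)).bind (A.kernel K), inferInstance, ?_⟩
  -- `F` need not be a Hölder function of two coordinates, but `Q F` is, and so is `Q (Q F)`
  refine measure_ext_of_lipschitz fun F H hH hF hF1 hFL => ?_
  have hg := hQ F 1 H α hH hα.le hα1 hF hF1 hFL
  have hg1 := hQ F 1 H 1 hH zero_le_one le_rfl hF hF1 hFL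
  have hg' := hQ _ 1 (L * H) α (mul_nonneg hL hH) hα.le hα1 hg.measurable hg.bound
    (fun x y p q => by simpa using hg1.holder x y p q)
  rw [integral_bind hF hF1, integral_bind hg.measurable hg.bound, integral_bind hF hF1]
  exact hstat _ 1 _ (mul_nonneg hL hH) hg _ (mul_nonneg hL (mul_nonneg hL hH)) hg'

end Existence

end RandCocycle

end MarkovCocycle

end

theorem mainTheorem6 {S : Type*} [MetricSpace S] [CompactSpace S] [MeasurableSpace S]
    [BorelSpace S] {m : ℕ} (hm : 2 ≤ m)
    (K : Kernel S S) [IsMarkovKernel K] (μ : Measure S) [IsProbabilityMeasure μ]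
    (hμ : Kernel.Invariant K μ) (hK : MarkovCocycle.IsStronglyMixing K μ)
    (A : MarkovCocycle.RandCocycle S m) (hA : A.IsIrreducible K μ)
    (hgap : A.lyapExp K μ 2 < A.lyapExp K μ 1) :
    ∃ V ∈ 𝓝 A, ∃ α₁ α₀ C σ : ℝ,
      0 < α₁ ∧ α₁ < α₀ / 2 ∧ α₀ ≤ 1 ∧ 0 < C ∧ 0 < σ ∧ σ < 1 ∧
      ∀ B ∈ V, ∃ μB : Measure (S × S × MarkovCocycle.Proj m),
        (IsProbabilityMeasure μB ∧ Kernel.Invariant (B.kernel K) μB) ∧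
        (∀ ν : Measure (S × S × MarkovCocycle.Proj m),
          IsProbabilityMeasure ν → Kernel.Invariant (B.kernel K) ν → ν = μB) ∧
        ∀ α ∈ Set.Icc α₁ α₀, ∀ f : S × S × MarkovCocycle.Proj m → ℂ,
          MarkovCocycle.MemHolder α f → ∀ n : ℕ,
            MarkovCocycle.MemHolder α ((B.markovOp K)^[n] f) ∧
            MarkovCocycle.holderNorm α (fun w => (B.markovOp K)^[n] f w - ∫ w', f w' ∂μB) ≤
              C * σ ^ n * MarkovCocycle.holderNorm α f := by
  obtain ⟨a, ha⟩ := A.exists_hasBound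
  obtain ⟨N, hN, hrate⟩ := ha.exists_integral_projRate_le hm hμ hK hA hgap
  obtain ⟨V, hV, c, α₀, hα₀, hα₀1, hnhds⟩ :=
    MarkovCocycle.RandCocycle.exists_nhds_lintegral_exp_projRate_le hm hrate
  have hc : 1 ≤ c := (hnhds A (mem_of_mem_nhds hV)).1.1
  -- moments of order `α` are contracted by `1 - α / 4`, uniformly on `α ≥ α₀ / 3`
  obtain ⟨C, σ, hC, hσ0, hσ1, hcontr⟩ :=
    MarkovCocycle.RandCocycle.exists_markovOp_contraction (s := 1 - α₀ / 3 / 4) hm hK hc hN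
      (by linarith) (by linarith)
  refine ⟨V, hV, α₀ / 3, α₀, 3 * C, σ, by positivity, by linarith, hα₀1, by positivity, hσ0, hσ1,
    fun B hB => ?_⟩
  obtain ⟨hBc, hexp⟩ := hnhds B hB
  have hiter : ∀ α ∈ Set.Icc (α₀ / 3) α₀, ∀ (f : S × S × MarkovCocycle.Proj m → ℂ) (R H : ℝ),
      0 ≤ H → MarkovCocycle.IsHolder α R H f → ∀ n : ℕ,
        MarkovCocycle.IsHolder α R (C * σ ^ n * H) ((B.markovOp K)^[n] f) ∧
        ∃ a : ℂ, ∀ w, ‖(B.markovOp K)^[n] f w - a‖ ≤ C * σ ^ n * (H + R) := by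
    intro α hα
    have h0 : 0 ≤ α := le_trans (by positivity) hα.1
    refine hcontr B hBc α h0 (hα.2.trans hα₀1) fun x v hv => ?_
    exact (hexp α h0 hα.2 x v hv).trans (ENNReal.ofReal_le_ofReal (by linarith [hα.1]))
  have hfl : B.IsFlattening K α₀ := by
    intro f R H hH hf
    refine ⟨fun n => C * σ ^ n * (H + R), ?_, fun n =>
      (hiter α₀ ⟨by linarith, le_rfl⟩ f R H hH hf n).2⟩
    have := ((tendsto_pow_atTop_nhds_zero_of_lt_one hσ0.le hσ1).const_mul C).mul_const (H + R)
    simpa using this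
  obtain ⟨μB, hμB, hinv⟩ := hBc.exists_invariant hm hμ hα₀ hα₀1 hfl
  refine ⟨μB, ⟨hμB, hinv⟩, fun ν hν hνinv =>
    hBc.invariant_unique hm hα₀.le hα₀1 hfl hνinv hinv, fun α hα f hf n => ?_⟩
  have hα0 : 0 < α := lt_of_lt_of_le (by positivity) hα.1
  set R := MarkovCocycle.supNorm f
  set H := MarkovCocycle.holderSeminorm α f
  have hR : 0 ≤ R := MarkovCocycle.supNorm_nonneg f
  have hH : 0 ≤ H := MarkovCocycle.holderSeminorm_nonneg α f
  have hfh := hf.isHolder hα0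
  obtain ⟨hn, a, hna⟩ := hiter α hα f R H hH hfh n
  refine ⟨hn.memHolder, ?_⟩
  have hσn : 0 < σ ^ n := by positivity
  -- the stationary mean of `f` is that of its iterates, hence as close to `a` as their values
  have hmean : ‖∫ w, f w ∂μB - a‖ ≤ C * σ ^ n * (H + R) := by
    rw [← MarkovCocycle.RandCocycle.integral_iterate_markovOp hinv hfh.measurable hfh.bound n]
    exact MarkovCocycle.RandCocycle.norm_integral_sub_le hn.measurable hn.bound hna
  have hsup : ∀ w, ‖(B.markovOp K)^[n] f w - ∫ w', f w' ∂μB‖ ≤ 2 * (C * σ ^ n * (H + R)) := by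
    intro w
    rw [norm_sub_rev] at hmean
    have := norm_sub_le_norm_sub_add_norm_sub ((B.markovOp K)^[n] f w) a (∫ w', f w' ∂μB)
    linarith [hna w]
  refine ((hn.sub_const _ hsup).holderNorm_le (by positivity) (by positivity)).trans ?_
  change _ ≤ 3 * C * σ ^ n * (H + R)
  have : 0 ≤ C * σ ^ n * R := by positivity
  nlinarith
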